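/- **Proposition 3.1.** Let $S$ be a closed oriented surface with a conformal class $[g]$ of Riemannian metrics and a spin structure $\chi$. For $\tilde g\in[g]$ let $D_{\tilde g}$ be the Dirac operator of $(S,\tilde g,\chi)$ and $\lambda_1(D_{\tilde g}^2)$ the smallest eigenvalue of its square, and put $$\lambda_{\min}^+(S,[g],\chi)=\inf_{\tilde g\in[g]}\sqrt{\lambda_1(D_{\tilde g}^2)}\;\mathrm{Area}(S,\tilde g)^{1/2}.$$ Let $\lambda_{\min}^+(\mathbb S^2)$ be this invariant for the round unit sphere with its unique spin structure. Let $$\mathcal M_1=\left\{(x,y)\in\mathbb R^2 : |x|\le \tfrac12,\; y^2+\left(|x|-\tfrac12\right)^2\ge\tfrac14,\; y>0\right\}.$$ For $(x,y)\in\mathcal M_1$ let $\Gamma_{x,y}\subset\mathbb R^2$ be the lattice generated by $(1,0)$ and $(x,y)$, and let $T_{x,y}$ be the torus $\mathbb R^2/\Gamma_{x,y}$ with the metric induced by the Euclidean metric of $\mathbb R^2$ and with the (non-trivial) spin structure given by the homomorphism $\chi_{x,y}:\Gamma_{x,y}\to\{-1,1\}$, $\chi_{x,y}(1,0)=1$,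 $\chi_{x,y}(x,y)=-1$; that is, in a parallel spin frame, spinor fields on $T_{x,y}$ are the maps $\psi:\mathbb R^2\to\mathbb C^2$ with $\psi(p+\gamma)=\chi_{x,y}(\gamma)\,\psi(p)$ for all $\gamma\in\Gamma_{x,y}$. Then $$0<\lambda_{\min}^+(T_{x,y})\le\lambda_{\min}^+(\mathbb S^2)\qquad\text{for all }(x,y)\in\mathcal M_1,$$ and the function $(x,y)\mapsto\lambda_{\min}^+(T_{x,y})$ is continuous on $\mathcal M_1$. -/

import Mathlib

open scoped ContDiff Matrix

noncomputable section

/-! ## Spinors and the Dirac operator in a conformal chart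

A chart is a copy of the oriented plane `ℂ = ℝ²` with a metric `f² g_eucl`, `f > 0`. Its positively
oriented orthonormal frame is `e₁ = f⁻¹ ∂₁`, `e₂ = f⁻¹ ∂₂` (coordinate directions `1` and `I`), and
a spinor field is given by its two complex components in a spin frame that lies over `(e₁, e₂)`. -/

/-- Clifford multiplication by `e₁` on the spinor module `ℂ²`. -/
def clifford₁ : Matrix (Fin 2) (Fin 2) ℂ := !![0, -1; 1, 0]

/-- Clifford multiplication by `e₂` on the spinor module `ℂ²`. -/
def clifford₂ : Matrix (Fin 2) (Fin 2) ℂ := !![0, Complex.I; Complex.I, 0]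

/-- The Clifford relations `eᵢ eⱼ + eⱼ eᵢ = -2 δᵢⱼ`. -/
theorem clifford_relations :
    clifford₁ * clifford₁ = -1 ∧ clifford₂ * clifford₂ = -1 ∧
      clifford₁ * clifford₂ + clifford₂ * clifford₁ = 0 := by
  refine ⟨?_, ?_, ?_⟩ <;> ext i j <;> fin_cases i <;> fin_cases j <;>
    simp [clifford₁, clifford₂, Matrix.mul_apply, Fin.sum_univ_two]

/-- The Levi-Civita connection form `v ↦ g(∇_v e₁, e₂)` of the metric `g = f² g_eucl`. With
`u = log f` it is `-(∂₂ u) dx + (∂₁ u) dy`. -/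
def connectionForm (f : ℂ → ℝ) (z v : ℂ) : ℝ :=
  -(fderiv ℝ (fun p => Real.log (f p)) z Complex.I) * v.re +
    (fderiv ℝ (fun p => Real.log (f p)) z 1) * v.im

/-- The spinor covariant derivative
`∇_v ψ = ∂_v ψ + (1/2) g(∇_v e₁, e₂) e₁ · e₂ · ψ` of the metric `f² g_eucl`. -/
def spinDeriv (f : ℂ → ℝ) (ψ : ℂ → Fin 2 → ℂ) (z v : ℂ) : Fin 2 → ℂ :=
  fderiv ℝ ψ z v + (connectionForm f z v / 2) • ((clifford₁ * clifford₂) *ᵥ ψ z)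

/-- The Dirac operator `D ψ = e₁ · ∇_{e₁} ψ + e₂ · ∇_{e₂} ψ` of the metric `f² g_eucl`, where
`eᵢ = f⁻¹ ∂ᵢ`. -/
def chartDirac (f : ℂ → ℝ) (ψ : ℂ → Fin 2 → ℂ) (z : ℂ) : Fin 2 → ℂ :=
  (f z)⁻¹ • (clifford₁ *ᵥ spinDeriv f ψ z 1 + clifford₂ *ᵥ spinDeriv f ψ z Complex.I)

/-! ## Surfaces with a conformal structure, an orientation and a spin structure -/

/-- An oriented conformal surface with a spin structure, given by an atlas. Each chart `i : ι` is
parametrized by all of `ℂ` (possibly as a covering of its image), and the point `z ∈ U j` of the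
chart `src j` is the same point of the surface as `τ j z` of the chart `tgt j`. The spin structure
is the choice, for every transition, of a square root `s j` of the rotation `τ' / |τ'|`. The sets
`dom i` together represent almost every point of the surface exactly once. -/
structure SpinAtlas (ι J : Type) where
  src : J → ι
  tgt : J → ι
  U : J → Set ℂ
  τ : J → ℂ → ℂ
  s : J → ℂ → ℂ
  dom : ι → Set ℂ
  isOpen_U : ∀ j, IsOpen (U j)
  holo : ∀ j, DifferentiableOn ℂ (τ j) (U j)
  deriv_ne : ∀ j, ∀ z ∈ U j, deriv (τ j) z ≠ 0
  s_cont : ∀ j, ContinuousOn (s j) (U j)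
  s_sq : ∀ j, ∀ z ∈ U j, s j z ^ 2 = deriv (τ j) z / (‖deriv (τ j) z‖ : ℂ)

namespace SpinAtlas

variable {ι J : Type}

/-- `f` is a smooth Riemannian metric in the conformal class of `S`: it is `(f i)² g_eucl` in the
chart `i`. -/
structure IsMetric (S : SpinAtlas ι J) (f : ι → ℂ → ℝ) : Prop where
  smooth : ∀ i, ContDiff ℝ ∞ (f i)
  pos : ∀ i z, 0 < f i z
  compat : ∀ j, ∀ z ∈ S.U j, f (S.src j) z = f (S.tgt j) (S.τ j z) * ‖deriv (S.τ j) z‖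

/-- `ψ` is a smooth spinor field on `S`. If the orthonormal frame of the chart `tgt j` is the frame
of `src j` rotated by the angle `θ`, then `exp (i θ) = |τ'| / τ'`, and the components of a spinor
change by the lift `exp ((θ/2) e₁ e₂) = diag (exp (-i θ/2), exp (i θ/2))` to the spin group that
the spin structure selects, which is `diag (s, conj s)`. -/
structure IsSpinor (S : SpinAtlas ι J) (ψ : ι → ℂ → Fin 2 → ℂ) : Prop where
  smooth : ∀ i, ContDiff ℝ ∞ (ψ i)
  compat : ∀ j, ∀ z ∈ S.U j,
    ψ (S.src j) z =
      !![S.s j z, 0; 0, (starRingEnd ℂ) (S.s j z)] *ᵥ ψ (S.tgt j) (S.τ j z)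

/-- `μ` is an eigenvalue of the square of the Dirac operator of the metric `f`. -/
def IsDiracSqEigenvalue (S : SpinAtlas ι J) (f : ι → ℂ → ℝ) (μ : ℝ) : Prop :=
  ∃ ψ : ι → ℂ → Fin 2 → ℂ, S.IsSpinor ψ ∧ (∃ i, ψ i ≠ 0) ∧
    ∀ i, chartDirac (f i) (chartDirac (f i) (ψ i)) = μ • ψ i

/-- `λ₁(D²)`, the smallest eigenvalue of the square of the Dirac operator of the metric `f`. -/
def firstEigenvalue (S : SpinAtlas ι J) (f : ι → ℂ → ℝ) : ℝ :=
  sInf {μ : ℝ | S.IsDiracSqEigenvalue f μ}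

/-- The area of the surface in the metric `f`. -/
def area [Fintype ι] (S : SpinAtlas ι J) (f : ι → ℂ → ℝ) : ℝ :=
  ∑ i, ∫ z in S.dom i, f i z ^ 2

/-- `λ_min⁺`, the infimum of `√λ₁(D²) · Area^(1/2)` over all metrics in the conformal class. -/
def lamMin [Fintype ι] (S : SpinAtlas ι J) : ℝ :=
  sInf {v : ℝ | ∃ f, S.IsMetric f ∧ v = √(S.firstEigenvalue f) * √(S.area f)}

end SpinAtlas

/-! ## Flat tori and the sphere -/

/-- The flat torus `ℝ²/Γ`, where `Γ` is generated by `(1, 0)` and `(x, y)`, with the spin structure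
`χ : Γ → {-1, 1}`, `χ (1, 0) = ε₁`, `χ (x, y) = ε₂`. The only chart is the universal covering, the
transitions are the translations by the elements of `Γ`, and `dom` is the parallelogram spanned by
the two generators. The spin structure is trivial if and only
if `ε₁ = ε₂ = 1`. -/
def flatTorus (x y : ℝ) (ε₁ ε₂ : ℤˣ) : SpinAtlas Unit (ℤ × ℤ) where
  src := fun _ => ()
  tgt := fun _ => ()
  U := fun _ => Set.univ
  τ := fun γ z => z + (γ.1 + γ.2 * (⟨x, y⟩ : ℂ))
  s := fun γ _ => (((ε₁ ^ γ.1 * ε₂ ^ γ.2 : ℤˣ) : ℤ) : ℂ)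
  dom := fun _ => (fun p : ℝ × ℝ => (p.1 + p.2 * (⟨x, y⟩ : ℂ) : ℂ)) '' (Set.Ico 0 1 ×ˢ Set.Ico 0 1)
  isOpen_U := fun _ => isOpen_univ
  holo := fun _ => by fun_prop
  deriv_ne := fun _ z _ => by simp
  s_cont := fun _ => continuousOn_const
  s_sq := fun γ z _ => by
    rcases Int.units_eq_one_or (ε₁ ^ γ.1 * ε₂ ^ γ.2) with h | h <;> simp [h]

/-- The sphere `S² = ℂ ∪ {∞}` with its standard conformal structure and its unique spin structure.
There are two charts, with coordinates `z` (`true`) and `w = 1 / z` (`false`). -/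
def sphere : SpinAtlas Bool Unit where
  src := fun _ => true
  tgt := fun _ => false
  U := fun _ => {0}ᶜ
  τ := fun _ z => z⁻¹
  s := fun _ z => Complex.I * (starRingEnd ℂ) z / (‖z‖ : ℂ)
  dom := fun i => if i then Set.univ else ∅
  isOpen_U := fun _ => isOpen_compl_singleton
  holo := fun _ => differentiableOn_inv
  deriv_ne := fun _ z hz => by simpa using hz
  s_cont := fun _ => by
    refine ContinuousOn.div (by fun_prop) (by fun_prop) ?_
    intro z hz
    simpa using hz
  s_sq := fun _ z hz => by
    have hz0 : z ≠ 0 := by simpa using hz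
    have hn : (‖z‖ : ℂ) ≠ 0 := by simpa using hz0
    have h := Complex.mul_conj' z
    simp only [deriv_inv, norm_neg, norm_inv, norm_pow, Complex.ofReal_inv, Complex.ofReal_pow]
    field_simp
    rw [Complex.I_sq]
    linear_combination (-((starRingEnd ℂ) z * z + ‖z‖ ^ 2)) * h

/-- The parameter domain `𝓜₁` of the spin-conformal moduli space of 2-tori with non-trivial spin
structure. -/
def moduliDomain : Set (ℝ × ℝ) :=
  {p | |p.1| ≤ 1 / 2 ∧ 1 / 4 ≤ p.2 ^ 2 + (|p.1| - 1 / 2) ^ 2 ∧ 0 < p.2}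

/-- The torus `T_{x,y}` with the spin structure `χ (1, 0) = 1`, `χ (x, y) = -1`. -/
def nontrivialSpinTorus (x y : ℝ) : SpinAtlas Unit (ℤ × ℤ) := flatTorus x y 1 (-1)

end

open scoped ContDiff Matrix
open MeasureTheory Set Filter Topology

noncomputable section

/-! ## Fourier series of functions on the unit square, antiperiodic in the second variable -/

/-! Rescaling a spinor by the square root of the conformal factor, φ = √f ψ, turns the Dirac
operator of f² g_eucl into the flat operators ∂₁ ± i∂₂ up to powers of f (`chartDirac_apply`). The
first component and the conjugate of the second then solve the same scalar equation ∂(f⁻¹ ∂̄φ) = -μ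
f φ (`chartEigen_of_dirac`), so the spectrum of D² is governed by the Rayleigh quotient of the
energy ∫ f⁻¹|∂̄φ|² by the mass ∫ f|φ|².

On a torus put z = s + tζ with ζ = x + iy. The domain becomes the unit square, the components are
periodic in s and antiperiodic in t, and the lattice enters only through P_ζ = ∂_t - ζ∂_s = -iy ∂̄.
The spin structure makes the symbol 2πi(n + 1/2 - ζm) nowhere zero, with linear growth. By
`torus_firstEigenvalue` and `gapBound_iff_le_lamMin`, λ_min⁺ is, up to √y, the inverse of the best κ
in `GapBound`: mass ≤ κ² · area · energy for all conformal factors F and all antiperiodic Φ.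

Positivity says that some finite κ works. Cauchy-Schwarz bounds the mass by √area times the square
of the L⁴ norm, the L⁴ norm is controlled by the H^{1/2} norm (`Twisted.integral_pow_four_le`), and
pairing P_ζΦ with a Fourier multiplier of Φ controls the H^{1/2} norm by the energy
(`TorusMetric.halfNorm_le`). Only the area of F enters, so the constant is uniform over the
conformal class.

For continuity, P_ζ is invertible: to Φ belongs Φ₀ with P_{ζ₀}Φ₀ = P_ζΦ. The two have the same
energy, and the same estimates bound the mass of Φ - Φ₀ by O(|ζ - ζ₀|²) times area times energy.
Hence the best constants differ by O(|ζ - ζ₀|) (`GapBound.perturb`).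

For the comparison with the sphere, a large multiple of the fundamental parallelogram contains any
compact subset of the plane. The torus inequality therefore holds in the plane for compactly
supported functions, with a scale-invariant constant (`lamMin_sq_mul_le_of_hasCompactSupport`). A
rescaled eigenspinor of the sphere decays like 1/|z| in a chart. Cutting it off linearly costs an
energy that is bounded but need not tend to zero, so the conformal factor is first enlarged by ε(1 +
|z|²)^(-3/4), which still has finite area and makes the error vanish; then ε → 0
(`lamMin_sq_mul_le_of_sphereSection`). Thus the squared torus invariant is at most μ · area for
every eigenvalue μ of every metric on the sphere.

The smallest eigenvalue is defined as a real infimum, which would be 0 on an empty spectrum, so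
eigenvalues must be shown to exist. This is the direct method (`exists_minimizing_sequence`) with
Rellich compactness and elliptic regularity, done by Fourier series on the torus and by localization
to squares on the sphere. On the torus the minimizer also identifies the first eigenvalue with the
Rayleigh infimum. -/

/-- Lebesgue measure on the unit square. -/
def cell : Measure (ℝ × ℝ) := volume.restrict (Ioc 0 1 ×ˢ Ioc 0 1)

instance : IsProbabilityMeasure cell := by
  constructor
  rw [cell, Measure.restrict_apply_univ, Measure.volume_eq_prod, Measure.prod_prod]
  simp

theorem cell_eq_prod :
    cell = (volume.restrict (Ioc (0:ℝ) 1)).prod (volume.restrict (Ioc (0:ℝ) 1)) := by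
  rw [cell, Measure.volume_eq_prod, Measure.prod_restrict]

/-- The exponentials `exp (2πi (m s + (n + 1/2) t))`. -/
def expo (k : ℤ × ℤ) (p : ℝ × ℝ) : ℂ :=
  Complex.exp (2 * Real.pi * Complex.I * (k.1 * p.1 + (k.2 + 1 / 2) * p.2))

theorem norm_expo (k : ℤ × ℤ) (p : ℝ × ℝ) : ‖expo k p‖ = 1 := by
  have : (2 * Real.pi * Complex.I * (k.1 * p.1 + (k.2 + 1 / 2) * p.2) : ℂ) =
      ((2 * Real.pi * (k.1 * p.1 + (k.2 + 1 / 2) * p.2) : ℝ) : ℂ) * Complex.I := by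
    push_cast; ring
  rw [expo, this, Complex.norm_exp_ofReal_mul_I]

theorem contDiff_expo (k : ℤ × ℤ) : ContDiff ℝ ∞ (expo k) := by
  unfold expo
  have h1 : ContDiff ℝ ∞ (fun p : ℝ × ℝ => (p.1 : ℂ)) := Complex.ofRealCLM.contDiff.comp contDiff_fst
  have h2 : ContDiff ℝ ∞ (fun p : ℝ × ℝ => (p.2 : ℂ)) := Complex.ofRealCLM.contDiff.comp contDiff_snd
  exact (contDiff_const.mul ((contDiff_const.mul h1).add (contDiff_const.mul h2))).cexp

/-- The Fourier coefficients of a function on the unit square. -/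
def coef (v : ℝ × ℝ → ℂ) (k : ℤ × ℤ) : ℂ := ∫ p, v p * (starRingEnd ℂ) (expo k p) ∂cell

section Torus

-- Normalized Haar measure makes the monomials on the torus orthonormal and `cellRep` measure
-- preserving.
local instance : MeasureSpace UnitAddCircle := ⟨AddCircle.haarAddCircle⟩

/-- The representative in the unit square of a point of the torus. -/
def cellRep (x : UnitAddTorus (Fin 2)) : ℝ × ℝ :=
  ((AddCircle.equivIoc 1 0 (x 0)).1, (AddCircle.equivIoc 1 0 (x 1)).1)

theorem measurePreserving_cellRep : MeasurePreserving cellRep volume cell := by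
  have h1 := UnitAddTorus.measurePreserving_equivPiIoc (d := Fin 2) (fun _ => 0)
  have hm : MeasurableSet {x : Fin 2 → ℝ | ∀ i, x i ∈ Ioc (0:ℝ) (0 + 1)} :=
    MeasurableSet.univ_pi' (fun i => measurableSet_Ioc)
  have h2 : MeasurePreserving (Subtype.val : {x : Fin 2 → ℝ // ∀ i, x i ∈ Ioc (0:ℝ) (0 + 1)} → _)
      (Measure.comap Subtype.val volume)
      (volume.restrict {x : Fin 2 → ℝ | ∀ i, x i ∈ Ioc (0:ℝ) (0 + 1)}) :=
    ⟨measurable_subtype_coe, map_comap_subtype_coe hm volume⟩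
  have h3 := (volume_preserving_finTwoArrow ℝ).restrict_preimage
    (s := Ioc (0:ℝ) 1 ×ˢ Ioc (0:ℝ) 1) (measurableSet_Ioc.prod measurableSet_Ioc)
  have h4 : (⇑(MeasurableEquiv.finTwoArrow (α := ℝ)) ⁻¹' (Ioc (0:ℝ) 1 ×ˢ Ioc (0:ℝ) 1)) =
      {x : Fin 2 → ℝ | ∀ i, x i ∈ Ioc (0:ℝ) (0 + 1)} := by
    ext x
    simp [MeasurableEquiv.finTwoArrow, Fin.forall_fin_two]
  rw [h4] at h3
  exact h3.comp (h2.comp h1)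

/-- A phase that turns antiperiodic into periodic. -/
def halfPhase (t : ℝ) : ℂ := Complex.exp (Real.pi * t * Complex.I)

theorem norm_halfPhase (t : ℝ) : ‖halfPhase t‖ = 1 := by
  rw [halfPhase, ← Complex.ofReal_mul, Complex.norm_exp_ofReal_mul_I]

theorem continuous_halfPhase : Continuous halfPhase := by unfold halfPhase; fun_prop

theorem halfPhase_mul_conj (t : ℝ) : halfPhase t * (starRingEnd ℂ) (halfPhase t) = 1 := by
  rw [Complex.mul_conj, Complex.normSq_eq_norm_sq, norm_halfPhase]; simp

theorem expo_cellRep (k : ℤ × ℤ) (x : UnitAddTorus (Fin 2)) :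
    expo k (cellRep x) = UnitAddTorus.mFourier ![k.1, k.2] x * halfPhase (cellRep x).2 := by
  have h (i : Fin 2) : x i = (((AddCircle.equivIoc 1 0 (x i)).1 : ℝ) : UnitAddCircle) :=
    ((AddCircle.equivIoc 1 0).symm_apply_apply (x i)).symm
  simp only [UnitAddTorus.mFourier, ContinuousMap.coe_mk, Fin.prod_univ_two, Matrix.cons_val_zero,
    Matrix.cons_val_one, expo, halfPhase, cellRep]
  conv_rhs => rw [h 0, h 1, fourier_coe_apply, fourier_coe_apply]
  simp only [← h 1]
  rw [← Complex.exp_add, ← Complex.exp_add]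
  congr 1
  push_cast
  ring

/-- The function on the torus that corresponds to an antiperiodic function on the square. -/
def toTorus (v : ℝ × ℝ → ℂ) (x : UnitAddTorus (Fin 2)) : ℂ :=
  v (cellRep x) * (starRingEnd ℂ) (halfPhase (cellRep x).2)

theorem memLp_toTorus {v : ℝ × ℝ → ℂ} (hv : MemLp v 2 cell) : MemLp (toTorus v) 2 volume := by
  have h1 : MemLp (fun p : ℝ × ℝ => v p * (starRingEnd ℂ) (halfPhase p.2)) 2 cell := by
    refine hv.of_le (hv.1.mul ?_) (Eventually.of_forall fun p => ?_)
    · exact (Complex.continuous_conj.comp (continuous_halfPhase.comp continuous_snd)).aestronglyMeasurable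
    · simp [norm_halfPhase]
  exact h1.comp_measurePreserving measurePreserving_cellRep

theorem mFourierCoeff_toTorus {v : ℝ × ℝ → ℂ} (hv : AEStronglyMeasurable v cell) (k : ℤ × ℤ) :
    UnitAddTorus.mFourierCoeff (toTorus v) ![k.1, k.2] = coef v k := by
  have hm : AEStronglyMeasurable (fun p => v p * (starRingEnd ℂ) (expo k p)) cell :=
    hv.mul (Complex.continuous_conj.comp (contDiff_expo k).continuous).aestronglyMeasurable
  rw [coef, ← measurePreserving_cellRep.map_eq]
  rw [← measurePreserving_cellRep.map_eq] at hm
  rw [integral_map measurePreserving_cellRep.measurable.aemeasurable hm]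
  unfold UnitAddTorus.mFourierCoeff
  congr 1 with x
  rw [expo_cellRep, UnitAddTorus.mFourier_neg, toTorus, map_mul, smul_eq_mul]
  ring

/-- Parseval's identity on the torus; the half phases of the two factors cancel in the product. -/
theorem hasSum_conj_coef_mul_coef {u v : ℝ × ℝ → ℂ} (hu : MemLp u 2 cell) (hv : MemLp v 2 cell) :
    HasSum (fun k => (starRingEnd ℂ) (coef u k) * coef v k)
      (∫ p, (starRingEnd ℂ) (u p) * v p ∂cell) := by
  have h := UnitAddTorus.hasSum_prod_mFourierCoeff (memLp_toTorus hu).toLp (memLp_toTorus hv).toLp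
  have hc (w : ℝ × ℝ → ℂ) (hw : MemLp w 2 cell) (k : ℤ × ℤ) :
      UnitAddTorus.mFourierCoeff ((memLp_toTorus hw).toLp (toTorus w)) ![k.1, k.2] = coef w k := by
    rw [← mFourierCoeff_toTorus hw.1]
    unfold UnitAddTorus.mFourierCoeff
    refine integral_congr_ae ?_
    filter_upwards [(memLp_toTorus hw).coeFn_toLp] with x hx
    rw [hx]
  have hm : AEStronglyMeasurable (fun p => (starRingEnd ℂ) (u p) * v p) cell :=
    (Complex.continuous_conj.comp_aestronglyMeasurable hu.1).mul hv.1
  have hint : (∫ t, (starRingEnd ℂ) ((memLp_toTorus hu).toLp (toTorus u) t) *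
      (memLp_toTorus hv).toLp (toTorus v) t) = ∫ p, (starRingEnd ℂ) (u p) * v p ∂cell := by
    rw [← measurePreserving_cellRep.map_eq] at hm ⊢
    rw [integral_map measurePreserving_cellRep.measurable.aemeasurable hm]
    refine integral_congr_ae ?_
    filter_upwards [(memLp_toTorus hu).coeFn_toLp, (memLp_toTorus hv).coeFn_toLp] with x h1 h2
    rw [h1, h2, toTorus, toTorus, map_mul, Complex.conj_conj]
    linear_combination ((starRingEnd ℂ) (u (cellRep x)) * v (cellRep x)) *
      halfPhase_mul_conj (cellRep x).2
  rw [hint] at h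
  have h' := ((finTwoArrowEquiv ℤ).symm.hasSum_iff).2 h
  refine h'.congr_fun fun k => ?_
  simp only [Function.comp_apply]
  have hk : (finTwoArrowEquiv ℤ).symm k = ![k.1, k.2] := rfl
  rw [hk, hc u hu, hc v hv]

theorem hasSum_norm_coef_sq {v : ℝ × ℝ → ℂ} (hv : MemLp v 2 cell) :
    HasSum (fun k => ‖coef v k‖ ^ 2) (∫ p, ‖v p‖ ^ 2 ∂cell) := by
  have h := hasSum_conj_coef_mul_coef hv hv
  have e (z : ℂ) : (starRingEnd ℂ) z * z = ((‖z‖ ^ 2 : ℝ) : ℂ) := by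
    rw [Complex.conj_mul']; push_cast; rfl
  simp only [e] at h
  rw [integral_complex_ofReal] at h
  exact Complex.hasSum_ofReal.1 h

/-- Riesz-Fischer. It produces weak derivatives from their Fourier coefficients. -/
theorem exists_coef_eq {a : ℤ × ℤ → ℂ} (ha : Summable fun k => ‖a k‖ ^ 2) :
    ∃ v, MemLp v 2 cell ∧ ∀ k, coef v k = a k := by
  have h2 : Memℓp (fun n : Fin 2 → ℤ => a (n 0, n 1)) 2 := by
    refine (memℓp_gen_iff (by norm_num)).2 ?_
    have := ((finTwoArrowEquiv ℤ).summable_iff).2 ha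
    refine this.congr fun n => ?_
    simp [finTwoArrowEquiv]
  set A : lp (fun _ : Fin 2 → ℤ => ℂ) 2 := ⟨_, h2⟩
  set V := UnitAddTorus.mFourierBasis.repr.symm A
  have hV (n : Fin 2 → ℤ) : UnitAddTorus.mFourierCoeff V n = a (n 0, n 1) := by
    rw [← UnitAddTorus.mFourierBasis_repr]
    simp [V, A]
  set v : ℝ × ℝ → ℂ := fun p => V ![(p.1 : UnitAddCircle), (p.2 : UnitAddCircle)] * halfPhase p.2
  have hrep (x : UnitAddTorus (Fin 2)) :
      (![((cellRep x).1 : UnitAddCircle), ((cellRep x).2 : UnitAddCircle)] : Fin 2 → UnitAddCircle) = x := by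
    ext i
    fin_cases i
    · exact (AddCircle.equivIoc 1 0).symm_apply_apply (x 0)
    · exact (AddCircle.equivIoc 1 0).symm_apply_apply (x 1)
  have hmk : MeasurePreserving (fun p : ℝ × ℝ =>
      (![(p.1 : UnitAddCircle), (p.2 : UnitAddCircle)] : UnitAddTorus (Fin 2))) cell volume := by
    refine ⟨?_, ?_⟩
    · refine measurable_pi_lambda _ fun i => ?_
      fin_cases i
      · exact AddCircle.measurable_mk'.comp measurable_fst
      · exact AddCircle.measurable_mk'.comp measurable_snd
    · rw [← measurePreserving_cellRep.map_eq, Measure.map_map _ measurePreserving_cellRep.measurable]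
      · simp only [Function.comp_def, hrep]
        exact Measure.map_id
      · refine measurable_pi_lambda _ fun i => ?_
        fin_cases i
        · exact AddCircle.measurable_mk'.comp measurable_fst
        · exact AddCircle.measurable_mk'.comp measurable_snd
  have hv : MemLp v 2 cell := by
    have h0 := (Lp.memLp V).comp_measurePreserving hmk
    refine h0.of_le (h0.1.mul (continuous_halfPhase.comp continuous_snd).aestronglyMeasurable)
      (Eventually.of_forall fun p => ?_)
    simp [v, norm_halfPhase]
  refine ⟨v, hv, fun k => ?_⟩
  rw [← mFourierCoeff_toTorus hv.1]
  have : toTorus v = V := by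
    ext x
    simp only [toTorus, v, hrep]
    rw [mul_assoc, halfPhase_mul_conj, mul_one]
  rw [this, hV]
  simp

end Torus

theorem ae_eq_zero_of_coef_eq_zero {v : ℝ × ℝ → ℂ} (hv : MemLp v 2 cell) (h : ∀ k, coef v k = 0) :
    v =ᵐ[cell] 0 := by
  have h1 := hasSum_norm_coef_sq hv
  simp only [h, norm_zero, ne_eq, OfNat.ofNat_ne_zero, not_false_eq_true, zero_pow] at h1
  have h2 : ∫ p, ‖v p‖ ^ 2 ∂cell = 0 := h1.unique hasSum_zero
  rw [integral_eq_zero_iff_of_nonneg (fun p => by positivity) (hv.integrable_norm_pow (by norm_num))] at h2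
  filter_upwards [h2] with p hp
  simpa using hp

theorem integrable_mul_conj_expo {v : ℝ × ℝ → ℂ} (hv : MemLp v 2 cell) (k : ℤ × ℤ) :
    Integrable (fun p => v p * (starRingEnd ℂ) (expo k p)) cell := by
  refine (hv.integrable (by norm_num)).mono (hv.1.mul
    (Complex.continuous_conj.comp (contDiff_expo k).continuous).aestronglyMeasurable)
    (Eventually.of_forall fun p => ?_)
  simp [norm_expo]

theorem coef_add {u v : ℝ × ℝ → ℂ} (hu : MemLp u 2 cell) (hv : MemLp v 2 cell) (k : ℤ × ℤ) :
    coef (fun p => u p + v p) k = coef u k + coef v k := by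
  simp only [coef, add_mul]
  exact integral_add (integrable_mul_conj_expo hu k) (integrable_mul_conj_expo hv k)

theorem coef_sub {u v : ℝ × ℝ → ℂ} (hu : MemLp u 2 cell) (hv : MemLp v 2 cell) (k : ℤ × ℤ) :
    coef (fun p => u p - v p) k = coef u k - coef v k := by
  simp only [coef, sub_mul]
  exact integral_sub (integrable_mul_conj_expo hu k) (integrable_mul_conj_expo hv k)

theorem coef_const_mul (c : ℂ) (v : ℝ × ℝ → ℂ) (k : ℤ × ℤ) :
    coef (fun p => c * v p) k = c * coef v k := by
  simp only [coef, mul_assoc]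
  exact integral_const_mul _ _

theorem coef_congr {u v : ℝ × ℝ → ℂ} (h : u =ᵐ[cell] v) (k : ℤ × ℤ) : coef u k = coef v k := by
  refine integral_congr_ae ?_
  filter_upwards [h] with p hp
  rw [hp]

theorem memLp_of_continuous {E : Type*} [NormedAddCommGroup E] [SecondCountableTopology E]
    {v : ℝ × ℝ → E} (hv : Continuous v) (q : ENNReal) : MemLp v q cell := by
  obtain ⟨C, hC⟩ := (isCompact_Icc.prod isCompact_Icc : IsCompact
    (Icc (0:ℝ) 1 ×ˢ Icc (0:ℝ) 1)).exists_bound_of_continuousOn hv.continuousOn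
  refine MemLp.of_bound hv.aestronglyMeasurable C ?_
  rw [cell]
  filter_upwards [ae_restrict_mem (measurableSet_Ioc.prod measurableSet_Ioc)] with p hp
  exact hC p ⟨Ioc_subset_Icc_self hp.1, Ioc_subset_Icc_self hp.2⟩

theorem integrable_of_continuous {E : Type*} [NormedAddCommGroup E] [SecondCountableTopology E]
    {v : ℝ × ℝ → E} (hv : Continuous v) : Integrable v cell :=
  memLp_one_iff_integrable.1 (memLp_of_continuous hv 1)

theorem norm_coef_le (v : ℝ × ℝ → ℂ) (k : ℤ × ℤ) : ‖coef v k‖ ≤ ∫ p, ‖v p‖ ∂cell := by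
  refine (norm_integral_le_integral_norm _).trans (le_of_eq ?_)
  simp [norm_expo]

/-! ## Smooth antiperiodic functions and rapidly decaying Fourier coefficients -/

theorem hasFDerivAt_expo (k : ℤ × ℤ) (p : ℝ × ℝ) :
    HasFDerivAt (expo k) ((2 * Real.pi * Complex.I * expo k p) •
      (((k.1 : ℂ) • (Complex.ofRealCLM.comp (ContinuousLinearMap.fst ℝ ℝ ℝ))) +
        ((k.2 + 1 / 2 : ℂ) • (Complex.ofRealCLM.comp (ContinuousLinearMap.snd ℝ ℝ ℝ))))) p := by
  have h1 : HasFDerivAt (fun p : ℝ × ℝ => (p.1 : ℂ))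
    (Complex.ofRealCLM.comp (ContinuousLinearMap.fst ℝ ℝ ℝ)) p :=
    (Complex.ofRealCLM.comp (ContinuousLinearMap.fst ℝ ℝ ℝ)).hasFDerivAt
  have h2 : HasFDerivAt (fun p : ℝ × ℝ => (p.2 : ℂ))
    (Complex.ofRealCLM.comp (ContinuousLinearMap.snd ℝ ℝ ℝ)) p :=
    (Complex.ofRealCLM.comp (ContinuousLinearMap.snd ℝ ℝ ℝ)).hasFDerivAt
  have h := (((h1.const_mul (k.1 : ℂ)).add (h2.const_mul (k.2 + 1 / 2 : ℂ))).const_mul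
    (2 * Real.pi * Complex.I : ℂ)).cexp
  refine h.congr_fderiv ?_
  ext <;> simp [expo] <;> ring

theorem fderiv_expo (k : ℤ × ℤ) (p v : ℝ × ℝ) :
    fderiv ℝ (expo k) p v = 2 * Real.pi * Complex.I * (k.1 * v.1 + (k.2 + 1 / 2) * v.2) * expo k p := by
  rw [(hasFDerivAt_expo k p).fderiv]
  simp
  ring

/-- Smooth functions on the plane that are periodic in the first and antiperiodic in the second
variable. -/
structure Twisted (Φ : ℝ × ℝ → ℂ) : Prop where
  smooth : ContDiff ℝ ∞ Φ
  twist : ∀ (m n : ℤ) (p : ℝ × ℝ), Φ (p + ((m:ℝ), (n:ℝ))) = (-1 : ℂ) ^ n * Φ p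

/-- Smooth doubly periodic functions. -/
structure Biperiodic {E : Type*} [NormedAddCommGroup E] [NormedSpace ℝ E] (F : ℝ × ℝ → E) :
    Prop where
  smooth : ContDiff ℝ ∞ F
  period : ∀ (m n : ℤ) (p : ℝ × ℝ), F (p + ((m:ℝ), (n:ℝ))) = F p

theorem fderiv_translate {E : Type*} [NormedAddCommGroup E] [NormedSpace ℝ E]
    (Φ : ℝ × ℝ → E) (q p : ℝ × ℝ) : fderiv ℝ (fun x => Φ (x + q)) p = fderiv ℝ Φ (p + q) :=
  fderiv_comp_add_right q

theorem neg_one_zpow_mul_self (n : ℤ) : (-1 : ℂ) ^ n * (-1 : ℂ) ^ n = 1 := by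
  rw [← mul_zpow]; simp

theorem conj_neg_one_zpow (n : ℤ) : (starRingEnd ℂ) ((-1 : ℂ) ^ n) = (-1 : ℂ) ^ n := by
  rw [map_zpow₀]; simp

theorem norm_neg_one_zpow (n : ℤ) : ‖(-1 : ℂ) ^ n‖ = 1 := by
  rw [norm_zpow]; simp

namespace Twisted

variable {Φ Ψ : ℝ × ℝ → ℂ}

protected theorem continuous (h : Twisted Φ) : Continuous Φ := h.smooth.continuous

protected theorem memLp (h : Twisted Φ) : MemLp Φ 2 cell := memLp_of_continuous h.continuous 2

protected theorem differentiable (h : Twisted Φ) : Differentiable ℝ Φ :=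
  h.smooth.differentiable (by simp)

protected theorem add (h : Twisted Φ) (h' : Twisted Ψ) : Twisted (fun p => Φ p + Ψ p) :=
  ⟨h.smooth.add h'.smooth, fun m n p => by rw [h.twist, h'.twist, mul_add]⟩

protected theorem const_mul (h : Twisted Φ) (c : ℂ) : Twisted (fun p => c * Φ p) :=
  ⟨contDiff_const.mul h.smooth, fun m n p => by rw [h.twist]; ring⟩

protected theorem sub (h : Twisted Φ) (h' : Twisted Ψ) : Twisted (fun p => Φ p - Ψ p) :=
  ⟨h.smooth.sub h'.smooth, fun m n p => by rw [h.twist, h'.twist, mul_sub]⟩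

protected theorem conj (h : Twisted Φ) : Twisted (fun p => (starRingEnd ℂ) (Φ p)) :=
  ⟨Complex.conjCLE.contDiff.comp h.smooth, fun m n p => by
    rw [h.twist, map_mul, conj_neg_one_zpow]⟩

protected theorem bimul (h : Twisted Φ) {F : ℝ × ℝ → ℂ} (hF : Biperiodic F) :
    Twisted (fun p => F p * Φ p) :=
  ⟨hF.smooth.mul h.smooth, fun m n p => by rw [h.twist, hF.period]; ring⟩

protected theorem mul (h : Twisted Φ) (h' : Twisted Ψ) : Biperiodic (fun p => Φ p * Ψ p) :=
  ⟨h.smooth.mul h'.smooth, fun m n p => by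
    rw [h.twist, h'.twist]; linear_combination Φ p * Ψ p * neg_one_zpow_mul_self n⟩

protected theorem fderiv (h : Twisted Φ) (v : ℝ × ℝ) : Twisted (fun p => fderiv ℝ Φ p v) := by
  refine ⟨(h.smooth.fderiv_right (m := ∞) (by simp)).clm_apply contDiff_const, fun m n p => ?_⟩
  rw [← fderiv_translate]
  have : (fun x => Φ (x + ((m:ℝ), (n:ℝ)))) = fun x => (-1 : ℂ) ^ n * Φ x := by
    ext x; exact h.twist m n x
  rw [this, fderiv_const_mul h.differentiable.differentiableAt]
  simp

end Twisted

theorem twisted_expo (k : ℤ × ℤ) : Twisted (expo k) := by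
  refine ⟨contDiff_expo k, fun m n p => ?_⟩
  have h : (-1 : ℂ) ^ n = Complex.exp (n * (Real.pi * Complex.I)) := by
    rw [Complex.exp_int_mul, Complex.exp_pi_mul_I]
  have h2 : Complex.exp (((k.1 * m + k.2 * n : ℤ) : ℂ) * (2 * Real.pi * Complex.I)) = 1 := by
    rw [Complex.exp_int_mul_two_pi_mul_I]
  rw [h, expo, expo, ← Complex.exp_add, ← one_mul (Complex.exp (_ + _)), ← h2, ← Complex.exp_add, h2]
  congr 1
  push_cast
  simp
  ring

protected theorem Biperiodic.fderiv {E : Type*} [NormedAddCommGroup E] [NormedSpace ℝ E] {F : ℝ × ℝ → E}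
    (h : Biperiodic F) (v : ℝ × ℝ) : Biperiodic (fun p => fderiv ℝ F p v) := by
  refine ⟨(h.smooth.fderiv_right (m := ∞) (by simp)).clm_apply contDiff_const, fun m n p => ?_⟩
  rw [← fderiv_translate]
  have : (fun x => F (x + ((m:ℝ), (n:ℝ)))) = F := by
    ext x; exact h.period m n x
  rw [this]

/-- By Fubini and the fundamental theorem of calculus, contributions of opposite sides of the square
cancel. This is the source of all integrations by parts on the torus. -/
theorem Biperiodic.integral_fderiv {F : ℝ × ℝ → ℂ} (h : Biperiodic F) (v : ℝ × ℝ) :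
    ∫ p, fderiv ℝ F p v ∂cell = 0 := by
  have hd : Differentiable ℝ F := h.smooth.differentiable (by simp)
  have hc (v : ℝ × ℝ) : Continuous (fun p => fderiv ℝ F p v) := (h.fderiv v).smooth.continuous
  have hi (v : ℝ × ℝ) := integrable_of_continuous (hc v)
  have h1 : ∫ p, fderiv ℝ F p (1, 0) ∂cell = 0 := by
    have hi1 := hi (1, 0)
    rw [cell_eq_prod] at hi1 ⊢
    rw [integral_prod_symm _ hi1]
    refine integral_eq_zero_of_ae (Eventually.of_forall fun t => ?_)
    simp only [Pi.zero_apply]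
    rw [← intervalIntegral.integral_of_le zero_le_one]
    have hder (s : ℝ) : HasDerivAt (fun s => F (s, t)) (fderiv ℝ F (s, t) (1, 0)) s := by
      have := (hd (s, t)).hasFDerivAt.comp_hasDerivAt s
        ((hasDerivAt_id s).prodMk (hasDerivAt_const s t))
      exact this
    rw [intervalIntegral.integral_eq_sub_of_hasDerivAt (fun s _ => hder s)
      (((hc (1, 0)).comp (by fun_prop : Continuous fun s : ℝ => (s, t))).intervalIntegrable _ _)]
    have := h.period 1 0 (0, t)
    simp at this
    simp [this]
  have h2 : ∫ p, fderiv ℝ F p (0, 1) ∂cell = 0 := by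
    have hi1 := hi (0, 1)
    rw [cell_eq_prod] at hi1 ⊢
    rw [integral_prod _ hi1]
    refine integral_eq_zero_of_ae (Eventually.of_forall fun s => ?_)
    simp only [Pi.zero_apply]
    rw [← intervalIntegral.integral_of_le zero_le_one]
    have hder (t : ℝ) : HasDerivAt (fun t => F (s, t)) (fderiv ℝ F (s, t) (0, 1)) t := by
      have := (hd (s, t)).hasFDerivAt.comp_hasDerivAt t
        ((hasDerivAt_const t s).prodMk (hasDerivAt_id t))
      exact this
    rw [intervalIntegral.integral_eq_sub_of_hasDerivAt (fun s _ => hder s)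
      (((hc (0, 1)).comp (by fun_prop : Continuous fun t : ℝ => (s, t))).intervalIntegrable _ _)]
    have := h.period 0 1 (s, 0)
    simp at this
    simp [this]
  have hv (p : ℝ × ℝ) : fderiv ℝ F p v = v.1 • fderiv ℝ F p (1, 0) + v.2 • fderiv ℝ F p (0, 1) := by
    rw [← map_smul, ← map_smul, ← map_add]; simp
  simp only [hv]
  rw [integral_add (f := fun p => v.1 • fderiv ℝ F p (1, 0)) (g := fun p => v.2 • fderiv ℝ F p (0, 1)) ((hi _).smul v.1) ((hi _).smul v.2), integral_smul, integral_smul, h1, h2]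
  simp

theorem Twisted.integral_fderiv_mul {Φ Ψ : ℝ × ℝ → ℂ} (h : Twisted Φ) (h' : Twisted Ψ) (v : ℝ × ℝ) :
    ∫ p, fderiv ℝ Φ p v * Ψ p ∂cell = -∫ p, Φ p * fderiv ℝ Ψ p v ∂cell := by
  have h0 := (h.mul h').integral_fderiv v
  have e (p : ℝ × ℝ) : fderiv ℝ (fun p => Φ p * Ψ p) p v =
      fderiv ℝ Φ p v * Ψ p + Φ p * fderiv ℝ Ψ p v := by
    rw [fderiv_fun_mul h.differentiable.differentiableAt h'.differentiable.differentiableAt]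
    simp
    ring
  simp only [e] at h0
  rw [integral_add (integrable_of_continuous ((h.fderiv v).mul h').smooth.continuous)
    (integrable_of_continuous (h.mul (h'.fderiv v)).smooth.continuous)] at h0
  exact eq_neg_of_add_eq_zero_left h0

theorem fderiv_conj {E : Type*} [NormedAddCommGroup E] [NormedSpace ℝ E] (Φ : E → ℂ) (p v : E) :
    fderiv ℝ (fun p => (starRingEnd ℂ) (Φ p)) p v = (starRingEnd ℂ) (fderiv ℝ Φ p v) := by
  have := Complex.conjCLE.comp_fderiv (f := Φ) (x := p)
  have h2 : fderiv ℝ (fun p => (starRingEnd ℂ) (Φ p)) p = fderiv ℝ (⇑Complex.conjCLE ∘ Φ) p := rfl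
  rw [h2, this]
  simp

/-- The operator `∂_t - ζ ∂_s`; it annihilates the functions that are holomorphic in `s + ζ t`. -/
def cauchyOp (ζ : ℂ) (Φ : ℝ × ℝ → ℂ) (p : ℝ × ℝ) : ℂ :=
  fderiv ℝ Φ p (0, 1) - ζ * fderiv ℝ Φ p (1, 0)

/-- The Fourier symbol of `∂_t - ζ ∂_s`. -/
def symb (ζ : ℂ) (k : ℤ × ℤ) : ℂ := 2 * Real.pi * Complex.I * ((k.2 + 1 / 2) - ζ * k.1)

theorem Twisted.cauchyOp {Φ : ℝ × ℝ → ℂ} (h : Twisted Φ) (ζ : ℂ) : Twisted (cauchyOp ζ Φ) :=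
  (h.fderiv _).sub ((h.fderiv _).const_mul ζ)

theorem Twisted.coef_fderiv {Φ : ℝ × ℝ → ℂ} (h : Twisted Φ) (v : ℝ × ℝ) (k : ℤ × ℤ) :
    coef (fun p => fderiv ℝ Φ p v) k =
      2 * Real.pi * Complex.I * (k.1 * v.1 + (k.2 + 1 / 2) * v.2) * coef Φ k := by
  rw [coef, h.integral_fderiv_mul (twisted_expo k).conj, coef, ← integral_neg, ← integral_const_mul]
  congr 1 with p
  rw [fderiv_conj, fderiv_expo]
  simp [Complex.conj_ofNat]
  ring

theorem Twisted.coef_cauchyOp {Φ : ℝ × ℝ → ℂ} (h : Twisted Φ) (ζ : ℂ) (k : ℤ × ℤ) :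
    coef (_root_.cauchyOp ζ Φ) k = symb ζ k * coef Φ k := by
  have := coef_sub (h.fderiv (0, 1)).memLp ((h.fderiv (1, 0)).const_mul ζ).memLp k
  rw [coef_const_mul, h.coef_fderiv, h.coef_fderiv] at this
  refine this.trans ?_
  simp [symb]
  ring

theorem Twisted.integral_cauchyOp_mul {Φ Ψ : ℝ × ℝ → ℂ} (h : Twisted Φ) (h' : Twisted Ψ) (ζ : ℂ) :
    ∫ p, _root_.cauchyOp ζ Φ p * Ψ p ∂cell = -∫ p, Φ p * _root_.cauchyOp ζ Ψ p ∂cell := by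
  simp only [_root_.cauchyOp, sub_mul, mul_sub, mul_assoc, mul_left_comm _ ζ]
  have i1 (v) := integrable_of_continuous ((h.fderiv v).mul h').smooth.continuous
  have i2 (v) := integrable_of_continuous (h.mul (h'.fderiv v)).smooth.continuous
  rw [integral_sub (i1 _) ((i1 _).const_mul _), integral_sub (i2 _) ((i2 _).const_mul _),
    integral_const_mul, integral_const_mul, h.integral_fderiv_mul h', h.integral_fderiv_mul h']
  ring

/-- The weight `1 + max |m| |n|` of a frequency. -/
def wt (k : ℤ × ℤ) : ℝ := 1 + max k.1.natAbs k.2.natAbs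

theorem one_le_wt (k : ℤ × ℤ) : 1 ≤ wt k := by
  unfold wt; have : (0:ℝ) ≤ max (k.1.natAbs : ℝ) k.2.natAbs := by positivity
  linarith

theorem wt_pos (k : ℤ × ℤ) : 0 < wt k := one_pos.trans_le (one_le_wt k)

/-- Antiperiodicity enters here: |n + 1/2| is at least 1/2, so 4|n + 1/2| absorbs both |n| and the
constant 1. The zero frequency needs no separate treatment. -/
theorem wt_le (k : ℤ × ℤ) : wt k ≤ |(k.1 : ℝ)| + 4 * |(k.2 : ℝ) + 1 / 2| := by
  have h1 : (k.1.natAbs : ℝ) = |(k.1 : ℝ)| := by rw [Nat.cast_natAbs]; simp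
  have h2 : (k.2.natAbs : ℝ) = |(k.2 : ℝ)| := by rw [Nat.cast_natAbs]; simp
  have h3 : (1 / 2 : ℝ) ≤ |(k.2 : ℝ) + 1 / 2| := by
    rcases le_or_gt 0 k.2 with h | h
    · have : (0:ℝ) ≤ k.2 := by exact_mod_cast h
      rw [abs_of_nonneg (by linarith)]; linarith
    · have : (k.2:ℝ) ≤ -1 := by exact_mod_cast (by omega : k.2 ≤ -1)
      rw [abs_of_nonpos (by linarith)]; linarith
  have h4 : |(k.2 : ℝ)| ≤ |(k.2 : ℝ) + 1 / 2| + 1 / 2 := by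
    have := abs_sub (( k.2 : ℝ) + 1 / 2) (1/2)
    rw [add_sub_cancel_right] at this
    rwa [abs_of_nonneg (by norm_num : (0:ℝ) ≤ 1/2)] at this
  unfold wt
  rw [Nat.cast_max, h1, h2]
  have := max_le_add_of_nonneg (abs_nonneg (k.1:ℝ)) (abs_nonneg (k.2:ℝ))
  linarith

theorem norm_symb (ζ : ℂ) (k : ℤ × ℤ) :
    ‖symb ζ k‖ = 2 * Real.pi * ‖((k.2 : ℂ) + 1 / 2) - ζ * k.1‖ := by
  simp [symb, abs_of_pos Real.pi_pos]

theorem norm_symb_im (ζ : ℂ) (k : ℤ × ℤ) :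
    |ζ.im| * |(k.1 : ℝ)| ≤ ‖((k.2 : ℂ) + 1 / 2) - ζ * k.1‖ := by
  rw [← abs_mul]
  refine le_trans (le_of_eq ?_) (Complex.abs_im_le_norm _)
  rw [← abs_neg]
  simp

/-- The operator `∂_t - ζ ∂_s` is elliptic, and invertible on antiperiodic functions. -/
theorem exists_symb_lower {ζ : ℂ} (hζ : ζ.im ≠ 0) :
    ∃ c > 0, ∀ k, c * wt k ≤ ‖symb ζ k‖ := by
  have hd : 0 < |ζ.im| := abs_pos.2 hζ
  set M := 1 / |ζ.im| + 4 * (1 + ‖ζ‖ / |ζ.im|) with hM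
  have hM0 : 0 < M := by positivity
  refine ⟨2 * Real.pi / M, by positivity, fun k => ?_⟩
  rw [norm_symb, div_mul_eq_mul_div, div_le_iff₀ hM0, mul_assoc (2 * Real.pi) _ M]
  refine mul_le_mul_of_nonneg_left ?_ (by positivity : 0 ≤ 2 * Real.pi)
  set X := ‖((k.2 : ℂ) + 1 / 2) - ζ * k.1‖
  have h1 : |(k.1 : ℝ)| ≤ X / |ζ.im| := by
    rw [le_div_iff₀ hd, mul_comm]; exact norm_symb_im ζ k
  have h2 : |(k.2 : ℝ) + 1 / 2| ≤ X + ‖ζ‖ * |(k.1 : ℝ)| := by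
    have e : ((((k.2:ℝ) + 1 / 2 : ℝ) : ℂ)) = (((k.2 : ℂ) + 1 / 2) - ζ * k.1) + ζ * k.1 := by
      push_cast; ring
    rw [← Real.norm_eq_abs, ← Complex.norm_real, e]
    refine (norm_add_le _ _).trans (le_of_eq ?_)
    simp [X]
  calc wt k ≤ |(k.1 : ℝ)| + 4 * |(k.2 : ℝ) + 1 / 2| := wt_le k
    _ ≤ X / |ζ.im| + 4 * (X + ‖ζ‖ * (X / |ζ.im|)) := by
      refine add_le_add h1 (mul_le_mul_of_nonneg_left (h2.trans ?_) (by norm_num))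
      gcongr
    _ = X * M := by rw [hM]; ring

theorem symb_ne_zero {ζ : ℂ} (hζ : ζ.im ≠ 0) (k : ℤ × ℤ) : symb ζ k ≠ 0 := by
  obtain ⟨c, hc, h⟩ := exists_symb_lower hζ
  exact norm_pos_iff.1 ((mul_pos hc (wt_pos k)).trans_le (h k))

/-- A sequence that decays faster than every power. -/
def RapidDecay (a : ℤ × ℤ → ℂ) : Prop := ∀ n : ℕ, ∃ C, ∀ k, wt k ^ n * ‖a k‖ ≤ C

/-- A derivative multiplies the coefficients by a linear factor in the frequency, and by `wt_le` the
two coordinate derivatives together recover one power of the weight. -/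
theorem Twisted.rapidDecay {Φ : ℝ × ℝ → ℂ} (h : Twisted Φ) : RapidDecay (coef Φ) := by
  intro n
  induction n generalizing Φ with
  | zero => exact ⟨_, fun k => by simpa using norm_coef_le Φ k⟩
  | succ n ih =>
    obtain ⟨C1, h1⟩ := ih (h.fderiv (1, 0))
    obtain ⟨C2, h2⟩ := ih (h.fderiv (0, 1))
    refine ⟨C1 + C2, fun k => ?_⟩
    have e1 := h1 k
    have e2 := h2 k
    rw [h.coef_fderiv] at e1 e2
    -- The factor 2π exceeds the constants 1 and 4 that occur in `wt_le`.
    have n1 : |(k.1:ℝ)| ≤ ‖(2 * Real.pi * Complex.I * (k.1 * (1:ℝ) + (k.2 + 1 / 2) * (0:ℝ)) : ℂ)‖ := by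
      simp [abs_of_pos Real.pi_pos]
      nlinarith [abs_nonneg (k.1:ℝ), Real.pi_gt_three]
    have n2 : 4 * |(k.2:ℝ) + 1 / 2| ≤
        ‖(2 * Real.pi * Complex.I * (k.1 * (0:ℝ) + (k.2 + 1 / 2) * (1:ℝ)) : ℂ)‖ := by
      have : ((k.2 : ℂ) + 1 / 2) = (((k.2:ℝ) + 1 / 2 : ℝ) : ℂ) := by push_cast; rfl
      simp only [Complex.ofReal_zero, mul_zero, Complex.ofReal_one, mul_one, zero_add, norm_mul, this,
        Complex.norm_real]
      simp [abs_of_pos Real.pi_pos]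
      nlinarith [abs_nonneg ((k.2:ℝ) + 2⁻¹), Real.pi_gt_three]
    rw [norm_mul] at e1 e2
    have hw := wt_le k
    have hp : 0 ≤ wt k ^ n := pow_nonneg (wt_pos k).le _
    calc wt k ^ (n + 1) * ‖coef Φ k‖ = wt k ^ n * (wt k * ‖coef Φ k‖) := by ring
      _ ≤ wt k ^ n * ((|(k.1 : ℝ)| + 4 * |(k.2 : ℝ) + 1 / 2|) * ‖coef Φ k‖) := by gcongr
      _ = wt k ^ n * (|(k.1 : ℝ)| * ‖coef Φ k‖) + wt k ^ n * (4 * |(k.2 : ℝ) + 1 / 2| * ‖coef Φ k‖) := by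
        ring
      _ ≤ _ := add_le_add (le_trans (by gcongr) e1) (le_trans (by gcongr) e2)

theorem summable_int_inv_sq : Summable fun m : ℤ => ((1 + (m.natAbs : ℝ)) ^ 2)⁻¹ := by
  have h : Summable fun n : ℕ => ((1 + (n : ℝ)) ^ 2)⁻¹ := by
    have := (summable_nat_add_iff 1).2 (Real.summable_nat_pow_inv (p := 2) |>.2 (by norm_num))
    refine this.congr fun n => ?_
    push_cast; rw [add_comm]
  refine Summable.of_nat_of_neg ?_ ?_ <;> simpa using h

/-- The fourth power of the weight dominates (1 + |m|)²(1 + |n|)², so four spare powers of decay buy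
absolute convergence. -/
theorem summable_wt : Summable fun k : ℤ × ℤ => (wt k ^ 4)⁻¹ := by
  have h := summable_int_inv_sq.mul_of_nonneg summable_int_inv_sq (fun _ => by positivity)
    (fun _ => by positivity)
  refine Summable.of_nonneg_of_le (fun k => inv_nonneg.2 (pow_nonneg (wt_pos k).le _)) (fun k => ?_) h
  rw [← mul_inv]
  refine inv_anti₀ (by positivity) ?_
  have h1 : 1 + (k.1.natAbs : ℝ) ≤ wt k := by unfold wt; gcongr; exact le_max_left _ _
  have h2 : 1 + (k.2.natAbs : ℝ) ≤ wt k := by unfold wt; gcongr; exact le_max_right _ _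
  calc _ ≤ wt k ^ 2 * wt k ^ 2 := by gcongr
    _ = _ := by ring

theorem RapidDecay.summable {a : ℤ × ℤ → ℂ} (h : RapidDecay a) (n : ℕ) :
    Summable fun k => wt k ^ n * ‖a k‖ := by
  obtain ⟨C, hC⟩ := h (n + 4)
  refine Summable.of_nonneg_of_le (fun k => mul_nonneg (pow_nonneg (wt_pos k).le _) (norm_nonneg _))
    (fun k => ?_) (summable_wt.mul_left C)
  have hp := pow_pos (wt_pos k) 4
  rw [← div_eq_mul_inv, le_div_iff₀ hp]
  refine le_trans (le_of_eq ?_) (hC k)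
  ring

theorem RapidDecay.mul_of_le {a b : ℤ × ℤ → ℂ} (h : RapidDecay a) (C : ℝ) (N : ℕ)
    (hb : ∀ k, ‖b k‖ ≤ C * wt k ^ N) : RapidDecay fun k => b k * a k := by
  intro n
  obtain ⟨D, hD⟩ := h (n + N)
  refine ⟨|C| * D, fun k => ?_⟩
  have hp : 0 ≤ wt k ^ n := pow_nonneg (wt_pos k).le _
  have hN : 0 ≤ wt k ^ N := pow_nonneg (wt_pos k).le _
  calc wt k ^ n * ‖b k * a k‖ = wt k ^ n * (‖b k‖ * ‖a k‖) := by rw [norm_mul]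
    _ ≤ wt k ^ n * ((|C| * wt k ^ N) * ‖a k‖) := by
      gcongr; exact (hb k).trans (by gcongr; exact le_abs_self C)
    _ = |C| * (wt k ^ (n + N) * ‖a k‖) := by ring
    _ ≤ _ := by gcongr; exact hD k

/-- The Fourier series with coefficients `a`. -/
def synth (a : ℤ × ℤ → ℂ) (p : ℝ × ℝ) : ℂ := ∑' k, a k * expo k p

theorem natAbs_le_wt (k : ℤ × ℤ) : |(k.1 : ℝ)| ≤ wt k ∧ |(k.2 : ℝ) + 1 / 2| ≤ wt k := by
  have h1 : (k.1.natAbs : ℝ) = |(k.1 : ℝ)| := by rw [Nat.cast_natAbs]; simp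
  have h2 : (k.2.natAbs : ℝ) = |(k.2 : ℝ)| := by rw [Nat.cast_natAbs]; simp
  unfold wt
  rw [Nat.cast_max, h1, h2]
  have a1 := le_max_left |(k.1 : ℝ)| |(k.2 : ℝ)|
  have a2 := le_max_right |(k.1 : ℝ)| |(k.2 : ℝ)|
  have a3 := abs_add_le (k.2 : ℝ) (1 / 2)
  rw [abs_of_nonneg (by norm_num : (0:ℝ) ≤ 1/2)] at a3
  constructor <;> linarith

/-- The constant 7 is a round number above 2π. -/
theorem norm_deriv_coeff_le (k : ℤ × ℤ) :
    ‖(2 * Real.pi * Complex.I * k.1 : ℂ)‖ ≤ 7 * wt k ^ 1 ∧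
    ‖(2 * Real.pi * Complex.I * (k.2 + 1 / 2) : ℂ)‖ ≤ 7 * wt k ^ 1 := by
  obtain ⟨h1, h2⟩ := natAbs_le_wt k
  have e : ((k.2 : ℂ) + 1 / 2) = (((k.2:ℝ) + 1 / 2 : ℝ) : ℂ) := by push_cast; rfl
  have hpi : 2 * Real.pi ≤ 7 := by linarith [Real.pi_lt_d2]
  rw [e]
  simp only [norm_mul, Complex.norm_real, Complex.norm_intCast, Complex.norm_I, mul_one,
    Complex.norm_ofNat, Real.norm_eq_abs, abs_of_pos Real.pi_pos, pow_one]
  constructor <;> gcongr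

theorem RapidDecay.hasFDerivAt_synth {a : ℤ × ℤ → ℂ} (h : RapidDecay a) (p : ℝ × ℝ) :
    HasFDerivAt (synth a)
      (synth (fun k => (2 * Real.pi * Complex.I * k.1) * a k) p •
          (Complex.ofRealCLM.comp (ContinuousLinearMap.fst ℝ ℝ ℝ)) +
        synth (fun k => (2 * Real.pi * Complex.I * (k.2 + 1 / 2)) * a k) p •
          (Complex.ofRealCLM.comp (ContinuousLinearMap.snd ℝ ℝ ℝ))) p := by
  set A : ℝ × ℝ →L[ℝ] ℂ := Complex.ofRealCLM.comp (ContinuousLinearMap.fst ℝ ℝ ℝ)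
  set B : ℝ × ℝ →L[ℝ] ℂ := Complex.ofRealCLM.comp (ContinuousLinearMap.snd ℝ ℝ ℝ)
  have s1 := (h.mul_of_le 7 1 (fun k => (norm_deriv_coeff_le k).1)).summable 0
  have s2 := (h.mul_of_le 7 1 (fun k => (norm_deriv_coeff_le k).2)).summable 0
  simp only [pow_zero, one_mul] at s1 s2
  have key : HasFDerivAt (fun y => ∑' k, a k * expo k y)
      (∑' k, (((2 * Real.pi * Complex.I * k.1) * a k * expo k p) • A +
        ((2 * Real.pi * Complex.I * (k.2 + 1 / 2)) * a k * expo k p) • B)) p := by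
    refine hasFDerivAt_tsum (u := fun k => ‖(2 * Real.pi * Complex.I * k.1) * a k‖ * ‖A‖ +
        ‖(2 * Real.pi * Complex.I * (k.2 + 1 / 2)) * a k‖ * ‖B‖)
      ((s1.mul_right _).add (s2.mul_right _))
      (f' := fun k p => ((2 * Real.pi * Complex.I * k.1) * a k * expo k p) • A +
        ((2 * Real.pi * Complex.I * (k.2 + 1 / 2)) * a k * expo k p) • B)
      (fun k x => ?_) (fun k x => ?_) (x₀ := 0) ?_ p
    · refine ((hasFDerivAt_expo k x).const_mul (a k)).congr_fderiv ?_
      ext <;> simp [A, B] <;> ring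
    · refine (norm_add_le _ _).trans ?_
      rw [norm_smul, norm_smul, norm_mul _ (expo k x), norm_mul _ (expo k x), norm_expo]
      simp
    · have := h.summable 0
      refine Summable.of_norm ?_
      simpa [norm_expo] using this
  refine key.congr_fderiv ?_
  have t1 : Summable fun k => (2 * Real.pi * Complex.I * k.1) * a k * expo k p := by
    refine Summable.of_norm ?_
    simpa [norm_expo] using s1
  have t2 : Summable fun k => (2 * Real.pi * Complex.I * (k.2 + 1 / 2)) * a k * expo k p := by
    refine Summable.of_norm ?_
    simpa [norm_expo] using s2
  rw [(t1.smul_const A).tsum_add (t2.smul_const B), t1.tsum_smul_const, t2.tsum_smul_const]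
  rfl

/-- The derivative of such a series is a combination of two series with rapidly decaying
coefficients, so the order of smoothness is raised by induction over all sequences at once. -/
theorem RapidDecay.contDiff_synth {a : ℤ × ℤ → ℂ} (h : RapidDecay a) : ContDiff ℝ ∞ (synth a) := by
  rw [contDiff_infty]
  intro n
  induction n generalizing a with
  | zero =>
    have : Differentiable ℝ (synth a) := fun p => (h.hasFDerivAt_synth p).differentiableAt
    exact contDiff_zero.2 this.continuous
  | succ n ih =>
    have e : fderiv ℝ (synth a) = _ := funext fun p => (h.hasFDerivAt_synth p).fderiv
    push_cast
    rw [contDiff_succ_iff_fderiv]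
    refine ⟨fun p => (h.hasFDerivAt_synth p).differentiableAt, by simp, ?_⟩
    rw [e]
    exact ((ih (h.mul_of_le 7 1 (fun k => (norm_deriv_coeff_le k).1))).smul contDiff_const).add
      ((ih (h.mul_of_le 7 1 (fun k => (norm_deriv_coeff_le k).2))).smul contDiff_const)

theorem RapidDecay.twisted_synth {a : ℤ × ℤ → ℂ} (h : RapidDecay a) : Twisted (synth a) := by
  refine ⟨h.contDiff_synth, fun m n p => ?_⟩
  simp only [synth, (twisted_expo _).twist]
  rw [← tsum_mul_left]
  congr 1 with k
  ring

theorem coef_expo (k l : ℤ × ℤ) : coef (expo k) l = if k = l then 1 else 0 := by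
  split_ifs with h
  · subst h
    have : ∀ p, expo k p * (starRingEnd ℂ) (expo k p) = 1 := fun p => by
      rw [Complex.mul_conj, Complex.normSq_eq_norm_sq, norm_expo]; simp
    simp [coef, this]
  -- Orthogonality without computing an integral: an exponential is an eigenfunction of both
  -- derivatives, so a nonzero coefficient at `l` forces the frequencies `k` and `l` to coincide.
  · have h1 := (twisted_expo k).coef_fderiv
    simp only [fderiv_expo, mul_assoc] at h1
    by_contra h2
    have g1 := h1 (1, 0) l
    have g2 := h1 (0, 1) l
    rw [show (fun p => 2 * ((Real.pi:ℂ) * (Complex.I * ((k.1 * ((1:ℝ) : ℂ) + (k.2 + 1 / 2) * ((0:ℝ):ℂ)) * expo k p)))) =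
      fun p => (2 * Real.pi * Complex.I * k.1) * expo k p by ext p; simp; ring, coef_const_mul] at g1
    rw [show (fun p => 2 * ((Real.pi:ℂ) * (Complex.I * ((k.1 * ((0:ℝ) : ℂ) + (k.2 + 1 / 2) * ((1:ℝ):ℂ)) * expo k p)))) =
      fun p => (2 * Real.pi * Complex.I * (k.2 + 1 / 2)) * expo k p by ext p; simp; ring, coef_const_mul] at g2
    have hpi : (Real.pi : ℂ) ≠ 0 := by exact_mod_cast Real.pi_ne_zero
    have hc : (2 * Real.pi * Complex.I : ℂ) * coef (expo k) l ≠ 0 :=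
      mul_ne_zero (mul_ne_zero (mul_ne_zero two_ne_zero hpi) Complex.I_ne_zero) h2
    simp only [Complex.ofReal_one, Complex.ofReal_zero, mul_one, mul_zero, add_zero, zero_add] at g1 g2
    apply h
    ext
    · have : (k.1 : ℂ) = l.1 := mul_left_cancel₀ hc (by linear_combination g1)
      exact_mod_cast this
    · have : (k.2 : ℂ) = l.2 := mul_left_cancel₀ hc (by linear_combination g2)
      exact_mod_cast this

theorem RapidDecay.coef_synth {a : ℤ × ℤ → ℂ} (h : RapidDecay a) (l : ℤ × ℤ) :
    coef (synth a) l = a l := by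
  have hs := h.summable 0
  simp only [pow_zero, one_mul] at hs
  have h1 : HasSum (fun k => ∫ p, a k * expo k p * (starRingEnd ℂ) (expo l p) ∂cell)
      (∫ p, ∑' k, a k * expo k p * (starRingEnd ℂ) (expo l p) ∂cell) := by
    refine hasSum_integral_of_summable_integral_norm (fun k => ?_) ?_
    · refine integrable_of_continuous ?_
      exact (continuous_const.mul (contDiff_expo k).continuous).mul
        (Complex.continuous_conj.comp (contDiff_expo l).continuous)
    · simpa [norm_expo] using hs
  have h2 (k : ℤ × ℤ) : ∫ p, a k * expo k p * (starRingEnd ℂ) (expo l p) ∂cell =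
      if k = l then a k else 0 := by
    have := coef_const_mul (a k) (expo k) l
    rw [coef_expo] at this
    simpa [coef] using this
  simp only [h2, tsum_mul_right] at h1
  have h3 : coef (synth a) l = ∑' k, (if k = l then a k else 0) := by
    rw [h1.tsum_eq]; rfl
  rw [h3, tsum_ite_eq]

theorem Twisted.eq_zero_of_ae {Φ : ℝ × ℝ → ℂ} (h : Twisted Φ) (h0 : Φ =ᵐ[cell] 0) : Φ = 0 := by
  have h1 : EqOn Φ 0 (Ioc 0 1 ×ˢ Ioc 0 1) := by
    refine Measure.eqOn_of_ae_eq h0 h.continuous.continuousOn continuousOn_const ?_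
    rw [interior_prod_eq, closure_prod_eq, interior_Ioc, closure_Ioo zero_ne_one]
    exact prod_mono Ioc_subset_Icc_self Ioc_subset_Icc_self
  ext p
  -- Subtracting the ceiling minus one moves a real number into the half-open interval (0, 1], which
  -- is the convention of `cell`.
  have h2 := h.twist (⌈p.1⌉ - 1) (⌈p.2⌉ - 1) (p - (((⌈p.1⌉ - 1 : ℤ) : ℝ), ((⌈p.2⌉ - 1 : ℤ) : ℝ)))
  rw [sub_add_cancel] at h2
  rw [h2, h1]
  · simp
  · constructor <;> simp <;> constructor <;> linarith [Int.ceil_lt_add_one p.1, Int.le_ceil p.1,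
      Int.ceil_lt_add_one p.2, Int.le_ceil p.2]

theorem Twisted.eq_of_coef {Φ Ψ : ℝ × ℝ → ℂ} (h : Twisted Φ) (h' : Twisted Ψ)
    (hc : ∀ k, coef Φ k = coef Ψ k) : Φ = Ψ := by
  have := (h.sub h').eq_zero_of_ae (ae_eq_zero_of_coef_eq_zero (h.sub h').memLp fun k => by
    rw [coef_sub h.memLp h'.memLp, hc, sub_self])
  ext p
  exact sub_eq_zero.1 (congrFun this p)

theorem Twisted.eq_synth {Φ : ℝ × ℝ → ℂ} (h : Twisted Φ) : Φ = synth (coef Φ) :=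
  h.eq_of_coef h.rapidDecay.twisted_synth fun k => (h.rapidDecay.coef_synth k).symm

/-- Fourier multipliers act on smooth antiperiodic functions. -/
theorem Twisted.exists_multiplier {Φ : ℝ × ℝ → ℂ} (h : Twisted Φ) {b : ℤ × ℤ → ℂ} {C : ℝ}
    (hb : ∀ k, ‖b k‖ ≤ C) : ∃ Ψ, Twisted Ψ ∧ ∀ k, coef Ψ k = b k * coef Φ k := by
  have := h.rapidDecay.mul_of_le C 0 (fun k => by simpa using hb k)
  exact ⟨_, this.twisted_synth, this.coef_synth⟩

/-! ## The critical Sobolev inequality `H^{1/2} ⊂ L⁴` -/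

/-- The square shell of radius N has 8N points, each of weight 1 + N, so it contributes at most 8 to
the sum. Linear growth of this sum is what makes H^{1/2} critical for L⁴ in dimension two. -/
theorem exists_finset_wt_le {X : ℝ} (hX : 0 ≤ X) : ∃ s : Finset (ℤ × ℤ),
    (∀ k, k ∈ s ↔ wt k ≤ X) ∧ ∑ k ∈ s, (wt k)⁻¹ ≤ 8 * X := by
  have hb (N : ℕ) : ∑ k ∈ Finset.Icc (-N : ℤ × ℤ) N, (wt k)⁻¹ ≤ 8 * N + 1 := by
    induction N with
    | zero => simp [wt]
    | succ N ih =>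
      have h := Finset.box_succ_disjUnion (α := ℤ × ℤ) N
      have h' : Finset.Icc (-((N + 1 : ℕ) : ℤ × ℤ)) ((N + 1 : ℕ) : ℤ × ℤ) = _ := h.symm
      rw [h', Finset.sum_disjUnion]
      have h1 : ∑ k ∈ (Finset.box (N + 1) : Finset (ℤ × ℤ)), (wt k)⁻¹ ≤ 8 := by
        have h2 : ∀ k ∈ (Finset.box (N + 1) : Finset (ℤ × ℤ)), (wt k)⁻¹ ≤ ((N : ℝ) + 1)⁻¹ := by
          intro k hk
          rw [Int.mem_box] at hk
          refine inv_anti₀ (by positivity) ?_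
          rw [wt, hk]; push_cast; linarith
        refine (Finset.sum_le_card_nsmul _ _ _ h2).trans ?_
        rw [Int.card_box (by omega), nsmul_eq_mul]
        push_cast
        rw [mul_assoc, mul_inv_cancel₀ (by positivity), mul_one]
      push_cast
      linarith
  rcases lt_or_ge X 1 with h | h
  · refine ⟨∅, fun k => ?_, by simpa using hX⟩
    simp only [Finset.notMem_empty, false_iff, not_le]
    exact h.trans_le (one_le_wt k)
  · have h1 : 1 ≤ ⌊X⌋₊ := Nat.le_floor (by exact_mod_cast h)
    -- The weight is one plus the maximum norm, hence the radius ⌊X⌋ - 1.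
    refine ⟨Finset.Icc (-((⌊X⌋₊ - 1 : ℕ)) : ℤ × ℤ) ((⌊X⌋₊ - 1 : ℕ)), fun k => ?_, ?_⟩
    · have e : wt k ≤ X ↔ 1 + max k.1.natAbs k.2.natAbs ≤ ⌊X⌋₊ := by
        rw [Nat.le_floor_iff hX, wt]; push_cast; rfl
      rw [e, Finset.mem_Icc, Prod.le_def, Prod.le_def]
      simp only [Prod.fst_neg, Prod.snd_neg, Prod.fst_natCast, Prod.snd_natCast]
      omega
    · refine (hb _).trans ?_
      rw [Nat.cast_sub h1]
      have := Nat.floor_le hX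
      push_cast
      linarith

/-- The square of the `H^{1/2}` norm. -/
def halfNorm (Φ : ℝ × ℝ → ℂ) : ℝ := ∑' k, wt k * ‖coef Φ k‖ ^ 2

theorem RapidDecay.summable_sq {a : ℤ × ℤ → ℂ} (h : RapidDecay a) (n : ℕ) :
    Summable fun k => wt k ^ n * ‖a k‖ ^ 2 := by
  obtain ⟨C, hC⟩ := h 0
  refine Summable.of_nonneg_of_le (fun k => mul_nonneg (pow_nonneg (wt_pos k).le _) (by positivity))
    (fun k => ?_) ((h.summable n).mul_left C)
  have := hC k
  rw [pow_zero, one_mul] at this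
  have hp : 0 ≤ wt k ^ n := pow_nonneg (wt_pos k).le _
  calc wt k ^ n * ‖a k‖ ^ 2 = ‖a k‖ * (wt k ^ n * ‖a k‖) := by ring
    _ ≤ _ := by gcongr

theorem Twisted.summable_half {Φ : ℝ × ℝ → ℂ} (h : Twisted Φ) :
    Summable fun k => wt k * ‖coef Φ k‖ ^ 2 := by simpa using h.rapidDecay.summable_sq 1

theorem halfNorm_nonneg (Φ : ℝ × ℝ → ℂ) : 0 ≤ halfNorm Φ :=
  tsum_nonneg fun k => mul_nonneg (wt_pos k).le (by positivity)

theorem coef_finset_sum (s : Finset (ℤ × ℤ)) (a : ℤ × ℤ → ℂ) (l : ℤ × ℤ) :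
    coef (fun p => ∑ k ∈ s, a k * expo k p) l = if l ∈ s then a l else 0 := by
  have h (k : ℤ × ℤ) : ∫ p, a k * expo k p * (starRingEnd ℂ) (expo l p) ∂cell =
      if k = l then a k else 0 := by
    have := coef_const_mul (a k) (expo k) l
    rw [coef_expo] at this
    simpa [coef] using this
  simp only [coef, Finset.sum_mul]
  rw [integral_finsetSum]
  · simp [h]
  · intro k _
    exact integrable_of_continuous ((continuous_const.mul (contDiff_expo k).continuous).mul
        (Complex.continuous_conj.comp (contDiff_expo l).continuous))

/-- The measure of a superlevel set is controlled by the high frequencies. -/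
theorem Twisted.measure_superlevel_le {Φ : ℝ × ℝ → ℂ} (h : Twisted Φ) (hS : 0 < halfNorm Φ)
    {t : ℝ} (ht : 0 < t) :
    cell {p | t < ‖Φ p‖} ≤ ENNReal.ofReal (4 / t ^ 2) *
      ∑' k, (if t ^ 2 < 32 * halfNorm Φ * wt k then ENNReal.ofReal (‖coef Φ k‖ ^ 2) else 0) := by
  set S := halfNorm Φ with hSdef
  -- The splitting frequency depends on the height t: by Cauchy-Schwarz the low part is bounded in
  -- square by 8 · t²/(32S) · S = (t/2)². Where |Φ| > t the high part therefore exceeds t/2, and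
  -- Chebyshev with Parseval applies.
  obtain ⟨s, hs, hsum⟩ := exists_finset_wt_le (X := t ^ 2 / (32 * S)) (by positivity)
  set low : ℝ × ℝ → ℂ := fun p => ∑ k ∈ s, coef Φ k * expo k p with hlow
  have hlowb (p : ℝ × ℝ) : ‖low p‖ ≤ t / 2 := by
    have h1 : ‖low p‖ ≤ ∑ k ∈ s, ‖coef Φ k‖ := by
      refine (norm_sum_le _ _).trans (le_of_eq ?_)
      simp [norm_expo]
    have h2 : (∑ k ∈ s, ‖coef Φ k‖) ^ 2 ≤ (∑ k ∈ s, (wt k)⁻¹) * ∑ k ∈ s, wt k * ‖coef Φ k‖ ^ 2 := by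
      refine Finset.sum_sq_le_sum_mul_sum_of_sq_le_mul s (fun k _ => inv_nonneg.2 (wt_pos k).le)
        (fun k _ => mul_nonneg (wt_pos k).le (by positivity)) (fun k _ => ?_)
      rw [← mul_assoc, inv_mul_cancel₀ (wt_pos k).ne', one_mul]
    have h3 : ∑ k ∈ s, wt k * ‖coef Φ k‖ ^ 2 ≤ S :=
      h.summable_half.sum_le_tsum s (fun k _ => mul_nonneg (wt_pos k).le (by positivity))
    have h4 : (∑ k ∈ s, ‖coef Φ k‖) ^ 2 ≤ (t / 2) ^ 2 := by
      refine h2.trans ?_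
      calc _ ≤ (8 * (t ^ 2 / (32 * S))) * S := by
            refine mul_le_mul hsum h3 (Finset.sum_nonneg fun k _ =>
              mul_nonneg (wt_pos k).le (by positivity)) (by positivity)
        _ = _ := by field_simp; norm_num
    exact h1.trans (abs_le_of_sq_le_sq' h4 (by positivity)).2
  have hlowc : Continuous low := by
    refine continuous_finsetSum _ fun k _ => continuous_const.mul (contDiff_expo k).continuous
  set hi : ℝ × ℝ → ℂ := fun p => Φ p - low p with hhi
  have hic : Continuous hi := h.continuous.sub hlowc
  have hcoef (k : ℤ × ℤ) : coef hi k = if k ∈ s then 0 else coef Φ k := by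
    rw [hhi, coef_sub h.memLp (memLp_of_continuous hlowc 2), hlow, coef_finset_sum]
    split_ifs <;> simp
  have hpars := hasSum_norm_coef_sq (memLp_of_continuous hic 2)
  have hsub : {p | t < ‖Φ p‖} ⊆ {p | ENNReal.ofReal (t ^ 2 / 4) ≤ ENNReal.ofReal (‖hi p‖ ^ 2)} := by
    intro p hp
    have h1 : ‖Φ p‖ ≤ ‖hi p‖ + ‖low p‖ := by
      have : Φ p = hi p + low p := by simp [hhi]
      rw [this]; exact norm_add_le _ _
    have h2 : t / 2 ≤ ‖hi p‖ := by linarith [hlowb p, (show t < ‖Φ p‖ from hp)]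
    refine ENNReal.ofReal_le_ofReal ?_
    nlinarith
  have hmarkov := mul_meas_ge_le_lintegral₀ (μ := cell) (f := fun p => ENNReal.ofReal (‖hi p‖ ^ 2))
    (by fun_prop) (ENNReal.ofReal (t ^ 2 / 4))
  have hint : ∫⁻ p, ENNReal.ofReal (‖hi p‖ ^ 2) ∂cell =
      ∑' k, (if t ^ 2 < 32 * S * wt k then ENNReal.ofReal (‖coef Φ k‖ ^ 2) else 0) := by
    rw [← ofReal_integral_eq_lintegral_ofReal (integrable_of_continuous (by fun_prop))
      (Eventually.of_forall fun p => by positivity), ← hpars.tsum_eq,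
      ENNReal.ofReal_tsum_of_nonneg (fun k => by positivity) hpars.summable]
    congr 1 with k
    rw [hcoef]
    have e : k ∈ s ↔ ¬ (t ^ 2 < 32 * S * wt k) := by
      rw [hs, le_div_iff₀ (by positivity), not_lt, mul_comm]
    by_cases hk : k ∈ s
    · rw [if_pos hk, if_neg (e.1 hk)]; simp
    · rw [if_neg hk, if_pos (not_not.1 (fun hh => hk (e.2 hh)))]
  calc cell {p | t < ‖Φ p‖} ≤ _ := measure_mono hsub
    _ = ENNReal.ofReal (4 / t ^ 2) * (ENNReal.ofReal (t ^ 2 / 4) *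
          cell {p | ENNReal.ofReal (t ^ 2 / 4) ≤ ENNReal.ofReal (‖hi p‖ ^ 2)}) := by
      rw [← mul_assoc, ← ENNReal.ofReal_mul (by positivity)]
      have : 4 / t ^ 2 * (t ^ 2 / 4) = 1 := by field_simp
      rw [this]; simp
    _ ≤ _ := by
      refine mul_le_mul_right (hmarkov.trans (le_of_eq hint)) _

theorem lintegral_sixteen_mul {a : ℝ} (ha : 0 ≤ a) :
    ∫⁻ t in Ioi (0:ℝ), (if t ^ 2 < a then ENNReal.ofReal (16 * t) else 0) = ENNReal.ofReal (8 * a) := by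
  have h1 : ∀ t ∈ Ioi (0:ℝ), (if t ^ 2 < a then ENNReal.ofReal (16 * t) else 0) =
      (Iio (√a)).indicator (fun t => ENNReal.ofReal (16 * t)) t := by
    intro t ht
    have : t ^ 2 < a ↔ t ∈ Iio (√a) := by
      rw [mem_Iio, Real.lt_sqrt (le_of_lt ht)]
    simp only [indicator, this]
  rw [setLIntegral_congr_fun measurableSet_Ioi h1, lintegral_indicator measurableSet_Iio,
    Measure.restrict_restrict measurableSet_Iio, Iio_inter_Ioi, ← ofReal_integral_eq_lintegral_ofReal]
  · rw [← integral_Ioc_eq_integral_Ioo, ← intervalIntegral.integral_of_le (Real.sqrt_nonneg a)]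
    congr 1
    rw [intervalIntegral.integral_const_mul, integral_id, Real.sq_sqrt ha]
    ring
  · exact ((continuous_const.mul continuous_id).integrableOn_Icc (a := (0:ℝ)) (b := √a)).mono_set
      Ioo_subset_Icc_self
  · filter_upwards [ae_restrict_mem measurableSet_Ioo] with t ht
    have := ht.1
    simp only [Pi.zero_apply]; linarith

/-- The embedding `H^{1/2} ⊂ L⁴` on the torus. -/
theorem Twisted.integral_pow_four_le {Φ : ℝ × ℝ → ℂ} (h : Twisted Φ) :
    ∫ p, ‖Φ p‖ ^ 4 ∂cell ≤ 256 * halfNorm Φ ^ 2 := by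
  set S := halfNorm Φ with hSdef
  -- The splitting frequency divides by `halfNorm Φ`, so the zero function is treated apart.
  rcases (halfNorm_nonneg Φ).eq_or_lt with h0 | hS
  · have hz := (hasSum_zero_iff_of_nonneg (fun k => mul_nonneg (wt_pos k).le (by positivity))).1
      (show HasSum (fun k => wt k * ‖coef Φ k‖ ^ 2) 0 from h0 ▸ h.summable_half.hasSum)
    have hc : ∀ k, coef Φ k = 0 := fun k => by
      have := congrFun hz k
      simpa [(wt_pos k).ne'] using this
    have : Φ = 0 := h.eq_zero_of_ae (ae_eq_zero_of_coef_eq_zero h.memLp hc)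
    simp [this]
    positivity
  -- Layer cake formula with 4t³ dt. After the superlevel estimate the integrand is 16t on t² < 32 S
  -- wt(k), and exchanging sum and integral gives 8 · 32 S wt(k)|coef|² for each frequency, in total
  -- 256 S².
  have hcake := lintegral_comp_eq_lintegral_meas_lt_mul cell (f := fun p => ‖Φ p‖)
    (g := fun t => 4 * t ^ 3) (Eventually.of_forall fun p => norm_nonneg _)
    h.continuous.norm.aemeasurable (fun t _ => (by fun_prop : Continuous fun t : ℝ => 4 * t ^ 3).intervalIntegrable _ _)
    (by filter_upwards [ae_restrict_mem measurableSet_Ioi] with t ht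
        have : 0 < t := ht
        positivity)
  have hprim (x : ℝ) : ∫ t in (0:ℝ)..x, 4 * t ^ 3 = x ^ 4 := by
    rw [intervalIntegral.integral_const_mul, integral_pow]; norm_num; ring
  simp only [hprim] at hcake
  have hle : ∫⁻ t in Ioi (0:ℝ), cell {p | t < ‖Φ p‖} * ENNReal.ofReal (4 * t ^ 3) ≤
      ENNReal.ofReal (256 * S ^ 2) := by
    calc _ ≤ ∫⁻ t in Ioi (0:ℝ), ∑' k, (if t ^ 2 < 32 * S * wt k then ENNReal.ofReal (16 * t) else 0) *
          ENNReal.ofReal (‖coef Φ k‖ ^ 2) := by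
          refine setLIntegral_mono' measurableSet_Ioi fun t ht => ?_
          have ht : 0 < t := ht
          refine (mul_le_mul_left (h.measure_superlevel_le hS ht) _).trans (le_of_eq ?_)
          rw [mul_right_comm, ← ENNReal.ofReal_mul (by positivity), ← ENNReal.tsum_mul_left]
          congr 1 with k
          have : 4 / t ^ 2 * (4 * t ^ 3) = 16 * t := by field_simp; norm_num
          rw [this]
          split_ifs <;> simp
      _ = ∑' k, ENNReal.ofReal (8 * (32 * S * wt k)) * ENNReal.ofReal (‖coef Φ k‖ ^ 2) := by
          rw [lintegral_tsum]
          · congr 1 with k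
            rw [lintegral_mul_const' _ _ ENNReal.ofReal_ne_top, lintegral_sixteen_mul]
            have := wt_pos k
            positivity
          · intro k
            refine (Measurable.mul_const ?_ _).aemeasurable
            refine Measurable.ite (measurableSet_lt (by fun_prop) (by fun_prop)) (by fun_prop) (by fun_prop)
      _ = ∑' k, ENNReal.ofReal (256 * S * (wt k * ‖coef Φ k‖ ^ 2)) := by
          congr 1 with k
          have := wt_pos k
          rw [← ENNReal.ofReal_mul (by positivity)]
          congr 1; ring
      _ = ENNReal.ofReal (256 * S ^ 2) := by
          rw [← ENNReal.ofReal_tsum_of_nonneg (fun k => by have := wt_pos k; positivity)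
            (h.summable_half.mul_left _), tsum_mul_left]
          congr 1
          rw [hSdef, halfNorm]; ring
  have hi4 : Integrable (fun p => ‖Φ p‖ ^ 4) cell := integrable_of_continuous (h.continuous.norm.pow 4)
  rw [← hcake, ← ofReal_integral_eq_lintegral_ofReal hi4 (Eventually.of_forall fun p => by positivity)] at hle
  exact (ENNReal.ofReal_le_ofReal_iff (by positivity)).1 hle

/-! ### The gap inequality, uniformly in the conformal factor -/

theorem integral_mul_le_sqrt_mul_sqrt {α : Type*} [MeasurableSpace α] {μ : Measure α} {f g : α → ℝ}
    (hf : MemLp f 2 μ) (hg : MemLp g 2 μ) :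
    ∫ x, f x * g x ∂μ ≤ √(∫ x, f x ^ 2 ∂μ) * √(∫ x, g x ^ 2 ∂μ) := by
  have h := integral_mul_le_Lp_mul_Lq_of_nonneg (μ := μ) (f := fun x => |f x|) (g := fun x => |g x|)
    Real.HolderConjugate.two_two (Eventually.of_forall fun x => abs_nonneg _)
    (Eventually.of_forall fun x => abs_nonneg _) (by simpa using hf.norm) (by simpa using hg.norm)
  simp only [Real.rpow_two, sq_abs, ← Real.sqrt_eq_rpow] at h
  refine le_trans (integral_mono (hf.integrable_mul hg) ?_ fun x => ?_) h
  · simpa [abs_mul] using (hf.integrable_mul hg).abs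
  · simpa [abs_mul] using le_abs_self (f x * g x)

/-- A smooth conformal factor on the model torus. -/
structure TorusMetric (F : ℝ × ℝ → ℝ) : Prop extends Biperiodic F where
  pos : ∀ p, 0 < F p

/-- The area of the model torus. -/
def torusArea (F : ℝ × ℝ → ℝ) : ℝ := ∫ p, F p ^ 2 ∂cell

/-- For φ = √f ψ the squared L² norm ∫ f²|ψ|² of a spinor component becomes ∫ f|φ|², and the
corresponding part of ∫ f²|Dψ|² becomes ∫ f⁻¹|∂̄φ|². The next two definitions are these forms in
lattice coordinates. -/
def torusMass (F : ℝ × ℝ → ℝ) (Φ : ℝ × ℝ → ℂ) : ℝ := ∫ p, F p * ‖Φ p‖ ^ 2 ∂cell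

def torusEnergy (ζ : ℂ) (F : ℝ × ℝ → ℝ) (Φ : ℝ × ℝ → ℂ) : ℝ :=
  ∫ p, (F p)⁻¹ * ‖cauchyOp ζ Φ p‖ ^ 2 ∂cell

namespace TorusMetric

variable {F : ℝ × ℝ → ℝ} {Φ Ψ : ℝ × ℝ → ℂ}

protected theorem continuous (hF : TorusMetric F) : Continuous F := hF.smooth.continuous

theorem continuous_inv (hF : TorusMetric F) : Continuous fun p => (F p)⁻¹ :=
  hF.continuous.inv₀ fun p => (hF.pos p).ne'

theorem mass_nonneg (hF : TorusMetric F) : 0 ≤ torusMass F Φ :=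
  integral_nonneg fun p => mul_nonneg (hF.pos p).le (by positivity)

theorem energy_nonneg (hF : TorusMetric F) (ζ : ℂ) : 0 ≤ torusEnergy ζ F Φ :=
  integral_nonneg fun p => mul_nonneg (inv_nonneg.2 (hF.pos p).le) (by positivity)

theorem area_nonneg : 0 ≤ torusArea F := integral_nonneg fun p => by positivity

/-- Cauchy-Schwarz for F and |Φ|², followed by the embedding into L⁴; the constant 16 is the root of
256. -/
theorem mass_le (hF : TorusMetric F) (h : Twisted Φ) :
    torusMass F Φ ≤ 16 * halfNorm Φ * √(torusArea F) := by
  have h1 := integral_mul_le_sqrt_mul_sqrt (memLp_of_continuous hF.continuous 2)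
    (memLp_of_continuous (h.continuous.norm.pow 2) 2)
  refine h1.trans ?_
  rw [mul_comm]
  have h2 : √(∫ p, (‖Φ p‖ ^ 2) ^ 2 ∂cell) ≤ 16 * halfNorm Φ := by
    rw [Real.sqrt_le_left (mul_nonneg (by norm_num) (halfNorm_nonneg Φ))]
    have := h.integral_pow_four_le
    simp only [← pow_mul]
    refine this.trans (le_of_eq (by ring))
  exact mul_le_mul_of_nonneg_right h2 (Real.sqrt_nonneg _)

/-- Cauchy-Schwarz with the weight √F on one factor and its inverse on the other: mass and energy
are dual to each other. -/
theorem norm_integral_conj_mul_le (hF : TorusMetric F) (hΦ : Continuous Φ) (hΨ : Continuous Ψ) :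
    ‖∫ p, (starRingEnd ℂ) (Ψ p) * Φ p ∂cell‖ ≤
      √(torusMass F Ψ) * √(∫ p, (F p)⁻¹ * ‖Φ p‖ ^ 2 ∂cell) := by
  refine (norm_integral_le_integral_norm _).trans ?_
  have h1 := integral_mul_le_sqrt_mul_sqrt
    (memLp_of_continuous (v := fun p => √(F p) * ‖Ψ p‖) (hF.continuous.sqrt.mul hΨ.norm) 2)
    (memLp_of_continuous (v := fun p => √((F p)⁻¹) * ‖Φ p‖) (hF.continuous_inv.sqrt.mul hΦ.norm) 2)
  have e1 (p) : (√(F p) * ‖Ψ p‖) ^ 2 = F p * ‖Ψ p‖ ^ 2 := by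
    rw [mul_pow, Real.sq_sqrt (hF.pos p).le]
  have e2 (p) : (√((F p)⁻¹) * ‖Φ p‖) ^ 2 = (F p)⁻¹ * ‖Φ p‖ ^ 2 := by
    rw [mul_pow, Real.sq_sqrt (inv_nonneg.2 (hF.pos p).le)]
  have e3 (p) : (√(F p) * ‖Ψ p‖) * (√((F p)⁻¹) * ‖Φ p‖) = ‖(starRingEnd ℂ) (Ψ p) * Φ p‖ := by
    rw [mul_mul_mul_comm, Real.sqrt_inv, mul_inv_cancel₀ (Real.sqrt_pos.2 (hF.pos p)).ne', one_mul]
    simp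
  simp only [e1, e2, e3] at h1
  exact h1

/-- The H^{1/2} norm is a pairing of `cauchyOp ζ Φ` with a function Ψ obtained from Φ by a bounded
multiplier. Weighted duality bounds the pairing by the mass of Ψ and the energy of Φ, and `mass_le`
returns the mass of Ψ to the H^{1/2} norm of Φ. -/
theorem halfNorm_le (hF : TorusMetric F) (h : Twisted Φ) {ζ : ℂ} {c : ℝ} (hc : 0 < c)
    (hζ : ∀ k, c * wt k ≤ ‖symb ζ k‖) :
    halfNorm Φ ≤ 16 / c ^ 2 * √(torusArea F) * torusEnergy ζ F Φ := by
  have hne (k) : symb ζ k ≠ 0 := norm_pos_iff.1 ((mul_pos hc (wt_pos k)).trans_le (hζ k))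
  have hb (k) : ‖(starRingEnd ℂ) (wt k / symb ζ k)‖ ≤ 1 / c := by
    rw [RCLike.norm_conj, norm_div, Complex.norm_real, Real.norm_of_nonneg (wt_pos k).le,
      div_le_div_iff₀ (norm_pos_iff.2 (hne k)) hc, one_mul, mul_comm]
    exact hζ k
  -- The multiplier is the conjugate of weight over symbol, so that pairing with the symbol leaves
  -- exactly the weight.
  obtain ⟨Ψ, hΨ, hcΨ⟩ := h.exists_multiplier hb
  have hp := hasSum_conj_coef_mul_coef hΨ.memLp (h.cauchyOp ζ).memLp
  have e (k) : (starRingEnd ℂ) (coef Ψ k) * coef (cauchyOp ζ Φ) k =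
      ((wt k * ‖coef Φ k‖ ^ 2 : ℝ) : ℂ) := by
    rw [hcΨ, h.coef_cauchyOp, map_mul, Complex.conj_conj]
    have : (starRingEnd ℂ) (coef Φ k) * coef Φ k = (‖coef Φ k‖ : ℂ) ^ 2 := Complex.conj_mul' _
    push_cast
    rw [← this]
    field_simp [hne k]
  simp only [e] at hp
  have h1 : ((halfNorm Φ : ℝ) : ℂ) = ∫ p, (starRingEnd ℂ) (Ψ p) * cauchyOp ζ Φ p ∂cell := by
    rw [← hp.tsum_eq, halfNorm, Complex.ofReal_tsum]
  have h2 : halfNorm Φ ≤ √(torusMass F Ψ) * √(torusEnergy ζ F Φ) := by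
    have := hF.norm_integral_conj_mul_le (h.cauchyOp ζ).continuous hΨ.continuous
    rw [← h1, Complex.norm_real] at this
    exact (le_abs_self _).trans this
  have h3 : halfNorm Ψ ≤ (1 / c) ^ 2 * halfNorm Φ := by
    rw [halfNorm, halfNorm, ← tsum_mul_left]
    refine hΨ.summable_half.tsum_le_tsum (fun k => ?_) (h.summable_half.mul_left _)
    rw [hcΨ, norm_mul, mul_pow]
    have := wt_pos k
    calc _ ≤ wt k * ((1 / c) ^ 2 * ‖coef Φ k‖ ^ 2) := by gcongr; exact hb k
      _ = _ := by ring
  set S := halfNorm Φ with hS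
  have hS0 : 0 ≤ S := halfNorm_nonneg Φ
  have hE := hF.energy_nonneg (Φ := Φ) ζ
  have h4 : S ^ 2 ≤ (16 / c ^ 2 * √(torusArea F) * torusEnergy ζ F Φ) * S := by
    calc S ^ 2 ≤ (√(torusMass F Ψ) * √(torusEnergy ζ F Φ)) ^ 2 := by gcongr
      _ = torusMass F Ψ * torusEnergy ζ F Φ := by
        rw [mul_pow, Real.sq_sqrt hF.mass_nonneg, Real.sq_sqrt hE]
      _ ≤ (16 * ((1 / c) ^ 2 * S) * √(torusArea F)) * torusEnergy ζ F Φ := by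
        gcongr
        exact (hF.mass_le hΨ).trans (by gcongr)
      _ = _ := by ring
  -- The estimate has the form S² ≤ K S; one factor S is cancelled.
  rcases hS0.eq_or_lt with h0 | h0
  · rw [← h0]; positivity
  · rw [sq] at h4
    exact le_of_mul_le_mul_right h4 h0

end TorusMetric

/-- `mass ≤ κ² · area · energy` for all conformal factors and all antiperiodic functions. -/
def GapBound (ζ : ℂ) (κ : ℝ) : Prop := ∀ F Φ, TorusMetric F → Twisted Φ →
  torusMass F Φ ≤ κ ^ 2 * (torusArea F * torusEnergy ζ F Φ)

/-- Combining `mass_le` with `halfNorm_le`, the conformal factor contributes only two factors √area.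
-/
theorem exists_gapBound {ζ : ℂ} (hζ : ζ.im ≠ 0) : ∃ κ > 0, GapBound ζ κ := by
  obtain ⟨c, hc, hs⟩ := exists_symb_lower hζ
  refine ⟨16 / c, by positivity, fun F Φ hF h => ?_⟩
  have h1 := hF.halfNorm_le h hc hs
  have h2 := hF.mass_le h
  have := Real.sq_sqrt (TorusMetric.area_nonneg (F := F))
  have hE := hF.energy_nonneg (Φ := Φ) ζ
  calc _ ≤ _ := h2
    _ ≤ 16 * (16 / c ^ 2 * √(torusArea F) * torusEnergy ζ F Φ) * √(torusArea F) := by gcongr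
    _ = (16 / c) ^ 2 * (√(torusArea F) ^ 2 * torusEnergy ζ F Φ) := by ring
    _ = _ := by rw [this]

/-! ### Stability of the gap inequality under changes of the lattice -/

theorem TorusMetric.sqrt_mass_le {F : ℝ × ℝ → ℝ} {Φ Ψ : ℝ × ℝ → ℂ} (hF : TorusMetric F)
    (h : Twisted Φ) (h' : Twisted Ψ) :
    √(torusMass F Φ) ≤ √(torusMass F Ψ) + √(torusMass F (fun p => Φ p - Ψ p)) := by
  have key : torusMass F Φ ≤ (√(torusMass F Ψ) + √(torusMass F (fun p => Φ p - Ψ p))) ^ 2 := by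
    have c1 : Continuous fun p => √(F p) * ‖Ψ p‖ := hF.continuous.sqrt.mul h'.continuous.norm
    have c2 : Continuous fun p => √(F p) * ‖Φ p - Ψ p‖ :=
      hF.continuous.sqrt.mul (h.continuous.sub h'.continuous).norm
    have h1 := integral_mul_le_sqrt_mul_sqrt (memLp_of_continuous c1 2) (memLp_of_continuous c2 2)
    have e1 (p) (z : ℂ) : (√(F p) * ‖z‖) ^ 2 = F p * ‖z‖ ^ 2 := by
      rw [mul_pow, Real.sq_sqrt (hF.pos p).le]
    simp only [e1] at h1
    rw [add_sq, Real.sq_sqrt hF.mass_nonneg, Real.sq_sqrt hF.mass_nonneg]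
    have h2 : torusMass F Φ ≤ torusMass F Ψ +
        2 * (∫ p, √(F p) * ‖Ψ p‖ * (√(F p) * ‖Φ p - Ψ p‖) ∂cell) +
        torusMass F (fun p => Φ p - Ψ p) := by
      have i1 : Integrable (fun p => F p * ‖Ψ p‖ ^ 2) cell :=
        integrable_of_continuous (hF.continuous.mul (h'.continuous.norm.pow 2))
      have i2 : Integrable (fun p => 2 * (√(F p) * ‖Ψ p‖ * (√(F p) * ‖Φ p - Ψ p‖))) cell :=
        (integrable_of_continuous (c1.mul c2)).const_mul 2
      have i3 : Integrable (fun p => F p * ‖Φ p - Ψ p‖ ^ 2) cell := integrable_of_continuous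
        (hF.continuous.mul ((h.continuous.sub h'.continuous).norm.pow 2))
      have i12 : Integrable (fun p => F p * ‖Ψ p‖ ^ 2 +
          2 * (√(F p) * ‖Ψ p‖ * (√(F p) * ‖Φ p - Ψ p‖))) cell := i1.add i2
      rw [torusMass, torusMass, torusMass, ← integral_const_mul]
      rw [← integral_add i1 i2, ← integral_add i12 i3]
      refine integral_mono (integrable_of_continuous (hF.continuous.mul (h.continuous.norm.pow 2)))
        (i12.add i3) fun p => ?_
      have t : ‖Φ p‖ ≤ ‖Ψ p‖ + ‖Φ p - Ψ p‖ := by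
        have := norm_add_le (Ψ p) (Φ p - Ψ p)
        rwa [add_sub_cancel] at this
      have hs := Real.mul_self_sqrt (hF.pos p).le
      calc F p * ‖Φ p‖ ^ 2 ≤ F p * (‖Ψ p‖ + ‖Φ p - Ψ p‖) ^ 2 := by
            have := (hF.pos p).le
            gcongr
        _ = F p * ‖Ψ p‖ ^ 2 + 2 * ((√(F p) * √(F p)) * ‖Ψ p‖ * ‖Φ p - Ψ p‖) +
            F p * ‖Φ p - Ψ p‖ ^ 2 := by rw [hs]; ring
        _ = _ := by ring
    unfold torusMass at *
    linarith
  exact Real.sqrt_le_iff.2 ⟨by positivity, key⟩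

/-- The two symbols differ by 2πi(ζ' - ζ)m up to sign, while the imaginary part alone makes the
symbol at ζ at least 2π|Im ζ||m|. The quotient is bounded independently of the frequency. -/
theorem halfNorm_sub_le {ζ ζ' : ℂ} (hζ : ζ.im ≠ 0) {Φ Φ' : ℝ × ℝ → ℂ} (h : Twisted Φ)
    (h' : Twisted Φ') (heq : ∀ k, symb ζ k * coef Φ k = symb ζ' k * coef Φ' k) :
    halfNorm (fun p => Φ p - Φ' p) ≤ (‖ζ - ζ'‖ / |ζ.im|) ^ 2 * halfNorm Φ' := by
  rw [halfNorm, halfNorm, ← tsum_mul_left]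
  refine (h.sub h').summable_half.tsum_le_tsum (fun k => ?_) (h'.summable_half.mul_left _)
  rw [coef_sub h.memLp h'.memLp]
  have hd : 0 < |ζ.im| := abs_pos.2 hζ
  have hs : symb ζ k * (coef Φ k - coef Φ' k) =
      (2 * Real.pi * Complex.I * ((ζ - ζ') * k.1)) * coef Φ' k := by
    rw [mul_sub, heq]; simp only [symb]; ring
  have h1 : ‖coef Φ k - coef Φ' k‖ ≤ ‖ζ - ζ'‖ / |ζ.im| * ‖coef Φ' k‖ := by
    have hs' := congrArg norm hs
    rw [norm_mul, norm_mul] at hs'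
    have hk : ‖(2 * Real.pi * Complex.I * ((ζ - ζ') * k.1) : ℂ)‖ =
        2 * Real.pi * (‖ζ - ζ'‖ * |(k.1:ℝ)|) := by
      simp [abs_of_pos Real.pi_pos]
    rw [hk] at hs'
    have hsy : 2 * Real.pi * (‖ζ - ζ'‖ * |(k.1:ℝ)|) ≤ ‖ζ - ζ'‖ / |ζ.im| * ‖symb ζ k‖ := by
      rw [norm_symb, div_mul_eq_mul_div, le_div_iff₀ hd]
      have := norm_symb_im ζ k
      have h3 : 0 ≤ 2 * Real.pi * ‖ζ - ζ'‖ := by positivity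
      nlinarith
    have hpos := norm_pos_iff.2 (symb_ne_zero hζ k)
    refine le_of_mul_le_mul_left (a := ‖symb ζ k‖) ?_ hpos
    rw [hs']
    calc _ ≤ ‖ζ - ζ'‖ / |ζ.im| * ‖symb ζ k‖ * ‖coef Φ' k‖ := by gcongr
      _ = _ := by ring
  have := wt_pos k
  calc _ ≤ wt k * (‖ζ - ζ'‖ / |ζ.im| * ‖coef Φ' k‖) ^ 2 := by gcongr
    _ = _ := by ring

theorem sqrt_mass_sub_le {ζ ζ₀ : ℂ} (hζ : ζ.im ≠ 0) {c : ℝ} (hc : 0 < c)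
    (hs : ∀ k, c * wt k ≤ ‖symb ζ₀ k‖) {Φ Φ₀ : ℝ × ℝ → ℂ} {F : ℝ × ℝ → ℝ} (hF : TorusMetric F)
    (h : Twisted Φ) (h₀ : Twisted Φ₀) (heq : ∀ k, symb ζ k * coef Φ k = symb ζ₀ k * coef Φ₀ k) :
    √(torusMass F (fun p => Φ p - Φ₀ p)) ≤ 16 / c * (‖ζ - ζ₀‖ / |ζ.im|) *
      √(torusArea F * torusEnergy ζ₀ F Φ₀) := by
  have h1 := halfNorm_sub_le hζ h h₀ heq
  have h2 := hF.halfNorm_le h₀ hc hs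
  have h3 := hF.mass_le (h.sub h₀)
  have hE := hF.energy_nonneg (Φ := Φ₀) ζ₀
  have hA := TorusMetric.area_nonneg (F := F)
  have hsq := Real.sq_sqrt hA
  rw [Real.sqrt_le_iff]
  refine ⟨by positivity, ?_⟩
  rw [mul_pow _ (√(torusArea F * _)), Real.sq_sqrt (by positivity)]
  calc _ ≤ _ := h3
    _ ≤ 16 * ((‖ζ - ζ₀‖ / |ζ.im|) ^ 2 * (16 / c ^ 2 * √(torusArea F) * torusEnergy ζ₀ F Φ₀)) *
        √(torusArea F) := by gcongr; exact h1.trans (by gcongr)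
    _ = (16 / c * (‖ζ - ζ₀‖ / |ζ.im|)) ^ 2 * (√(torusArea F) ^ 2 * torusEnergy ζ₀ F Φ₀) := by ring
    _ = _ := by rw [hsq]

/-- The symbol at ζ' has no zero, so its inverse is a bounded multiplier on smooth antiperiodic
functions. -/
theorem exists_cauchyOp_eq (ζ : ℂ) {ζ' : ℂ} (hζ' : ζ'.im ≠ 0) {Φ : ℝ × ℝ → ℂ}
    (h : Twisted Φ) : ∃ Φ', Twisted Φ' ∧ cauchyOp ζ' Φ' = cauchyOp ζ Φ := by
  obtain ⟨c, hc, hs⟩ := exists_symb_lower hζ'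
  have := (h.cauchyOp ζ).exists_multiplier (b := fun k => (symb ζ' k)⁻¹) (C := 1 / c) (fun k => by
    rw [norm_inv, one_div]
    refine inv_anti₀ hc (le_trans ?_ (hs k))
    exact le_mul_of_one_le_right hc.le (one_le_wt k))
  obtain ⟨Φ', h', hc'⟩ := this
  refine ⟨Φ', h', (h'.cauchyOp ζ').eq_of_coef (h.cauchyOp ζ) fun k => ?_⟩
  rw [h'.coef_cauchyOp, hc', mul_inv_cancel_left₀ (symb_ne_zero hζ' k)]

/-- Functions are matched by equal images under the two operators, hence have equal energy, and only
the mass changes. The lower bound `c` is needed at ζ₀ alone, so both directions have the same error.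
-/
theorem GapBound.perturb {ζ ζ₀ : ℂ} (hζ : ζ.im ≠ 0) (hζ₀ : ζ₀.im ≠ 0) {c : ℝ} (hc : 0 < c)
    (hs : ∀ k, c * wt k ≤ ‖symb ζ₀ k‖) {κ : ℝ} (hκ : 0 ≤ κ) :
    (GapBound ζ₀ κ → GapBound ζ (κ + 16 / c * (‖ζ - ζ₀‖ / |ζ.im|))) ∧
    (GapBound ζ κ → GapBound ζ₀ (κ + 16 / c * (‖ζ - ζ₀‖ / |ζ.im|))) := by
  have aux {F Φ Φ₀} (hF : TorusMetric F) (h : Twisted Φ) (h₀ : Twisted Φ₀)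
      (heq : cauchyOp ζ Φ = cauchyOp ζ₀ Φ₀) :
      torusEnergy ζ F Φ = torusEnergy ζ₀ F Φ₀ ∧
      √(torusMass F (fun p => Φ p - Φ₀ p)) ≤ 16 / c * (‖ζ - ζ₀‖ / |ζ.im|) *
      √(torusArea F * torusEnergy ζ₀ F Φ₀) := by
    refine ⟨by rw [torusEnergy, torusEnergy, heq], sqrt_mass_sub_le hζ hc hs hF h h₀ fun k => ?_⟩
    rw [← h.coef_cauchyOp, ← h₀.coef_cauchyOp, heq]
  have fin {F Φ Ψ} {X ρ : ℝ} (hF : TorusMetric F) (h : Twisted Φ) (hΨ : Twisted Ψ) (hX : 0 ≤ X)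
      (hρ : 0 ≤ ρ) (h1 : torusMass F Ψ ≤ κ ^ 2 * X) (h2 : √(torusMass F (fun p => Φ p - Ψ p)) ≤ ρ * √X) :
      torusMass F Φ ≤ (κ + ρ) ^ 2 * X := by
    have h3 := hF.sqrt_mass_le h hΨ
    have h4 : √(torusMass F Ψ) ≤ κ * √X := by
      rw [Real.sqrt_le_iff]
      refine ⟨by positivity, ?_⟩
      rw [mul_pow, Real.sq_sqrt hX]; exact h1
    have h5 : √(torusMass F Φ) ≤ (κ + ρ) * √X := by linarith
    rw [Real.sqrt_le_iff, mul_pow, Real.sq_sqrt hX] at h5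
    exact h5.2
  have hρ : 0 ≤ 16 / c * (‖ζ - ζ₀‖ / |ζ.im|) := by positivity
  constructor
  · intro hg F Φ hF h
    obtain ⟨Φ₀, h₀, heq⟩ := exists_cauchyOp_eq ζ hζ₀ h
    obtain ⟨hE, hm⟩ := aux hF h h₀ heq.symm
    rw [hE]
    exact fin hF h h₀ (mul_nonneg TorusMetric.area_nonneg (hF.energy_nonneg _)) hρ (hg F Φ₀ hF h₀) hm
  · intro hg F Φ₀ hF h₀
    obtain ⟨Φ, h, heq⟩ := exists_cauchyOp_eq ζ₀ hζ h₀
    obtain ⟨hE, hm⟩ := aux hF h h₀ heq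
    have h1 := hg F Φ hF h
    rw [hE] at h1
    refine fin hF h₀ h (mul_nonneg TorusMetric.area_nonneg (hF.energy_nonneg _)) hρ h1 ?_
    have : torusMass F (fun p => Φ₀ p - Φ p) = torusMass F (fun p => Φ p - Φ₀ p) := by
      simp only [torusMass, norm_sub_rev]
    rw [this]; exact hm

/-! ## The variational principle -/

/-- A minimizing sequence of the Rayleigh quotient `‖κ v‖² / ‖ι v‖²` converges, and its limit
satisfies the Euler-Lagrange equation, provided that `κ`-bounded sequences are `ι`-precompact. -/
theorem exists_minimizing_sequence {V H : Type*} [AddCommGroup V] [Module ℂ V]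
    [NormedAddCommGroup H] [InnerProductSpace ℂ H] [CompleteSpace H] (ι κ : V →ₗ[ℂ] H)
    (hcpt : ∀ (a : ℕ → V) (M : ℝ), (∀ n, ‖ι (a n)‖ ≤ 1) → (∀ n, ‖κ (a n)‖ ^ 2 ≤ M) →
      ∃ g : ℕ → ℕ, StrictMono g ∧ CauchySeq fun n => ι (a (g n)))
    (hne : ∃ v, ι v ≠ 0) :
    ∃ μ : ℝ, (∀ v, μ * ‖ι v‖ ^ 2 ≤ ‖κ v‖ ^ 2) ∧ ∃ (a : ℕ → V) (u w : H),
      Tendsto (fun n => ι (a n)) atTop (𝓝 u) ∧ Tendsto (fun n => κ (a n)) atTop (𝓝 w) ∧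
      ‖u‖ = 1 ∧ ∀ v, inner ℂ (κ v) w = μ * inner ℂ (ι v) u := by
  set A : Set ℝ := {r | ∃ v, ‖ι v‖ = 1 ∧ r = ‖κ v‖ ^ 2} with hA
  have hbdd : BddBelow A := ⟨0, by rintro r ⟨v, _, rfl⟩; positivity⟩
  have hnorm {v : V} (hv : ι v ≠ 0) : ‖ι (((‖ι v‖⁻¹ : ℝ) : ℂ) • v)‖ = 1 := by
    rw [map_smul, norm_smul, Complex.norm_real, norm_inv, norm_norm,
      inv_mul_cancel₀ (norm_ne_zero_iff.2 hv)]
  have hAne : A.Nonempty := by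
    obtain ⟨v, hv⟩ := hne
    exact ⟨_, _, hnorm hv, rfl⟩
  set μ := sInf A with hμ
  have hμ0 : 0 ≤ μ := le_csInf hAne (by rintro r ⟨v, _, rfl⟩; positivity)
  have hmin (v : V) : μ * ‖ι v‖ ^ 2 ≤ ‖κ v‖ ^ 2 := by
    by_cases hv : ι v = 0
    · simp [hv]
    have h1 : μ ≤ ‖κ (((‖ι v‖⁻¹ : ℝ) : ℂ) • v)‖ ^ 2 := csInf_le hbdd ⟨_, hnorm hv, rfl⟩
    have hp : 0 < ‖ι v‖ := norm_pos_iff.2 hv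
    rw [map_smul, norm_smul, Complex.norm_real, norm_inv, norm_norm, mul_pow, inv_pow,
      ← div_eq_inv_mul, le_div_iff₀ (by positivity)] at h1
    exact h1
  have hex (n : ℕ) : ∃ v, ‖ι v‖ = 1 ∧ ‖κ v‖ ^ 2 < μ + 1 / ((n : ℝ) + 1) := by
    obtain ⟨r, ⟨v, hv, rfl⟩, hr⟩ := exists_lt_of_csInf_lt hAne
      (show sInf A < μ + 1 / ((n : ℝ) + 1) by rw [← hμ]; linarith [show 0 < 1 / ((n : ℝ) + 1) by positivity])
    exact ⟨v, hv, hr⟩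
  choose b hb1 hb2 using hex
  obtain ⟨g, hg, hcau⟩ := hcpt b (μ + 1) (fun n => (hb1 n).le) (fun n => (hb2 n).le.trans (by
    have : 1 / ((n : ℝ) + 1) ≤ 1 := by rw [div_le_one (by positivity)]; linarith [n.cast_nonneg (α := ℝ)]
    linarith))
  set a : ℕ → V := fun n => b (g n) with ha
  have ha1 (n) : ‖ι (a n)‖ = 1 := hb1 _
  have ha2 (n) : ‖κ (a n)‖ ^ 2 ≤ μ + 1 / ((n : ℝ) + 1) := (hb2 _).le.trans (by
    have : (n : ℝ) ≤ g n := by exact_mod_cast hg.id_le n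
    gcongr)
  have hpar (n m) : ‖κ (a n) - κ (a m)‖ ^ 2 ≤
      -- The parallelogram law in both norms, with minimality applied to the sum of the two members:
      -- convergence under ι forces convergence under κ, so no weak limits are needed.
      2 * (1 / ((n : ℝ) + 1)) + 2 * (1 / ((m : ℝ) + 1)) + μ * ‖ι (a n) - ι (a m)‖ ^ 2 := by
    have p1 := parallelogram_law_with_norm ℂ (κ (a n)) (κ (a m))
    have p2 := parallelogram_law_with_norm ℂ (ι (a n)) (ι (a m))
    have h1 := hmin (a n + a m)
    rw [map_add, map_add] at h1
    rw [ha1, ha1] at p2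
    have := ha2 n
    have := ha2 m
    nlinarith
  have hcauκ : CauchySeq fun n => κ (a n) := by
    rw [Metric.cauchySeq_iff]
    intro ε hε
    have ht : Tendsto (fun n : ℕ => 1 / ((n : ℝ) + 1)) atTop (𝓝 0) := tendsto_one_div_add_atTop_nhds_zero_nat
    obtain ⟨N1, hN1⟩ := eventually_atTop.1 (ht.eventually (gt_mem_nhds (show 0 < ε ^ 2 / 8 by positivity)))
    -- This radius keeps the term with μ below ε²/4, since 4μ ≤ (2(μ + 1))²; the shift by one covers
    -- μ = 0.
    obtain ⟨N2, hN2⟩ := Metric.cauchySeq_iff.1 hcau (ε / (2 * (μ + 1))) (by positivity)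
    refine ⟨max N1 N2, fun m hm n hn => ?_⟩
    have h0 := (hN2 m (le_of_max_le_right hm) n (le_of_max_le_right hn)).le
    rw [dist_eq_norm] at h0 ⊢
    have h1 : (ε / (2 * (μ + 1))) ^ 2 * μ ≤ ε ^ 2 / 4 := by
      rw [div_pow, div_mul_eq_mul_div, div_le_div_iff₀ (by positivity) (by norm_num)]
      have : μ * 4 ≤ (2 * (μ + 1)) ^ 2 := by nlinarith
      nlinarith [sq_nonneg ε]
    have h2 : ‖ι (a m) - ι (a n)‖ ^ 2 ≤ (ε / (2 * (μ + 1))) ^ 2 := by gcongr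
    have h3 := hpar m n
    have h4 := hN1 m (le_of_max_le_left hm)
    have h5 := hN1 n (le_of_max_le_left hn)
    have h6 : ‖κ (a m) - κ (a n)‖ ^ 2 < ε ^ 2 := by nlinarith
    exact lt_of_pow_lt_pow_left₀ 2 hε.le h6
  obtain ⟨u, hu⟩ := cauchySeq_tendsto_of_complete hcau
  obtain ⟨w, hw⟩ := cauchySeq_tendsto_of_complete hcauκ
  have hu1 : ‖u‖ = 1 := by
    refine tendsto_nhds_unique hu.norm ?_
    change Tendsto (fun n => ‖ι (a n)‖) _ _
    simp only [ha1]; exact tendsto_const_nhds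
  have hwμ : ‖w‖ ^ 2 ≤ μ := by
    have h1 := (hw.norm.pow 2)
    have h2 : Tendsto (fun n : ℕ => μ + 1 / ((n : ℝ) + 1)) atTop (𝓝 (μ + 0)) :=
      tendsto_one_div_add_atTop_nhds_zero_nat.const_add μ
    rw [add_zero] at h2
    exact le_of_tendsto_of_tendsto' h1 h2 ha2
  refine ⟨μ, hmin, a, u, w, hu, hw, hu1, fun v => ?_⟩
  -- Minimality passes to the limit pair (u, w) and to all its variations along V, although u itself
  -- need not come from a vector of V.
  have hq (t : ℂ) : μ * ‖u + t • ι v‖ ^ 2 ≤ ‖w + t • κ v‖ ^ 2 := by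
    have h1 : Tendsto (fun n => μ * ‖ι (a n) + t • ι v‖ ^ 2) atTop (𝓝 (μ * ‖u + t • ι v‖ ^ 2)) :=
      ((hu.add_const _).norm.pow 2).const_mul μ
    have h2 : Tendsto (fun n => ‖κ (a n) + t • κ v‖ ^ 2) atTop (𝓝 (‖w + t • κ v‖ ^ 2)) :=
      (hw.add_const _).norm.pow 2
    refine le_of_tendsto_of_tendsto' h1 h2 fun n => ?_
    have := hmin (a n + t • v)
    simpa only [map_add, map_smul] using this
  set X : ℂ := inner ℂ (κ v) w - μ * inner ℂ (ι v) u with hX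
  set B : ℝ := ‖κ v‖ ^ 2 - μ * ‖ι v‖ ^ 2 with hB
  have hB0 : 0 ≤ B := sub_nonneg.2 (hmin v)
  have hexp (t : ℂ) : 0 ≤ 2 * ((starRingEnd ℂ) t * X).re + ‖t‖ ^ 2 * B := by
    have h := hq t
    rw [@norm_add_sq ℂ, @norm_add_sq ℂ, hu1, norm_smul, norm_smul, mul_pow, mul_pow] at h
    have e1 : RCLike.re (inner ℂ u (t • ι v)) = ((starRingEnd ℂ) t * inner ℂ (ι v) u).re := by
      rw [inner_re_symm, inner_smul_left]; rfl
    have e2 : RCLike.re (inner ℂ w (t • κ v)) = ((starRingEnd ℂ) t * inner ℂ (κ v) w).re := by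
      rw [inner_re_symm, inner_smul_left]; rfl
    rw [e1, e2] at h
    have e3 : ((starRingEnd ℂ) t * X).re = ((starRingEnd ℂ) t * inner ℂ (κ v) w).re -
        μ * ((starRingEnd ℂ) t * inner ℂ (ι v) u).re := by
      rw [hX, mul_sub, Complex.sub_re, mul_left_comm, Complex.re_ofReal_mul]
    rw [e3, hB]
    nlinarith
  have hXz : X = 0 := by
    by_contra hne0
    have hXp : 0 < ‖X‖ ^ 2 := by positivity
    -- Varying against the defect X makes the linear term dominate. The denominator B + 1 avoids
    -- dividing by zero and keeps the quadratic term at most half as large.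
    have h1 := hexp (-((1 / (B + 1) : ℝ) : ℂ) * X)
    have e1 : ((starRingEnd ℂ) (-((1 / (B + 1) : ℝ) : ℂ) * X) * X).re = -(1 / (B + 1)) * ‖X‖ ^ 2 := by
      rw [map_mul, mul_assoc, Complex.conj_mul', map_neg, Complex.conj_ofReal, ← Complex.ofReal_neg,
        ← Complex.ofReal_pow, Complex.re_ofReal_mul, Complex.ofReal_re]
    have e2 : ‖-((1 / (B + 1) : ℝ) : ℂ) * X‖ ^ 2 = (1 / (B + 1)) ^ 2 * ‖X‖ ^ 2 := by
      rw [norm_mul, norm_neg, Complex.norm_real, mul_pow, Real.norm_eq_abs, sq_abs]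
    rw [e1, e2] at h1
    have h2 : (1 / (B + 1)) * B ≤ 1 := by
      rw [one_div, inv_mul_le_one₀ (by positivity)]; linarith
    have h3 : 0 < 1 / (B + 1) := by positivity
    nlinarith [mul_pos h3 hXp]
  exact sub_eq_zero.1 hXz

/-! ## Rellich's theorem on the torus -/

/-- Tychonoff for the Fourier coefficients gives a subsequence converging at each frequency. The
bound M makes the high frequencies uniformly small, so finitely many frequencies decide the L²
distance. -/
theorem exists_subseq_cauchy (v : ℕ → ℝ × ℝ → ℂ) (hv : ∀ n, MemLp (v n) 2 cell) (M : ℝ)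
    (hs : ∀ n, Summable fun k => wt k ^ 2 * ‖coef (v n) k‖ ^ 2)
    (hM : ∀ n, ∑' k, wt k ^ 2 * ‖coef (v n) k‖ ^ 2 ≤ M) :
    ∃ g : ℕ → ℕ, StrictMono g ∧ ∀ ε > 0, ∃ N, ∀ n ≥ N, ∀ m ≥ N,
      ∫ p, ‖v (g n) p - v (g m) p‖ ^ 2 ∂cell ≤ ε := by
  have hM0 : 0 ≤ M := (tsum_nonneg fun k => by positivity).trans (hM 0)
  have hball (n : ℕ) : coef (v n) ∈ univ.pi fun _ : ℤ × ℤ => Metric.closedBall (0 : ℂ) √M := by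
    intro k _
    rw [mem_closedBall_zero_iff]
    refine Real.le_sqrt_of_sq_le (le_trans ?_ (((hs n).le_tsum k fun k _ => by positivity).trans (hM n)))
    exact le_mul_of_one_le_left (by positivity) (one_le_pow₀ (one_le_wt k))
  obtain ⟨L, _, g, hg, hL⟩ := (isCompact_univ_pi fun _ => isCompact_closedBall _ _).tendsto_subseq hball
  refine ⟨g, hg, fun ε hε => ?_⟩
  -- Beyond weight X the squared difference is at most 4M/X² ≤ ε/2; the summand 1 ensures X ≤ X².
  set X : ℝ := 1 + 8 * M / ε
  have hX : 1 ≤ X := by simp only [X]; linarith [show 0 ≤ 8 * M / ε by positivity]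
  obtain ⟨s, hsX, -⟩ := exists_finset_wt_le (X := X) (by linarith)
  have hlim : Tendsto (fun n => ∑ k ∈ s, ‖coef (v (g n)) k - L k‖ ^ 2) atTop (𝓝 0) := by
    have : Tendsto (fun n => ∑ k ∈ s, ‖coef (v (g n)) k - L k‖ ^ 2) atTop (𝓝 (∑ k ∈ s, ‖L k - L k‖ ^ 2)) := by
      refine tendsto_finsetSum _ fun k _ => ?_
      exact (((tendsto_pi_nhds.1 hL k).sub_const _).norm).pow 2
    simpa using this
  obtain ⟨N, hN⟩ := eventually_atTop.1 (hlim.eventually (gt_mem_nhds (show 0 < ε / 8 by positivity)))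
  refine ⟨N, fun n hn m hm => ?_⟩
  have hp := hasSum_norm_coef_sq ((hv (g n)).sub (hv (g m)))
  have hd (k) : coef (v (g n) - v (g m)) k = coef (v (g n)) k - coef (v (g m)) k :=
    coef_sub (hv _) (hv _) k
  simp only [hd] at hp
  have hsq (x y : ℂ) : ‖x - y‖ ^ 2 ≤ 2 * (‖x‖ ^ 2 + ‖y‖ ^ 2) := by
    have h1 := norm_sub_le x y
    have h2 : ‖x - y‖ ^ 2 ≤ (‖x‖ + ‖y‖) ^ 2 := by gcongr
    nlinarith [sq_nonneg (‖x‖ - ‖y‖)]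
  have hsum2 := ((hs (g n)).add (hs (g m))).mul_left (2 / X ^ 2)
  have hfin : Summable fun k => if k ∈ s then ‖coef (v (g n)) k - coef (v (g m)) k‖ ^ 2 else 0 :=
    summable_of_ne_finset_zero (s := s) (fun k hk => if_neg hk)
  have hle (k) : ‖coef (v (g n)) k - coef (v (g m)) k‖ ^ 2 ≤
      (if k ∈ s then ‖coef (v (g n)) k - coef (v (g m)) k‖ ^ 2 else 0) +
      2 / X ^ 2 * (wt k ^ 2 * ‖coef (v (g n)) k‖ ^ 2 + wt k ^ 2 * ‖coef (v (g m)) k‖ ^ 2) := by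
    split_ifs with hk
    · have := wt_pos k
      have : 0 ≤ 2 / X ^ 2 * (wt k ^ 2 * ‖coef (v (g n)) k‖ ^ 2 + wt k ^ 2 * ‖coef (v (g m)) k‖ ^ 2) := by positivity
      linarith
    · rw [hsX, not_le] at hk
      rw [zero_add]
      refine (hsq _ _).trans ?_
      have h1 : 1 ≤ wt k ^ 2 / X ^ 2 := by
        rw [one_le_div (by positivity)]; gcongr
      calc 2 * (‖coef (v (g n)) k‖ ^ 2 + ‖coef (v (g m)) k‖ ^ 2)
          ≤ (wt k ^ 2 / X ^ 2) * (2 * (‖coef (v (g n)) k‖ ^ 2 + ‖coef (v (g m)) k‖ ^ 2)) :=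
            le_mul_of_one_le_left (by positivity) h1
        _ = _ := by ring
  have h1 := hp.summable.tsum_le_tsum hle (hfin.add hsum2)
  rw [hp.tsum_eq, hfin.tsum_add hsum2, tsum_mul_left, (hs (g n)).tsum_add (hs (g m)),
    tsum_eq_sum (s := s) (fun k hk => if_neg hk)] at h1
  have h2 : ∑ k ∈ s, (if k ∈ s then ‖coef (v (g n)) k - coef (v (g m)) k‖ ^ 2 else 0) ≤ ε / 2 := by
    have h3 : ∑ k ∈ s, (if k ∈ s then ‖coef (v (g n)) k - coef (v (g m)) k‖ ^ 2 else 0) ≤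
        ∑ k ∈ s, 2 * (‖coef (v (g n)) k - L k‖ ^ 2 + ‖coef (v (g m)) k - L k‖ ^ 2) := by
      refine Finset.sum_le_sum fun k hk => ?_
      rw [if_pos hk]
      have := hsq (coef (v (g n)) k - L k) (coef (v (g m)) k - L k)
      rwa [sub_sub_sub_cancel_right] at this
    rw [← Finset.mul_sum, Finset.sum_add_distrib] at h3
    have := hN n hn
    have := hN m hm
    linarith
  have h4 : 2 / X ^ 2 * (∑' k, wt k ^ 2 * ‖coef (v (g n)) k‖ ^ 2 + ∑' k, wt k ^ 2 * ‖coef (v (g m)) k‖ ^ 2) ≤ ε / 2 := by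
    calc _ ≤ 2 / X ^ 2 * (M + M) := by gcongr <;> exact hM _
      _ ≤ ε / 2 := by
        rw [div_mul_eq_mul_div, div_le_iff₀ (by positivity)]
        have : 8 * M / ε * ε = 8 * M := by field_simp
        have hX1 : 8 * M ≤ X * ε := by simp only [X]; nlinarith
        have : X * ε ≤ X ^ 2 * ε := by
          have : X ≤ X ^ 2 := by nlinarith
          gcongr
        linarith
  have e : ∀ p, (v (g n) - v (g m)) p = v (g n) p - v (g m) p := fun p => rfl
  simp only [e] at h1
  linarith

/-- Ellipticity in its simplest form: the operator controls one full derivative in L². It feeds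
Rellich's theorem. -/
theorem summable_wt_sq_of_coef_eq {ζ : ℂ} {c : ℝ} (hc : 0 < c) (hs : ∀ k, c * wt k ≤ ‖symb ζ k‖)
    {v w : ℝ × ℝ → ℂ} (hw : MemLp w 2 cell) (h : ∀ k, coef w k = symb ζ k * coef v k) :
    (Summable fun k => wt k ^ 2 * ‖coef v k‖ ^ 2) ∧
      ∑' k, wt k ^ 2 * ‖coef v k‖ ^ 2 ≤ 1 / c ^ 2 * ∫ p, ‖w p‖ ^ 2 ∂cell := by
  have hp := hasSum_norm_coef_sq hw
  have hle (k) : wt k ^ 2 * ‖coef v k‖ ^ 2 ≤ 1 / c ^ 2 * ‖coef w k‖ ^ 2 := by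
    rw [h, norm_mul, mul_pow, ← mul_assoc]
    refine mul_le_mul_of_nonneg_right ?_ (by positivity)
    rw [one_div_mul_eq_div, le_div_iff₀ (by positivity), ← mul_pow]
    have := wt_pos k
    rw [mul_comm]
    exact pow_le_pow_left₀ (by positivity) (hs k) 2
  have hsum : Summable fun k => wt k ^ 2 * ‖coef v k‖ ^ 2 :=
    Summable.of_nonneg_of_le (fun k => by positivity) hle (hp.summable.mul_left _)
  refine ⟨hsum, ?_⟩
  rw [← hp.tsum_eq, ← tsum_mul_left]
  exact hsum.tsum_le_tsum hle (hp.summable.mul_left _)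

/-! ## Sobolev regularity on the torus -/

/-- Square integrable functions with `n` square integrable derivatives. -/
def Sob (n : ℕ) (v : ℝ × ℝ → ℂ) : Prop :=
  MemLp v 2 cell ∧ Summable fun k => wt k ^ (2 * n) * ‖coef v k‖ ^ 2

theorem sob_zero {v : ℝ × ℝ → ℂ} (hv : MemLp v 2 cell) : Sob 0 v :=
  ⟨hv, by simpa using (hasSum_norm_coef_sq hv).summable⟩

theorem Sob.of_coef_le {n m : ℕ} {v w : ℝ × ℝ → ℂ} (hv : MemLp v 2 cell) (hw : Sob m w) (C : ℝ)
    (h : ∀ k, wt k ^ n * ‖coef v k‖ ≤ C * (wt k ^ m * ‖coef w k‖)) : Sob n v := by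
  refine ⟨hv, Summable.of_nonneg_of_le (fun k => ?_) (fun k => ?_) (hw.2.mul_left (C ^ 2))⟩
  · have := wt_pos k; positivity
  · have := wt_pos k
    calc wt k ^ (2 * n) * ‖coef v k‖ ^ 2 = (wt k ^ n * ‖coef v k‖) ^ 2 := by ring
      _ ≤ (C * (wt k ^ m * ‖coef w k‖)) ^ 2 := pow_le_pow_left₀ (by positivity) (h k) 2
      _ = _ := by ring

theorem Sob.mono {n : ℕ} {v : ℝ × ℝ → ℂ} (h : Sob (n + 1) v) : Sob n v := by
  refine Sob.of_coef_le h.1 h 1 fun k => ?_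
  have := one_le_wt k
  rw [one_mul, pow_succ]
  gcongr
  exact le_mul_of_one_le_right (by positivity) this

theorem Sob.add {n : ℕ} {u v : ℝ × ℝ → ℂ} (hu : Sob n u) (hv : Sob n v) :
    Sob n (fun p => u p + v p) := by
  refine ⟨hu.1.add hv.1, Summable.of_nonneg_of_le (fun k => ?_) (fun k => ?_) ((hu.2.add hv.2).mul_left 2)⟩
  · have := wt_pos k; positivity
  · rw [coef_add hu.1 hv.1]
    have := wt_pos k
    have h2 : ‖coef u k + coef v k‖ ^ 2 ≤ 2 * (‖coef u k‖ ^ 2 + ‖coef v k‖ ^ 2) := by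
      have h1 := norm_add_le (coef u k) (coef v k)
      have h2 : ‖coef u k + coef v k‖ ^ 2 ≤ (‖coef u k‖ + ‖coef v k‖) ^ 2 := by gcongr
      nlinarith [sq_nonneg (‖coef u k‖ - ‖coef v k‖)]
    calc _ ≤ wt k ^ (2 * n) * (2 * (‖coef u k‖ ^ 2 + ‖coef v k‖ ^ 2)) := by gcongr
      _ = _ := by ring

theorem Sob.const_mul {n : ℕ} {v : ℝ × ℝ → ℂ} (hv : Sob n v) (c : ℂ) : Sob n (fun p => c * v p) := by
  refine Sob.of_coef_le (hv.1.const_mul c) hv ‖c‖ fun k => ?_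
  rw [coef_const_mul, norm_mul]
  exact le_of_eq (by ring)

/-- Elliptic regularity for `∂_t - ζ ∂_s` on the torus. -/
theorem Sob.of_symb {ζ : ℂ} (hζ : ζ.im ≠ 0) {n : ℕ} {v w : ℝ × ℝ → ℂ} (hv : MemLp v 2 cell)
    (hw : Sob n w) (h : ∀ k, symb ζ k * coef v k = coef w k) : Sob (n + 1) v := by
  obtain ⟨c, hc, hs⟩ := exists_symb_lower hζ
  refine Sob.of_coef_le hv hw (1 / c) fun k => ?_
  rw [← h, norm_mul, one_div_mul_eq_div, le_div_iff₀ hc]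
  have := wt_pos k
  calc wt k ^ (n + 1) * ‖coef v k‖ * c = wt k ^ n * ((c * wt k) * ‖coef v k‖) := by ring
    _ ≤ _ := by gcongr; exact hs k

theorem rapidDecay_of_sob {v : ℝ × ℝ → ℂ} (h : ∀ n, Sob n v) : RapidDecay (coef v) := by
  intro n
  refine ⟨√(∑' k, wt k ^ (2 * n) * ‖coef v k‖ ^ 2), fun k => Real.le_sqrt_of_sq_le ?_⟩
  refine le_trans (le_of_eq (by ring)) ((h n).2.le_tsum k fun k _ => ?_)
  have := wt_pos k; positivity

theorem exists_twisted_ae_eq {v : ℝ × ℝ → ℂ} (h : ∀ n, Sob n v) : ∃ U, Twisted U ∧ v =ᵐ[cell] U := by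
  have hr := rapidDecay_of_sob h
  refine ⟨_, hr.twisted_synth, ?_⟩
  have := ae_eq_zero_of_coef_eq_zero ((h 0).1.sub hr.twisted_synth.memLp) fun k => by
    have := coef_sub (h 0).1 hr.twisted_synth.memLp k
    rw [hr.coef_synth, sub_self] at this
    exact this
  filter_upwards [this] with p hp
  exact sub_eq_zero.1 hp

/-- The Fourier symbol of the directional derivative. -/
def dsymb (e : ℝ × ℝ) (k : ℤ × ℤ) : ℂ := 2 * Real.pi * Complex.I * (k.1 * e.1 + (k.2 + 1 / 2) * e.2)

theorem conj_dsymb (e : ℝ × ℝ) (k : ℤ × ℤ) : (starRingEnd ℂ) (dsymb e k) = -dsymb e k := by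
  simp [dsymb, Complex.conj_ofNat]

theorem memLp_bounded_mul {F v : ℝ × ℝ → ℂ} (hF : Continuous F) (hv : MemLp v 2 cell) :
    MemLp (fun p => F p * v p) 2 cell := by
  exact hv.mul (memLp_of_continuous hF ⊤)

/-- Parseval converts multiplication of the coefficients by the derivative symbol into integration
by parts against smooth antiperiodic functions, where the function v itself has no classical
derivative. -/
theorem integral_weakDeriv {v w : ℝ × ℝ → ℂ} (hv : MemLp v 2 cell) (hw : MemLp w 2 cell) {e : ℝ × ℝ}
    (h : ∀ k, coef w k = dsymb e k * coef v k) {θ : ℝ × ℝ → ℂ} (hθ : Twisted θ) :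
    ∫ p, θ p * w p ∂cell = -∫ p, fderiv ℝ θ p e * v p ∂cell := by
  have h1 := hasSum_conj_coef_mul_coef hθ.conj.memLp hw
  have h2 := (hasSum_conj_coef_mul_coef (hθ.conj.fderiv e).memLp hv).neg
  simp only [Complex.conj_conj] at h1
  simp only [fderiv_conj, Complex.conj_conj] at h2
  refine h1.unique (h2.congr_fun fun k => ?_)
  have := hθ.conj.coef_fderiv e k
  simp only [fderiv_conj] at this
  rw [this, h, map_mul]
  have := conj_dsymb e k
  rw [dsymb] at this
  rw [this, dsymb]
  ring

theorem Sob.exists_weakDeriv {n : ℕ} {v : ℝ × ℝ → ℂ} (h : Sob (n + 1) v) {e : ℝ × ℝ}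
    (he : ∀ k, ‖dsymb e k‖ ≤ 7 * wt k) : ∃ w, Sob n w ∧ ∀ k, coef w k = dsymb e k * coef v k := by
  have hb (k) : ‖dsymb e k * coef v k‖ ^ 2 ≤ 49 * (wt k ^ (2 * (n + 1)) * ‖coef v k‖ ^ 2) := by
    have h1 := one_le_wt k
    calc ‖dsymb e k * coef v k‖ ^ 2 ≤ (7 * wt k * ‖coef v k‖) ^ 2 := by
          rw [norm_mul]; gcongr; exact he k
      _ = 49 * (wt k ^ 2 * ‖coef v k‖ ^ 2) := by ring
      _ ≤ _ := by
        gcongr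
        · omega
  obtain ⟨w, hw, hc⟩ := exists_coef_eq (Summable.of_nonneg_of_le (fun k => by positivity) hb (h.2.mul_left 49))
  refine ⟨w, Sob.of_coef_le hw h 7 fun k => ?_, hc⟩
  rw [hc, norm_mul]
  have := wt_pos k
  calc _ ≤ wt k ^ n * (7 * wt k * ‖coef v k‖) := by gcongr; exact he k
    _ = _ := by ring

theorem Sob.bimul {n : ℕ} {v F : ℝ × ℝ → ℂ} (h : Sob n v) (hF : Biperiodic F) :
    Sob n (fun p => F p * v p) := by
  induction n generalizing v F with
  | zero => exact sob_zero (memLp_bounded_mul hF.smooth.continuous h.1)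
  | succ n ih =>
    have key {e : ℝ × ℝ} (he : ∀ k, ‖dsymb e k‖ ≤ 7 * wt k) :
        ∃ g, Sob n g ∧ ∀ k, dsymb e k * coef (fun p => F p * v p) k = coef g k := by
      obtain ⟨w, hw, hc⟩ := h.exists_weakDeriv he
      refine ⟨fun p => F p * w p + fderiv ℝ F p e * v p, (ih hw hF).add (ih h.mono (hF.fderiv e)),
        fun k => ?_⟩
      rw [coef_add (ih hw hF).1 (ih h.mono (hF.fderiv e)).1]
      -- Testing the weak derivative of v against F times an exponential yields the Leibniz rule for
      -- the coefficients of F v.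
      have hθ := (twisted_expo k).conj.bimul hF
      have h1 := integral_weakDeriv h.1 hw.1 hc hθ
      have e1 (p) : fderiv ℝ (fun p => F p * (starRingEnd ℂ) (expo k p)) p e =
          fderiv ℝ F p e * (starRingEnd ℂ) (expo k p) - dsymb e k * (F p * (starRingEnd ℂ) (expo k p)) := by
        rw [fderiv_fun_mul (hF.smooth.differentiable (by simp)).differentiableAt
          (twisted_expo k).conj.differentiable.differentiableAt]
        simp only [add_apply, smul_apply, smul_eq_mul]
        rw [fderiv_conj, fderiv_expo, map_mul]
        have := conj_dsymb e k
        rw [dsymb] at this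
        rw [this, dsymb]
        ring
      simp only [e1] at h1
      have i1 := integrable_mul_conj_expo (ih h.mono (hF.fderiv e)).1 k
      have i2 := (integrable_mul_conj_expo (ih h.mono hF).1 k).const_mul (dsymb e k)
      have e2 : ∫ p, (fderiv ℝ F p e * (starRingEnd ℂ) (expo k p) -
          dsymb e k * (F p * (starRingEnd ℂ) (expo k p))) * v p ∂cell =
          coef (fun p => fderiv ℝ F p e * v p) k - dsymb e k * coef (fun p => F p * v p) k := by
        rw [coef, coef, ← integral_const_mul, ← integral_sub i1 i2]
        congr 1 with p
        ring
      have e3 : ∫ p, F p * (starRingEnd ℂ) (expo k p) * w p ∂cell = coef (fun p => F p * w p) k := by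
        rw [coef]; congr 1 with p; ring
      rw [e2, e3] at h1
      rw [h1]; ring
    obtain ⟨g1, hg1, hc1⟩ := key (e := (1, 0)) fun k => by
      simpa [dsymb] using (norm_deriv_coeff_le k).1
    obtain ⟨g2, hg2, hc2⟩ := key (e := (0, 1)) fun k => by
      simpa [dsymb] using (norm_deriv_coeff_le k).2
    -- Both directional derivatives lie in `Sob n`, hence so does ∂_t - i∂_s. Since its symbol
    -- dominates the weight, this one elliptic operator recovers the full gain of a derivative.
    have hI : Complex.I.im ≠ 0 := by simp
    refine Sob.of_symb hI (memLp_bounded_mul hF.smooth.continuous h.1)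
      (hg2.add (hg1.const_mul (-Complex.I))) fun k => ?_
    rw [coef_add hg2.1 (hg1.const_mul _).1, coef_const_mul, ← hc1, ← hc2]
    simp only [symb, dsymb, Complex.ofReal_one, Complex.ofReal_zero]
    ring

/-! ## Minimizers on the torus -/

section L2

variable {α V : Type*} [MeasurableSpace α] {μ : Measure α} [AddCommGroup V] [Module ℂ V]

/-- A linear map into square integrable functions, as a linear map into `L²`. -/
def toL2 (T : V →ₗ[ℂ] (α → ℂ)) (h : ∀ v, MemLp (T v) 2 μ) : V →ₗ[ℂ] Lp ℂ 2 μ where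
  toFun v := (h v).toLp
  map_add' u v := by
    rw [← MemLp.toLp_add]
    congr 1
    exact map_add T u v
  map_smul' c v := by
    rw [RingHom.id_apply, ← MemLp.toLp_const_smul]
    congr 1
    exact map_smul T c v

theorem norm_sq_L2 (u : Lp ℂ 2 μ) : ‖u‖ ^ 2 = ∫ x, ‖u x‖ ^ 2 ∂μ := by
  have h1 := @inner_self_eq_norm_sq ℂ (Lp ℂ 2 μ) _ _ _ u
  have h2 : inner ℂ u u = ((∫ x, ‖u x‖ ^ 2 ∂μ : ℝ) : ℂ) := by
    rw [L2.inner_def, ← integral_complex_ofReal]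
    congr 1 with x
    rw [RCLike.inner_apply, Complex.mul_conj']
    push_cast; rfl
  rw [h2] at h1
  exact h1.symm

theorem norm_sq_toLp {f : α → ℂ} (hf : MemLp f 2 μ) : ‖hf.toLp‖ ^ 2 = ∫ x, ‖f x‖ ^ 2 ∂μ := by
  rw [norm_sq_L2]
  refine integral_congr_ae ?_
  filter_upwards [hf.coeFn_toLp] with x hx
  rw [hx]

theorem inner_toLp {f : α → ℂ} (hf : MemLp f 2 μ) (u : Lp ℂ 2 μ) :
    inner ℂ hf.toLp u = ∫ x, u x * (starRingEnd ℂ) (f x) ∂μ := by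
  rw [L2.inner_def]
  refine integral_congr_ae ?_
  filter_upwards [hf.coeFn_toLp] with x hx
  rw [hx, RCLike.inner_apply]

theorem inner_toLp_toLp {f g : α → ℂ} (hf : MemLp f 2 μ) (hg : MemLp g 2 μ) :
    inner ℂ hf.toLp hg.toLp = ∫ x, g x * (starRingEnd ℂ) (f x) ∂μ := by
  rw [inner_toLp]
  refine integral_congr_ae ?_
  filter_upwards [hg.coeFn_toLp] with x hx
  rw [hx]

theorem norm_sq_toL2 (T : V →ₗ[ℂ] (α → ℂ)) (h : ∀ v, MemLp (T v) 2 μ) (v : V) :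
    ‖toL2 T h v‖ ^ 2 = ∫ x, ‖T v x‖ ^ 2 ∂μ := norm_sq_toLp (h v)

theorem inner_toL2_left (T : V →ₗ[ℂ] (α → ℂ)) (h : ∀ v, MemLp (T v) 2 μ) (v : V) (u : Lp ℂ 2 μ) :
    inner ℂ (toL2 T h v) u = ∫ x, u x * (starRingEnd ℂ) (T v x) ∂μ := inner_toLp (h v) u

theorem inner_toLp_toL2 {f : α → ℂ} (hf : MemLp f 2 μ) (T : V →ₗ[ℂ] (α → ℂ))
    (h : ∀ v, MemLp (T v) 2 μ) (v : V) :
    inner ℂ hf.toLp (toL2 T h v) = ∫ x, T v x * (starRingEnd ℂ) (f x) ∂μ := inner_toLp_toLp hf (h v)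

end L2

/-- The smooth antiperiodic functions as a vector space. -/
def twistedSpace : Submodule ℂ (ℝ × ℝ → ℂ) where
  carrier := {Φ | Twisted Φ}
  add_mem' h h' := h.add h'
  zero_mem' := ⟨contDiff_const, fun m n p => by simp⟩
  smul_mem' c _ h := h.const_mul c

theorem cauchyOp_add {ζ : ℂ} {Φ Ψ : ℝ × ℝ → ℂ} (h : Twisted Φ) (h' : Twisted Ψ) (p : ℝ × ℝ) :
    cauchyOp ζ (Φ + Ψ) p = cauchyOp ζ Φ p + cauchyOp ζ Ψ p := by
  simp only [cauchyOp]
  rw [fderiv_add h.differentiable.differentiableAt h'.differentiable.differentiableAt]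
  simp
  ring

theorem cauchyOp_smul {ζ c : ℂ} {Φ : ℝ × ℝ → ℂ} (h : Twisted Φ) (p : ℝ × ℝ) :
    cauchyOp ζ (c • Φ) p = c * cauchyOp ζ Φ p := by
  simp only [cauchyOp]
  rw [fderiv_const_smul h.differentiable.differentiableAt]
  simp
  ring

theorem conj_symb (ζ : ℂ) (k : ℤ × ℤ) :
    (starRingEnd ℂ) (symb ζ k) = -symb ((starRingEnd ℂ) ζ) k := by
  simp [symb, Complex.conj_ofNat]

theorem cauchyOp_expo (ζ : ℂ) (k : ℤ × ℤ) (p : ℝ × ℝ) :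
    cauchyOp ζ (expo k) p = symb ζ k * expo k p := by
  rw [cauchyOp, fderiv_expo, fderiv_expo, symb]
  simp
  ring

namespace TorusMetric

variable {F : ℝ × ℝ → ℝ}

theorem biperiodic_ofReal (hF : TorusMetric F) : Biperiodic fun p => (F p : ℂ) :=
  ⟨Complex.ofRealCLM.contDiff.comp hF.smooth, fun m n p => by rw [hF.period]⟩

theorem exists_le (hF : TorusMetric F) : ∃ B > 0, (∀ᵐ p ∂cell, F p ≤ B) ∧ ∀ᵐ p ∂cell, (F p)⁻¹ ≤ B := by
  have hK : IsCompact (Icc (0:ℝ) 1 ×ˢ Icc (0:ℝ) 1) := isCompact_Icc.prod isCompact_Icc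
  obtain ⟨B1, h1⟩ := hK.exists_bound_of_continuousOn hF.continuous.continuousOn
  obtain ⟨B2, h2⟩ := hK.exists_bound_of_continuousOn hF.continuous_inv.continuousOn
  refine ⟨max 1 (max B1 B2), by positivity, ?_, ?_⟩ <;> rw [cell] <;>
    filter_upwards [ae_restrict_mem (measurableSet_Ioc.prod measurableSet_Ioc)] with p hp
  · exact (le_abs_self _).trans ((h1 p ⟨Ioc_subset_Icc_self hp.1, Ioc_subset_Icc_self hp.2⟩).trans
      (le_max_of_le_right (le_max_left _ _)))
  · exact (le_abs_self _).trans ((h2 p ⟨Ioc_subset_Icc_self hp.1, Ioc_subset_Icc_self hp.2⟩).trans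
      (le_max_of_le_right (le_max_right _ _)))

/-- `√F Φ` in `L²`. -/
def massMap (hF : TorusMetric F) : twistedSpace →ₗ[ℂ] Lp ℂ 2 cell :=
  toL2 (V := twistedSpace)
    { toFun := fun Φ p => (√(F p) : ℂ) * Φ.1 p
      map_add' := fun Φ Ψ => by ext p; simp; ring
      map_smul' := fun c Φ => by ext p; simp; ring }
    fun Φ => memLp_of_continuous ((Complex.continuous_ofReal.comp hF.continuous.sqrt).mul
      (show Twisted Φ.1 from Φ.2).continuous) 2

/-- `√F⁻¹ (∂_t - ζ ∂_s) Φ` in `L²`. -/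
def energyMap (hF : TorusMetric F) (ζ : ℂ) : twistedSpace →ₗ[ℂ] Lp ℂ 2 cell :=
  toL2 (V := twistedSpace)
    { toFun := fun Φ p => (√(F p)⁻¹ : ℂ) * cauchyOp ζ Φ.1 p
      map_add' := fun Φ Ψ => by
        ext p
        have := cauchyOp_add (ζ := ζ) (show Twisted Φ.1 from Φ.2) (show Twisted Ψ.1 from Ψ.2) p
        simp [this]; ring
      map_smul' := fun c Φ => by
        ext p
        have := cauchyOp_smul (ζ := ζ) (c := c) (show Twisted Φ.1 from Φ.2) p
        simp [this]; ring }
    fun Φ => memLp_of_continuous ((Complex.continuous_ofReal.comp hF.continuous_inv.sqrt).mul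
      ((show Twisted Φ.1 from Φ.2).cauchyOp ζ).continuous) 2

theorem norm_sq_massMap (hF : TorusMetric F) (Φ : twistedSpace) :
    ‖hF.massMap Φ‖ ^ 2 = torusMass F Φ.1 := by
  rw [massMap, norm_sq_toL2, torusMass]
  congr 1 with p
  simp only [LinearMap.coe_mk, AddHom.coe_mk, norm_mul, Complex.norm_real, mul_pow]
  rw [Real.norm_eq_abs, sq_abs, Real.sq_sqrt (hF.pos p).le]

theorem norm_sq_energyMap (hF : TorusMetric F) (ζ : ℂ) (Φ : twistedSpace) :
    ‖hF.energyMap ζ Φ‖ ^ 2 = torusEnergy ζ F Φ.1 := by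
  rw [energyMap, norm_sq_toL2, torusEnergy]
  congr 1 with p
  simp only [LinearMap.coe_mk, AddHom.coe_mk, norm_mul, Complex.norm_real, mul_pow]
  rw [Real.norm_eq_abs, sq_abs, Real.sq_sqrt (inv_nonneg.2 (hF.pos p).le)]

/-- F and its inverse are bounded on the square, so the weighted norms compare with the plain ones
and Rellich's theorem applies. The invertibility of the operator lets the energy alone control the
first derivatives. -/
theorem precompact (hF : TorusMetric F) {ζ : ℂ} (hζ : ζ.im ≠ 0) (a : ℕ → twistedSpace) (M : ℝ)
    (hM : ∀ n, ‖hF.energyMap ζ (a n)‖ ^ 2 ≤ M) :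
    ∃ g : ℕ → ℕ, StrictMono g ∧ CauchySeq fun n => hF.massMap (a (g n)) := by
  obtain ⟨c, hc, hs⟩ := exists_symb_lower hζ
  obtain ⟨B, hB, hB1, hB2⟩ := hF.exists_le
  have ht (n) : Twisted (a n).1 := (a n).2
  have hr (n) := summable_wt_sq_of_coef_eq hc hs ((ht n).cauchyOp ζ).memLp ((ht n).coef_cauchyOp ζ)
  have hen (n) : ∫ p, ‖cauchyOp ζ (a n).1 p‖ ^ 2 ∂cell ≤ B * M := by
    refine le_trans ?_ (mul_le_mul_of_nonneg_left (hM n) hB.le)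
    rw [norm_sq_energyMap, torusEnergy, ← integral_const_mul]
    have hc := ((ht n).cauchyOp ζ).continuous
    refine integral_mono_ae (integrable_of_continuous (hc.norm.pow 2))
      ((integrable_of_continuous (hF.continuous_inv.mul (hc.norm.pow 2))).const_mul B) ?_
    filter_upwards [hB1] with p hp
    have hpos := hF.pos p
    rw [← mul_assoc, ← div_eq_mul_inv]
    exact le_mul_of_one_le_left (by positivity) ((one_le_div hpos).2 hp)
  obtain ⟨g, hg, hcau⟩ := exists_subseq_cauchy (fun n => (a n).1) (fun n => (ht n).memLp)
    (1 / c ^ 2 * (B * M)) (fun n => (hr n).1)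
    (fun n => (hr n).2.trans (mul_le_mul_of_nonneg_left (hen n) (by positivity)))
  refine ⟨g, hg, Metric.cauchySeq_iff.2 fun ε hε => ?_⟩
  obtain ⟨N, hN⟩ := hcau (ε ^ 2 / (2 * B)) (by positivity)
  refine ⟨N, fun n hn m hm => ?_⟩
  rw [dist_eq_norm, ← map_sub]
  refine lt_of_pow_lt_pow_left₀ 2 hε.le ?_
  rw [norm_sq_massMap]
  have h1 : torusMass F (a (g n) - a (g m)).1 ≤ B * ∫ p, ‖(a (g n)).1 p - (a (g m)).1 p‖ ^ 2 ∂cell := by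
    rw [torusMass, ← integral_const_mul]
    have hc := ((ht (g n)).continuous.sub (ht (g m)).continuous)
    refine integral_mono_ae (integrable_of_continuous (hF.continuous.mul (hc.norm.pow 2)))
      ((integrable_of_continuous (hc.norm.pow 2)).const_mul B) ?_
    filter_upwards [hB1] with p hp
    exact mul_le_mul_of_nonneg_right hp (by positivity)
  have h2 := hN n hn m hm
  calc _ ≤ _ := h1
    _ ≤ B * (ε ^ 2 / (2 * B)) := by gcongr
    _ = ε ^ 2 / 2 := by field_simp
    _ < ε ^ 2 := by linarith [show 0 < ε ^ 2 by positivity]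

/-- The Rayleigh quotient on the torus has a smooth minimizer, which solves the eigenvalue
equation. -/
theorem exists_minimizer (hF : TorusMetric F) {ζ : ℂ} (hζ : ζ.im ≠ 0) :
    ∃ (μ : ℝ) (U W : ℝ × ℝ → ℂ), Twisted U ∧ Twisted W ∧ U ≠ 0 ∧
      (∀ p, cauchyOp ζ U p = F p * W p) ∧
      (∀ p, cauchyOp ((starRingEnd ℂ) ζ) W p = -μ * (F p * U p)) ∧
      ∀ Φ, Twisted Φ → μ * torusMass F Φ ≤ torusEnergy ζ F Φ := by
  have hne : ∃ v, hF.massMap v ≠ 0 := by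
    refine ⟨⟨expo 0, twisted_expo 0⟩, fun h0 => ?_⟩
    have h1 := hF.norm_sq_massMap ⟨expo 0, twisted_expo 0⟩
    rw [h0] at h1
    simp only [norm_zero, ne_eq, OfNat.ofNat_ne_zero, not_false_eq_true, zero_pow, torusMass, norm_expo,
      one_pow, mul_one] at h1
    have h2 := (integral_pos_iff_support_of_nonneg (fun p => (hF.pos p).le)
      (integrable_of_continuous hF.continuous)).2 (by
        have : Function.support F = univ := by ext p; simp [(hF.pos p).ne']
        rw [this]; simp)
    exact h2.ne h1
  obtain ⟨μ, hmin, a, u', w', hu, hw, hu1, hEL⟩ := exists_minimizing_sequence hF.massMap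
    (hF.energyMap ζ) (fun a M _ hM => hF.precompact hζ a M hM) hne
  have ht (n) : Twisted (a n).1 := (a n).2
  have cs : Continuous fun p => (√(F p) : ℂ) := Complex.continuous_ofReal.comp hF.continuous.sqrt
  have ci : Continuous fun p => (√(F p)⁻¹ : ℂ) := Complex.continuous_ofReal.comp hF.continuous_inv.sqrt
  have hsi (p) : (√(F p) : ℂ) * √(F p)⁻¹ = 1 := by
    rw [← Complex.ofReal_mul, ← Real.sqrt_mul (hF.pos p).le, mul_inv_cancel₀ (hF.pos p).ne']
    simp
  have hss (p) : (√(F p) : ℂ) * √(F p) = F p := by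
    rw [← Complex.ofReal_mul, Real.mul_self_sqrt (hF.pos p).le]
  -- Undoing the weights: u is the L² limit of the minimizing functions, and w is the limit of F⁻¹
  -- times their images under the operator.
  set u : ℝ × ℝ → ℂ := fun p => (√(F p)⁻¹ : ℂ) * u' p with hudef
  set w : ℝ × ℝ → ℂ := fun p => (√(F p)⁻¹ : ℂ) * w' p with hwdef
  have hu2 : MemLp u 2 cell := memLp_bounded_mul ci (Lp.memLp u')
  have hw2 : MemLp w 2 cell := memLp_bounded_mul ci (Lp.memLp w')
  have mi (k) : MemLp (fun p => (√(F p)⁻¹ : ℂ) * expo k p) 2 cell :=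
    memLp_of_continuous (ci.mul (contDiff_expo k).continuous) 2
  have ms (k) : MemLp (fun p => (√(F p) : ℂ) * expo k p) 2 cell :=
    memLp_of_continuous (cs.mul (contDiff_expo k).continuous) 2
  -- The relation between u and w passes to the limit one Fourier coefficient at a time.
  have heq1 (k) : symb ζ k * coef u k = coef (fun p => (F p : ℂ) * w p) k := by
    have l1 : Tendsto (fun n => coef (a n).1 k) atTop (𝓝 (coef u k)) := by
      have := (tendsto_const_nhds (x := (mi k).toLp)).inner (𝕜 := ℂ) hu
      rw [inner_toLp] at this
      refine (this.congr fun n => ?_).trans_eq ?_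
      · rw [massMap, inner_toLp_toL2, coef]
        congr 1 with p
        simp only [LinearMap.coe_mk, AddHom.coe_mk, map_mul, Complex.conj_ofReal]
        linear_combination ((a n).1 p * (starRingEnd ℂ) (expo k p)) * hsi p
      · rw [coef]; congr 2 with p
        simp only [hudef, map_mul, Complex.conj_ofReal]; ring
    have l2 : Tendsto (fun n => coef (cauchyOp ζ (a n).1) k) atTop
        (𝓝 (coef (fun p => (F p : ℂ) * w p) k)) := by
      have := (tendsto_const_nhds (x := (ms k).toLp)).inner (𝕜 := ℂ) hw
      rw [inner_toLp] at this
      refine (this.congr fun n => ?_).trans_eq ?_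
      · rw [energyMap, inner_toLp_toL2, coef]
        congr 1 with p
        simp only [LinearMap.coe_mk, AddHom.coe_mk, map_mul, Complex.conj_ofReal]
        linear_combination (cauchyOp ζ (a n).1 p * (starRingEnd ℂ) (expo k p)) * hsi p
      · rw [coef]; congr 2 with p
        simp only [hwdef, map_mul, Complex.conj_ofReal]
        linear_combination (√(F p)⁻¹ * w' p * (starRingEnd ℂ) (expo k p)) * hss p -
          (w' p * √(F p) * (starRingEnd ℂ) (expo k p)) * hsi p
    refine tendsto_nhds_unique (l1.const_mul (symb ζ k)) (l2.congr fun n => ?_)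
    exact (ht n).coef_cauchyOp ζ k
  -- The Euler-Lagrange equation tested on exponentials; the adjoint operator has conjugate
  -- parameter and the opposite sign.
  have heq2 (k) : symb ((starRingEnd ℂ) ζ) k * coef w k = coef (fun p => (-μ : ℂ) * ((F p : ℂ) * u p)) k := by
    have h := hEL ⟨expo k, twisted_expo k⟩
    have h1 : inner ℂ (hF.energyMap ζ ⟨expo k, twisted_expo k⟩) w' =
        (starRingEnd ℂ) (symb ζ k) * coef w k := by
      rw [energyMap, inner_toL2_left, coef, ← integral_const_mul]
      congr 1 with p
      simp only [LinearMap.coe_mk, AddHom.coe_mk, cauchyOp_expo, map_mul, Complex.conj_ofReal, hwdef]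
      ring
    have h2 : inner ℂ (hF.massMap ⟨expo k, twisted_expo k⟩) u' = coef (fun p => (F p : ℂ) * u p) k := by
      rw [massMap, inner_toL2_left, coef]
      congr 1 with p
      simp only [LinearMap.coe_mk, AddHom.coe_mk, map_mul, Complex.conj_ofReal, hudef]
      rw [← hss]
      linear_combination (-√(F p) * u' p * (starRingEnd ℂ) (expo k p)) * hsi p
    rw [h1, h2, conj_symb] at h
    rw [coef_const_mul]
    linear_combination -h
  have hζ' : ((starRingEnd ℂ) ζ).im ≠ 0 := by simpa using hζ
  -- Bootstrapping the first-order system: each equation gives one unknown a derivative more than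
  -- the other has.
  have hsob (n) : Sob n u ∧ Sob n w := by
    induction n with
    | zero => exact ⟨sob_zero hu2, sob_zero hw2⟩
    | succ n ih =>
      exact ⟨Sob.of_symb hζ hu2 (ih.2.bimul hF.biperiodic_ofReal) heq1,
        Sob.of_symb hζ' hw2 ((ih.1.bimul hF.biperiodic_ofReal).const_mul _) heq2⟩
  obtain ⟨U, hU, huU⟩ := exists_twisted_ae_eq fun n => (hsob n).1
  obtain ⟨W, hW, hwW⟩ := exists_twisted_ae_eq fun n => (hsob n).2
  refine ⟨μ, U, W, hU, hW, ?_, ?_, ?_, fun Φ hΦ => ?_⟩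
  · rintro rfl
    have h1 := norm_sq_L2 u'
    have h2 : ∫ p, ‖u' p‖ ^ 2 ∂cell = 0 := by
      refine integral_eq_zero_of_ae ?_
      filter_upwards [huU] with p hp
      have : u' p = √(F p) * u p := by
        rw [hudef]; linear_combination (-u' p) * hsi p
      rw [this, hp]; simp
    rw [h2, hu1] at h1
    norm_num at h1
  · have := (hU.cauchyOp ζ).eq_of_coef (hW.bimul hF.biperiodic_ofReal) fun k => by
      rw [hU.coef_cauchyOp, ← coef_congr huU, heq1]
      refine coef_congr ?_ k
      filter_upwards [hwW] with p hp
      rw [hp]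
    exact congrFun this
  · have := (hW.cauchyOp ((starRingEnd ℂ) ζ)).eq_of_coef
        ((hU.bimul hF.biperiodic_ofReal).const_mul (-μ)) fun k => by
      rw [hW.coef_cauchyOp, ← coef_congr hwW, heq2]
      refine coef_congr ?_ k
      filter_upwards [huU] with p hp
      rw [hp]
    exact congrFun this
  · have := hmin ⟨Φ, hΦ⟩
    rwa [norm_sq_massMap, norm_sq_energyMap] at this

end TorusMetric

/-! ## The Dirac operator in terms of the Cauchy-Riemann operators -/

/-- The operator `∂₁ + i ∂₂`. -/
def dbar (φ : ℂ → ℂ) (z : ℂ) : ℂ := fderiv ℝ φ z 1 + Complex.I * fderiv ℝ φ z Complex.I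

/-- The operator `∂₁ - i ∂₂`. -/
def del (φ : ℂ → ℂ) (z : ℂ) : ℂ := fderiv ℝ φ z 1 - Complex.I * fderiv ℝ φ z Complex.I

theorem dbar_conj (φ : ℂ → ℂ) (z : ℂ) :
    dbar (fun p => (starRingEnd ℂ) (φ p)) z = (starRingEnd ℂ) (del φ z) := by
  simp [dbar, del, fderiv_conj]

theorem del_conj (φ : ℂ → ℂ) (z : ℂ) :
    del (fun p => (starRingEnd ℂ) (φ p)) z = (starRingEnd ℂ) (dbar φ z) := by
  simp [dbar, del, fderiv_conj]; ring

theorem dbar_mul {φ χ : ℂ → ℂ} {z : ℂ} (h : DifferentiableAt ℝ φ z) (h' : DifferentiableAt ℝ χ z) :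
    dbar (fun p => φ p * χ p) z = φ z * dbar χ z + χ z * dbar φ z := by
  simp only [dbar, fderiv_fun_mul h h', add_apply, smul_apply, smul_eq_mul]
  ring

theorem del_mul {φ χ : ℂ → ℂ} {z : ℂ} (h : DifferentiableAt ℝ φ z) (h' : DifferentiableAt ℝ χ z) :
    del (fun p => φ p * χ p) z = φ z * del χ z + χ z * del φ z := by
  simp only [del, fderiv_fun_mul h h', add_apply, smul_apply, smul_eq_mul]
  ring

theorem del_neg (φ : ℂ → ℂ) (z : ℂ) : del (fun p => -φ p) z = -del φ z := by
  simp [del, fderiv_fun_neg]; ring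

theorem contDiff_fderiv_apply {φ : ℂ → ℂ} (h : ContDiff ℝ ∞ φ) (v : ℂ) :
    ContDiff ℝ ∞ fun p => fderiv ℝ φ p v :=
  (h.fderiv_right (m := ∞) (by simp)).clm_apply contDiff_const

theorem contDiff_dbar {φ : ℂ → ℂ} (h : ContDiff ℝ ∞ φ) : ContDiff ℝ ∞ (dbar φ) :=
  (contDiff_fderiv_apply h _).add (contDiff_const.mul (contDiff_fderiv_apply h _))

theorem contDiff_del {φ : ℂ → ℂ} (h : ContDiff ℝ ∞ φ) : ContDiff ℝ ∞ (del φ) :=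
  (contDiff_fderiv_apply h _).sub (contDiff_const.mul (contDiff_fderiv_apply h _))

theorem contDiff_sqrt_ofReal {f : ℂ → ℝ} (hf : ContDiff ℝ ∞ f) (hpos : ∀ z, 0 < f z) :
    ContDiff ℝ ∞ fun p => (√(f p) : ℂ) :=
  Complex.ofRealCLM.contDiff.comp (hf.sqrt fun z => (hpos z).ne')

theorem contDiff_inv_ofReal {f : ℂ → ℝ} (hf : ContDiff ℝ ∞ f) (hpos : ∀ z, 0 < f z) :
    ContDiff ℝ ∞ fun p => ((f p)⁻¹ : ℂ) := by
  have : ContDiff ℝ ∞ fun p => (((f p)⁻¹ : ℝ) : ℂ) :=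
    Complex.ofRealCLM.contDiff.comp (hf.inv fun z => (hpos z).ne')
  simpa using this

theorem fderiv_sqrt_ofReal {f : ℂ → ℝ} (hf : ContDiff ℝ ∞ f) (hpos : ∀ z, 0 < f z) (z v : ℂ) :
    fderiv ℝ (fun p => (√(f p) : ℂ)) z v = ((fderiv ℝ f z v / (2 * √(f z)) : ℝ) : ℂ) := by
  have hd := (hf.differentiable (by simp)).differentiableAt (x := z)
  have h1 := (Complex.ofRealCLM.hasFDerivAt (x := √(f z))).comp z (hd.hasFDerivAt.sqrt (hpos z).ne')
  have h2 : fderiv ℝ (fun p => (√(f p) : ℂ)) z = _ := h1.fderiv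
  rw [h2]
  simp
  ring

theorem fderiv_log_conformal {f : ℂ → ℝ} (hf : ContDiff ℝ ∞ f) (hpos : ∀ z, 0 < f z) (z v : ℂ) :
    fderiv ℝ (fun p => Real.log (f p)) z v = fderiv ℝ f z v / f z := by
  have hd := (hf.differentiable (by simp)).differentiableAt (x := z)
  rw [(hd.hasFDerivAt.log (hpos z).ne').fderiv]
  simp
  ring

/-- The conformal covariance of the Dirac operator. -/
theorem chartDirac_apply {f : ℂ → ℝ} (hf : ContDiff ℝ ∞ f) (hpos : ∀ z, 0 < f z)
    {ψ : ℂ → Fin 2 → ℂ} (hψ : ContDiff ℝ ∞ ψ) (z : ℂ) :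
    chartDirac f ψ z 0 = -((f z : ℂ)⁻¹ * (√(f z) : ℂ)⁻¹ * del (fun p => (√(f p) : ℂ) * ψ p 1) z) ∧
    chartDirac f ψ z 1 = (f z : ℂ)⁻¹ * (√(f z) : ℂ)⁻¹ * dbar (fun p => (√(f p) : ℂ) * ψ p 0) z := by
  have hd := (hψ.differentiable (by simp)).differentiableAt (x := z)
  have hc (i : Fin 2) (v : ℂ) : fderiv ℝ ψ z v i = fderiv ℝ (fun p => ψ p i) z v := by
    rw [fderiv_pi (differentiableAt_pi.1 hd)]; rfl
  have hdi (i : Fin 2) : DifferentiableAt ℝ (fun p => ψ p i) z := differentiableAt_pi.1 hd i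
  have hs : DifferentiableAt ℝ (fun p => (√(f p) : ℂ)) z :=
    ((contDiff_sqrt_ofReal hf hpos).differentiable (by simp)).differentiableAt
  have hr : (√(f z) : ℂ) ≠ 0 := by exact_mod_cast (Real.sqrt_pos.2 (hpos z)).ne'
  have hfr : (f z : ℂ) = (√(f z) : ℂ) ^ 2 := by
    rw [← Complex.ofReal_pow, Real.sq_sqrt (hpos z).le]
  have hI : Complex.I ^ 2 = -1 := Complex.I_sq
  rw [del_mul hs (hdi 1), dbar_mul hs (hdi 0)]
  simp only [dbar, del, fderiv_sqrt_ofReal hf hpos]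
  have c1 (w : Fin 2 → ℂ) : clifford₁ *ᵥ w = ![-w 1, w 0] := by
    ext i; fin_cases i <;> simp [clifford₁, Matrix.mulVec, dotProduct, Fin.sum_univ_two]
  have c2 (w : Fin 2 → ℂ) : clifford₂ *ᵥ w = ![Complex.I * w 1, Complex.I * w 0] := by
    ext i; fin_cases i <;> simp [clifford₂, Matrix.mulVec, dotProduct, Fin.sum_univ_two]
  simp only [chartDirac, spinDeriv, connectionForm, fderiv_log_conformal hf hpos,
    ← Matrix.mulVec_mulVec, c1, c2]
  simp only [Pi.smul_apply, Pi.add_apply, Matrix.cons_val_zero, Matrix.cons_val_one, hc,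
    Complex.real_smul]
  push_cast
  simp only [Complex.one_re, Complex.one_im, Complex.I_re, Complex.I_im, Complex.ofReal_one,
    Complex.ofReal_zero]
  rw [hfr]
  constructor
  · field_simp
    linear_combination (ψ z 1 * (fderiv ℝ f z 1)) * hI
  · field_simp
    linear_combination (-(ψ z 0) * (fderiv ℝ f z 1)) * hI

/-- The eigenvalue equation for one rescaled component of a spinor. -/
def ChartEigen (f : ℂ → ℝ) (φ : ℂ → ℂ) (μ : ℝ) : Prop :=
  ∀ z, del (fun p => (f p : ℂ)⁻¹ * dbar φ p) z = -μ * (f z * φ z)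

theorem contDiff_chartDirac {f : ℂ → ℝ} (hf : ContDiff ℝ ∞ f) (hpos : ∀ z, 0 < f z)
    {ψ : ℂ → Fin 2 → ℂ} (hψ : ContDiff ℝ ∞ ψ) : ContDiff ℝ ∞ (chartDirac f ψ) := by
  have hi := contDiff_inv_ofReal hf hpos
  have hs := contDiff_sqrt_ofReal hf hpos
  have hsi : ContDiff ℝ ∞ fun p => (√(f p) : ℂ)⁻¹ := by
    have : ContDiff ℝ ∞ fun p => (((√(f p))⁻¹ : ℝ) : ℂ) := Complex.ofRealCLM.contDiff.comp
      ((hf.sqrt fun z => (hpos z).ne').inv fun z => (Real.sqrt_pos.2 (hpos z)).ne')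
    simpa using this
  rw [contDiff_pi]
  intro i
  fin_cases i
  · have : (fun z => chartDirac f ψ z 0) = _ := funext fun z => (chartDirac_apply hf hpos hψ z).1
    exact this ▸ ((hi.mul hsi).mul (contDiff_del (hs.mul (contDiff_pi.1 hψ 1)))).neg
  · have : (fun z => chartDirac f ψ z 1) = _ := funext fun z => (chartDirac_apply hf hpos hψ z).2
    exact this ▸ ((hi.mul hsi).mul (contDiff_dbar (hs.mul (contDiff_pi.1 hψ 0))))

/-- D interchanges the two components, so D² preserves each. Conjugation interchanges ∂₁ + i∂₂ and
∂₁ - i∂₂, so the conjugated second component satisfies the equation of the first and a single scalar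
analysis suffices. -/
theorem chartEigen_of_dirac {f : ℂ → ℝ} (hf : ContDiff ℝ ∞ f) (hpos : ∀ z, 0 < f z)
    {ψ : ℂ → Fin 2 → ℂ} (hψ : ContDiff ℝ ∞ ψ) {μ : ℝ}
    (h : chartDirac f (chartDirac f ψ) = μ • ψ) :
    ChartEigen f (fun p => (√(f p) : ℂ) * ψ p 0) μ ∧
    ChartEigen f (fun p => (starRingEnd ℂ) ((√(f p) : ℂ) * ψ p 1)) μ := by
  have hχ := contDiff_chartDirac hf hpos hψ
  have hr (z) : (√(f z) : ℂ) ≠ 0 := by exact_mod_cast (Real.sqrt_pos.2 (hpos z)).ne'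
  have hf0 (z) : (f z : ℂ) ≠ 0 := by exact_mod_cast (hpos z).ne'
  have hfr (z) : (f z : ℂ) = (√(f z) : ℂ) ^ 2 := by
    rw [← Complex.ofReal_pow, Real.sq_sqrt (hpos z).le]
  constructor
  · intro z
    have h1 := (chartDirac_apply hf hpos hχ z).1
    have e : (fun p => (√(f p) : ℂ) * chartDirac f ψ p 1) =
        fun p => (f p : ℂ)⁻¹ * dbar (fun p => (√(f p) : ℂ) * ψ p 0) p := by
      ext p
      rw [(chartDirac_apply hf hpos hψ p).2]
      have := hr p
      field_simp
    rw [e, h] at h1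
    simp only [Pi.smul_apply, Complex.real_smul] at h1
    have := hr z
    have := hf0 z
    field_simp at h1 ⊢
    linear_combination h1
  · intro z
    have h1 := (chartDirac_apply hf hpos hχ z).2
    have e : (fun p => (√(f p) : ℂ) * chartDirac f ψ p 0) =
        fun p => (starRingEnd ℂ) (-((f p : ℂ)⁻¹ * dbar (fun p => (starRingEnd ℂ) ((√(f p) : ℂ) * ψ p 1)) p)) := by
      ext p
      rw [(chartDirac_apply hf hpos hψ p).1, dbar_conj, map_neg, map_mul,
        Complex.conj_conj, map_inv₀, Complex.conj_ofReal]
      have := hr p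
      field_simp
    rw [e, h, dbar_conj] at h1
    simp only [Pi.smul_apply, Complex.real_smul] at h1
    have h2 := congrArg (starRingEnd ℂ) h1
    rw [del_neg] at h2
    simp only [map_mul, map_neg, Complex.conj_conj, map_inv₀, Complex.conj_ofReal] at h2 ⊢
    have := hr z
    have := hf0 z
    field_simp at h2 ⊢
    linear_combination h2

/-- D² preserves the splitting into components, so a scalar solution becomes an eigenspinor whose
second component is zero. -/
theorem dirac_of_chartEigen {f : ℂ → ℝ} (hf : ContDiff ℝ ∞ f) (hpos : ∀ z, 0 < f z)
    {φ : ℂ → ℂ} (hφ : ContDiff ℝ ∞ φ) {μ : ℝ} (h : ChartEigen f φ μ) :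
    ContDiff ℝ ∞ (fun p => ![(√(f p) : ℂ)⁻¹ * φ p, 0]) ∧
    chartDirac f (chartDirac f fun p => ![(√(f p) : ℂ)⁻¹ * φ p, 0]) =
      μ • fun p => ![(√(f p) : ℂ)⁻¹ * φ p, 0] := by
  have hr (z) : (√(f z) : ℂ) ≠ 0 := by exact_mod_cast (Real.sqrt_pos.2 (hpos z)).ne'
  have hf0 (z) : (f z : ℂ) ≠ 0 := by exact_mod_cast (hpos z).ne'
  have hsi : ContDiff ℝ ∞ fun p => (√(f p) : ℂ)⁻¹ := by
    have : ContDiff ℝ ∞ fun p => (((√(f p))⁻¹ : ℝ) : ℂ) := Complex.ofRealCLM.contDiff.comp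
      ((hf.sqrt fun z => (hpos z).ne').inv fun z => (Real.sqrt_pos.2 (hpos z)).ne')
    simpa using this
  have hψ : ContDiff ℝ ∞ (fun p => ![(√(f p) : ℂ)⁻¹ * φ p, 0]) := by
    rw [contDiff_pi]
    intro i
    fin_cases i
    · exact hsi.mul hφ
    · exact contDiff_const
  refine ⟨hψ, ?_⟩
  set ψ : ℂ → Fin 2 → ℂ := fun p => ![(√(f p) : ℂ)⁻¹ * φ p, 0] with hψdef
  have hχ := contDiff_chartDirac hf hpos hψ
  have e0 : (fun p => (√(f p) : ℂ) * ψ p 0) = φ := by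
    ext p; simp [ψ, mul_inv_cancel_left₀ (hr p)]
  have e1 : (fun p => (√(f p) : ℂ) * ψ p 1) = fun _ => 0 := by
    ext p; simp [ψ]
  have hz : del (fun _ => 0) = fun _ => 0 := by ext z; simp [del]
  have hz' : dbar (fun _ => 0) = fun _ => 0 := by ext z; simp [dbar]
  have x0 : (fun p => (√(f p) : ℂ) * chartDirac f ψ p 0) = fun _ => 0 := by
    ext p; rw [(chartDirac_apply hf hpos hψ p).1, e1, hz]; simp
  have x1 : (fun p => (√(f p) : ℂ) * chartDirac f ψ p 1) = fun p => (f p : ℂ)⁻¹ * dbar φ p := by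
    ext p
    rw [(chartDirac_apply hf hpos hψ p).2, e0]
    have := hr p
    field_simp
  ext z i
  fin_cases i
  · change chartDirac f (chartDirac f ψ) z 0 = _
    rw [(chartDirac_apply hf hpos hχ z).1, x1, h z]
    simp [ψ]
    have := hr z
    have := hf0 z
    field_simp
  · change chartDirac f (chartDirac f ψ) z 1 = _
    rw [(chartDirac_apply hf hpos hχ z).2, x0, hz']
    simp [ψ]

/-! ## The flat torus in lattice coordinates -/

/-- Lattice coordinates: `(s, t) ↦ s + t ζ`. -/
def latticeMap (ζ : ℂ) : ℝ × ℝ →L[ℝ] ℂ :=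
  Complex.ofRealCLM.comp (ContinuousLinearMap.fst ℝ ℝ ℝ) +
    ζ • Complex.ofRealCLM.comp (ContinuousLinearMap.snd ℝ ℝ ℝ)

theorem latticeMap_apply (ζ : ℂ) (p : ℝ × ℝ) : latticeMap ζ p = p.1 + p.2 * ζ := by
  simp [latticeMap, mul_comm]

/-- The inverse of `latticeMap`. -/
def latticeInv (ζ : ℂ) : ℂ →L[ℝ] ℝ × ℝ :=
  (Complex.reCLM - (ζ.re / ζ.im) • Complex.imCLM).prod (ζ.im⁻¹ • Complex.imCLM)

theorem latticeInv_latticeMap {ζ : ℂ} (hζ : ζ.im ≠ 0) (p : ℝ × ℝ) :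
    latticeInv ζ (latticeMap ζ p) = p := by
  rw [latticeMap_apply]
  ext
  · simp [latticeInv]; field_simp; ring
  · simp [latticeInv]; field_simp

theorem latticeMap_latticeInv {ζ : ℂ} (hζ : ζ.im ≠ 0) (z : ℂ) :
    latticeMap ζ (latticeInv ζ z) = z := by
  rw [latticeMap_apply]
  apply Complex.ext
  · simp [latticeInv]; field_simp; ring
  · simp [latticeInv]; field_simp

theorem fderiv_comp_lattice {φ : ℂ → ℂ} (hφ : Differentiable ℝ φ) (ζ : ℂ) (p v : ℝ × ℝ) :
    fderiv ℝ (fun p => φ (latticeMap ζ p)) p v = fderiv ℝ φ (latticeMap ζ p) (latticeMap ζ v) := by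
  have := fderiv_comp p (hφ.differentiableAt (x := latticeMap ζ p)) (latticeMap ζ).differentiableAt
  have h2 : fderiv ℝ (fun p => φ (latticeMap ζ p)) p = fderiv ℝ (φ ∘ latticeMap ζ) p := rfl
  rw [h2, this, (latticeMap ζ).fderiv]
  rfl

theorem cauchyOp_comp_lattice {φ : ℂ → ℂ} (hφ : Differentiable ℝ φ) (ζ : ℂ) (p : ℝ × ℝ) :
    cauchyOp ζ (fun p => φ (latticeMap ζ p)) p = -(Complex.I * ζ.im) * dbar φ (latticeMap ζ p) ∧
    cauchyOp ((starRingEnd ℂ) ζ) (fun p => φ (latticeMap ζ p)) p =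
      (Complex.I * ζ.im) * del φ (latticeMap ζ p) := by
  have e1 : latticeMap ζ (0, 1) = ζ.re • (1 : ℂ) + ζ.im • Complex.I := by
    rw [latticeMap_apply]; apply Complex.ext <;> simp
  have e2 : latticeMap ζ (1, 0) = 1 := by rw [latticeMap_apply]; simp
  have e3 := Complex.re_add_im ζ
  simp only [cauchyOp, fderiv_comp_lattice hφ, e1, e2, map_add, map_smul]
  simp only [dbar, del, Complex.real_smul]
  have e4 : (starRingEnd ℂ) ζ = ζ.re - ζ.im * Complex.I := by
    apply Complex.ext <;> simp
  constructor
  · linear_combination (fderiv ℝ φ (latticeMap ζ p) 1) * e3 +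
      ζ.im * fderiv ℝ φ (latticeMap ζ p) Complex.I * Complex.I_sq
  · rw [e4]
    linear_combination (ζ.im * fderiv ℝ φ (latticeMap ζ p) Complex.I) * Complex.I_sq

theorem integral_comp_lattice {E : Type*} [NormedAddCommGroup E] [NormedSpace ℝ E] {ζ : ℂ}
    (hζ : 0 < ζ.im) (h : ℂ → E) :
    ∫ z, h z = ζ.im • ∫ p, h (latticeMap ζ p) := by
  set A : ℝ × ℝ →ₗ[ℝ] ℝ × ℝ := Matrix.toLin (Module.Basis.finTwoProd ℝ) (Module.Basis.finTwoProd ℝ)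
    !![1, ζ.re; 0, ζ.im] with hA
  have hdet : LinearMap.det A = ζ.im := by
    rw [hA, LinearMap.det_toLin, Matrix.det_fin_two_of]; simp
  have hAp (p) : Complex.measurableEquivRealProd.symm (A p) = latticeMap ζ p := by
    rw [hA, Matrix.toLin_finTwoProd_apply, latticeMap_apply]
    apply Complex.ext <;> simp [Complex.measurableEquivRealProd] <;> ring
  have h1 := (Complex.volume_preserving_equiv_real_prod.symm).integral_comp'
    (f := Complex.measurableEquivRealProd.symm) h
  rw [← h1]
  have hmap := Measure.map_linearMap_addHaar_eq_smul_addHaar (μ := (volume : Measure (ℝ × ℝ)))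
    (f := A) (by rw [hdet]; exact hζ.ne')
  have hAc : Continuous A := LinearMap.continuous_of_finiteDimensional A
  have hemb : MeasurableEmbedding A := by
    have hinj : Function.Injective A := by
      have : LinearMap.ker A = ⊥ := by
        by_contra hne
        have := LinearMap.det_eq_zero_iff_ker_ne_bot.2 hne
        rw [hdet] at this
        exact hζ.ne' this
      exact LinearMap.ker_eq_bot.1 this
    exact hAc.measurableEmbedding hinj
  have h2 := hemb.integral_map (μ := volume) (fun q => h (Complex.measurableEquivRealProd.symm q))
  rw [hmap, integral_smul_measure, hdet] at h2
  simp only [hAp] at h2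
  rw [← h2, smul_smul, ENNReal.toReal_ofReal (abs_nonneg _), abs_of_pos (inv_pos.2 hζ),
    mul_inv_cancel₀ hζ.ne', one_smul]

/-! ## The Dirac spectrum of a torus -/

theorem cauchyOp_conj (ζ : ℂ) (Φ : ℝ × ℝ → ℂ) (p : ℝ × ℝ) :
    cauchyOp ζ (fun q => (starRingEnd ℂ) (Φ q)) p =
      (starRingEnd ℂ) (cauchyOp ((starRingEnd ℂ) ζ) Φ p) := by
  simp [cauchyOp, fderiv_conj]

namespace TorusMetric

variable {F : ℝ × ℝ → ℝ} {Φ W : ℝ × ℝ → ℂ}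

theorem mass_pos (hF : TorusMetric F) (h : Twisted Φ) (hne : Φ ≠ 0) : 0 < torusMass F Φ := by
  refine hF.mass_nonneg.lt_of_ne' fun h0 => hne (h.eq_zero_of_ae ?_)
  rw [torusMass, integral_eq_zero_iff_of_nonneg
    (fun p => mul_nonneg (hF.pos p).le (by positivity))
    (integrable_of_continuous (v := fun p => F p * ‖Φ p‖ ^ 2)
      (hF.continuous.mul (h.continuous.norm.pow 2)))] at h0
  filter_upwards [h0] with p hp
  have := (hF.pos p).ne'
  simpa [this] using hp

/-- The first equation turns the energy density into P_ζΦ times the conjugate of W; integrating by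
parts and applying the second equation leaves μ times the mass. -/
theorem energy_eq (hF : TorusMetric F) (hΦ : Twisted Φ) (hW : Twisted W) {ζ : ℂ} {μ : ℝ}
    (e1 : ∀ p, cauchyOp ζ Φ p = F p * W p)
    (e2 : ∀ p, cauchyOp ((starRingEnd ℂ) ζ) W p = -μ * (F p * Φ p)) :
    torusEnergy ζ F Φ = μ * torusMass F Φ := by
  have h := hΦ.integral_cauchyOp_mul hW.conj ζ
  rw [torusEnergy, torusMass, ← integral_const_mul]
  apply Complex.ofReal_injective
  rw [← integral_complex_ofReal, ← integral_complex_ofReal]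
  have l : ∀ p, (((F p)⁻¹ * ‖cauchyOp ζ Φ p‖ ^ 2 : ℝ) : ℂ) =
      cauchyOp ζ Φ p * (starRingEnd ℂ) (W p) := fun p => by
    have h0 : (F p : ℂ) ≠ 0 := by exact_mod_cast (hF.pos p).ne'
    push_cast
    rw [← Complex.mul_conj', e1, map_mul, Complex.conj_ofReal]
    field_simp
  have r : ∀ p, ((μ * (F p * ‖Φ p‖ ^ 2) : ℝ) : ℂ) =
      -(Φ p * cauchyOp ζ (fun q => (starRingEnd ℂ) (W q)) p) := fun p => by
    rw [cauchyOp_conj, e2]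
    push_cast
    rw [← Complex.mul_conj']
    simp
    ring
  simp only [l, r, integral_neg]
  exact h

end TorusMetric

section Torus

variable {x y : ℝ}

theorem latticeMap_add_int (ζ : ℂ) (p : ℝ × ℝ) (m n : ℤ) :
    latticeMap ζ (p + ((m : ℝ), (n : ℝ))) = latticeMap ζ p + (m + n * ζ) := by
  rw [map_add, latticeMap_apply ζ ((m : ℝ), (n : ℝ))]; simp

theorem latticeInv_add_int {ζ : ℂ} (hζ : ζ.im ≠ 0) (z : ℂ) (m n : ℤ) :
    latticeInv ζ (z + (m + n * ζ)) = latticeInv ζ z + ((m : ℝ), (n : ℝ)) := by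
  conv_lhs => rw [← latticeMap_latticeInv hζ z, ← latticeMap_add_int]
  exact latticeInv_latticeMap hζ _

theorem torus_sign (m n : ℤ) :
    ((((1 : ℤˣ) ^ m * (-1) ^ n : ℤˣ) : ℤ) : ℂ) = (-1 : ℂ) ^ n := by
  rcases Int.even_or_odd n with h | h
  · simp [h.neg_one_zpow]
  · simp [h.neg_one_zpow]

theorem torusMetric_of_isMetric {f : Unit → ℂ → ℝ} (hf : (nontrivialSpinTorus x y).IsMetric f) :
    TorusMetric fun p => f () (latticeMap ⟨x, y⟩ p) where
  smooth := (hf.smooth ()).comp (latticeMap _).contDiff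
  period m n p := by
    have := hf.compat (m, n) (latticeMap ⟨x, y⟩ p) (mem_univ _)
    rw [latticeMap_add_int]
    simpa [nontrivialSpinTorus, flatTorus] using this.symm
  pos p := hf.pos () _

theorem TorusMetric.isMetric {F : ℝ × ℝ → ℝ} (hF : TorusMetric F) (hy : y ≠ 0) :
    (nontrivialSpinTorus x y).IsMetric fun _ z => F (latticeInv ⟨x, y⟩ z) where
  smooth _ := hF.smooth.comp (latticeInv _).contDiff
  pos _ _ := hF.pos _
  compat j z _ := by
    have := latticeInv_add_int (ζ := ⟨x, y⟩) hy z j.1 j.2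
    have h2 := hF.period j.1 j.2 (latticeInv ⟨x, y⟩ z)
    rw [← this] at h2
    simpa [nontrivialSpinTorus, flatTorus] using h2.symm

theorem twisted_of_quasiperiodic {φ : ℂ → ℂ} (hφ : ContDiff ℝ ∞ φ)
    (h : ∀ (m n : ℤ) z, φ z = (-1 : ℂ) ^ n * φ (z + (m + n * (⟨x, y⟩ : ℂ)))) :
    Twisted fun p => φ (latticeMap ⟨x, y⟩ p) where
  smooth := hφ.comp (latticeMap _).contDiff
  twist m n p := by
    rw [latticeMap_add_int, h m n (latticeMap ⟨x, y⟩ p), ← mul_assoc, neg_one_zpow_mul_self, one_mul]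

theorem twisted_components {f : Unit → ℂ → ℝ} (hf : (nontrivialSpinTorus x y).IsMetric f)
    {ψ : Unit → ℂ → Fin 2 → ℂ} (hψ : (nontrivialSpinTorus x y).IsSpinor ψ) :
    Twisted (fun p => (√(f () (latticeMap ⟨x, y⟩ p)) : ℂ) * ψ () (latticeMap ⟨x, y⟩ p) 0) ∧
    Twisted (fun p => (starRingEnd ℂ)
      ((√(f () (latticeMap ⟨x, y⟩ p)) : ℂ) * ψ () (latticeMap ⟨x, y⟩ p) 1)) := by
  have hs := contDiff_sqrt_ofReal (hf.smooth ()) (hf.pos ())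
  have hp (m n : ℤ) (z : ℂ) : f () (z + (m + n * (⟨x, y⟩ : ℂ))) = f () z := by
    simpa [nontrivialSpinTorus, flatTorus] using (hf.compat (m, n) z (mem_univ _)).symm
  have hc (m n : ℤ) (z : ℂ) :
      ψ () z = !![(-1 : ℂ) ^ n, 0; 0, (-1 : ℂ) ^ n] *ᵥ ψ () (z + (m + n * (⟨x, y⟩ : ℂ))) := by
    have := hψ.compat (m, n) z (mem_univ _)
    simp only [nontrivialSpinTorus, flatTorus, torus_sign, conj_neg_one_zpow] at this
    exact this
  constructor
  · refine twisted_of_quasiperiodic (φ := fun z => (√(f () z) : ℂ) * ψ () z 0)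
      (hs.mul (contDiff_pi.1 (hψ.smooth ()) 0)) fun m n z => ?_
    rw [hp, hc m n z]
    simp [Matrix.mulVec, dotProduct, Fin.sum_univ_two]
    ring
  · refine twisted_of_quasiperiodic (φ := fun z => (starRingEnd ℂ) ((√(f () z) : ℂ) * ψ () z 1))
      (Complex.conjCLE.contDiff.comp (hs.mul (contDiff_pi.1 (hψ.smooth ()) 1))) fun m n z => ?_
    rw [hp, hc m n z]
    simp [Matrix.mulVec, dotProduct, Fin.sum_univ_two]
    ring

theorem torus_area (hy : 0 < y) (f : Unit → ℂ → ℝ) :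
    (nontrivialSpinTorus x y).area f = y * torusArea fun p => f () (latticeMap ⟨x, y⟩ p) := by
  have hdom : (nontrivialSpinTorus x y).dom () =
      latticeInv ⟨x, y⟩ ⁻¹' (Ico (0:ℝ) 1 ×ˢ Ico (0:ℝ) 1) := by
    have : (nontrivialSpinTorus x y).dom () = latticeMap ⟨x, y⟩ '' (Ico (0:ℝ) 1 ×ˢ Ico (0:ℝ) 1) := by
      simp [nontrivialSpinTorus, flatTorus, latticeMap_apply]
    rw [this]
    exact congrFun (image_eq_preimage_of_inverse (latticeInv_latticeMap (ζ := ⟨x, y⟩) hy.ne')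
      (latticeMap_latticeInv (ζ := ⟨x, y⟩) hy.ne')) _
  have hm : MeasurableSet ((nontrivialSpinTorus x y).dom ()) :=
    hdom ▸ (latticeInv _).measurable (measurableSet_Ico.prod measurableSet_Ico)
  rw [SpinAtlas.area, Fintype.sum_unique]
  change ∫ z in (nontrivialSpinTorus x y).dom (), f () z ^ 2 = _
  rw [← integral_indicator hm, integral_comp_lattice (ζ := ⟨x, y⟩) hy, smul_eq_mul, torusArea, cell]
  congr 1
  have e : (fun p => ((nontrivialSpinTorus x y).dom ()).indicator (fun z => f () z ^ 2)
      (latticeMap ⟨x, y⟩ p)) = (Ico (0:ℝ) 1 ×ˢ Ico (0:ℝ) 1).indicator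
        fun p => f () (latticeMap ⟨x, y⟩ p) ^ 2 := by
    ext p
    simp only [indicator, hdom, mem_preimage, latticeInv_latticeMap (ζ := ⟨x, y⟩) hy.ne']
  rw [e, integral_indicator (measurableSet_Ico.prod measurableSet_Ico)]
  refine setIntegral_congr_set ?_
  rw [Measure.volume_eq_prod]
  exact Measure.set_prod_ae_eq Ico_ae_eq_Ioc Ico_ae_eq_Ioc

/-- In lattice coordinates the operators ∂₁ ± i∂₂ acquire factors ± iy, whose product is y². The
function W = -iy f⁻¹ ∂̄φ puts the equation in the first-order form of `TorusMetric.energy_eq`. -/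
theorem torus_energy_of_chartEigen {f : ℂ → ℝ} {φ : ℂ → ℂ} {μ : ℝ}
    (hf : ContDiff ℝ ∞ f) (hpos : ∀ z, 0 < f z) (hφ : ContDiff ℝ ∞ φ) (h : ChartEigen f φ μ)
    (hF : TorusMetric fun p => f (latticeMap ⟨x, y⟩ p))
    (hΦ : Twisted fun p => φ (latticeMap ⟨x, y⟩ p)) :
    torusEnergy ⟨x, y⟩ (fun p => f (latticeMap ⟨x, y⟩ p)) (fun p => φ (latticeMap ⟨x, y⟩ p)) =
      (μ * y ^ 2) * torusMass (fun p => f (latticeMap ⟨x, y⟩ p)) fun p => φ (latticeMap ⟨x, y⟩ p) := by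
  set ζ : ℂ := ⟨x, y⟩ with hζ
  have hIy : ζ.im = y := rfl
  have hd : Differentiable ℝ φ := hφ.differentiable (by simp)
  set w : ℂ → ℂ := fun z => (f z : ℂ)⁻¹ * dbar φ z with hw
  have hwd : ContDiff ℝ ∞ w := (contDiff_inv_ofReal hf hpos).mul (contDiff_dbar hφ)
  have hf0 (z) : (f z : ℂ) ≠ 0 := by exact_mod_cast (hpos z).ne'
  have hW : Twisted fun p => -(Complex.I * y) * w (latticeMap ζ p) := by
    have e : (fun p => -(Complex.I * y) * w (latticeMap ζ p)) =
        fun p => (((f (latticeMap ζ p))⁻¹ : ℝ) : ℂ) * cauchyOp ζ (fun p => φ (latticeMap ζ p)) p := by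
      ext p
      rw [(cauchyOp_comp_lattice hd ζ p).1, hw, hIy]
      push_cast
      ring
    rw [e]
    have hb : Biperiodic fun p => (((f (latticeMap ζ p))⁻¹ : ℝ) : ℂ) :=
      ⟨Complex.ofRealCLM.contDiff.comp ((hf.inv fun z => (hpos z).ne').comp (latticeMap ζ).contDiff),
        fun m n p =>
          congrArg (fun t : ℝ => ((t⁻¹ : ℝ) : ℂ)) (hF.period m n p)⟩
    exact (hΦ.cauchyOp ζ).bimul hb
  refine hF.energy_eq hΦ hW (fun p => ?_) fun p => ?_
  · rw [(cauchyOp_comp_lattice hd ζ p).1, hw, hIy]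
    have := hf0 (latticeMap ζ p)
    field_simp
  · have hwd' : Differentiable ℝ fun z => -(Complex.I * y) * w z :=
      (contDiff_const.mul hwd).differentiable (by simp)
    rw [(cauchyOp_comp_lattice hwd' ζ p).2, hIy]
    have hwz := (hwd.differentiable (by simp)).differentiableAt (x := latticeMap ζ p)
    rw [del_mul (φ := fun _ => -(Complex.I * y)) (by fun_prop) hwz, h]
    have : del (fun _ => -(Complex.I * y)) (latticeMap ζ p) = 0 := by simp [del]
    rw [this]
    push_cast
    linear_combination (y ^ 2 * μ * f (latticeMap ζ p) * φ (latticeMap ζ p)) * Complex.I_sq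

theorem torus_exists_eigenvalue {f : Unit → ℂ → ℝ} (hy : 0 < y)
    (hf : (nontrivialSpinTorus x y).IsMetric f) : ∃ μ,
      (nontrivialSpinTorus x y).IsDiracSqEigenvalue f (μ / y ^ 2) ∧
      (∀ Φ, Twisted Φ → μ * torusMass (fun p => f () (latticeMap ⟨x, y⟩ p)) Φ ≤
        torusEnergy ⟨x, y⟩ (fun p => f () (latticeMap ⟨x, y⟩ p)) Φ) ∧
      ∃ Φ, Twisted Φ ∧ Φ ≠ 0 ∧ torusEnergy ⟨x, y⟩ (fun p => f () (latticeMap ⟨x, y⟩ p)) Φ =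
        μ * torusMass (fun p => f () (latticeMap ⟨x, y⟩ p)) Φ := by
  set ζ : ℂ := ⟨x, y⟩ with hζ
  have hIy : ζ.im = y := rfl
  have hF := torusMetric_of_isMetric hf
  obtain ⟨μ, U, W, hU, hW, hne, e1, e2, hmin⟩ := hF.exists_minimizer (ζ := ζ) hy.ne'
  refine ⟨μ, ?_, hmin, U, hU, hne, hF.energy_eq hU hW e1 e2⟩
  set φ : ℂ → ℂ := fun z => U (latticeInv ζ z) with hφ
  set w : ℂ → ℂ := fun z => W (latticeInv ζ z) with hw
  have hφc : ContDiff ℝ ∞ φ := hU.smooth.comp (latticeInv ζ).contDiff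
  have hwc : ContDiff ℝ ∞ w := hW.smooth.comp (latticeInv ζ).contDiff
  have hUφ : U = fun p => φ (latticeMap ζ p) := by
    ext p; simp only [φ, latticeInv_latticeMap (ζ := ζ) hy.ne']
  have hWw : W = fun p => w (latticeMap ζ p) := by
    ext p; simp only [w, latticeInv_latticeMap (ζ := ζ) hy.ne']
  have hy0 : (y : ℂ) ≠ 0 := by exact_mod_cast hy.ne'
  have d1 (z) : -(Complex.I * y) * dbar φ z = f () z * w z := by
    have := e1 (latticeInv ζ z)
    rw [hUφ, (cauchyOp_comp_lattice (hφc.differentiable (by simp)) ζ _).1,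
      latticeMap_latticeInv (ζ := ζ) hy.ne'] at this
    exact this
  have d2 (z) : (Complex.I * y) * del w z = -μ * (f () z * φ z) := by
    have := e2 (latticeInv ζ z)
    rw [hWw, (cauchyOp_comp_lattice (hwc.differentiable (by simp)) ζ _).2,
      latticeMap_latticeInv (ζ := ζ) hy.ne'] at this
    exact this
  have hf0 (z) : (f () z : ℂ) ≠ 0 := by exact_mod_cast (hf.pos () z).ne'
  have hE : ChartEigen (f ()) φ (μ / y ^ 2) := by
    intro z
    have e : (fun p => (f () p : ℂ)⁻¹ * dbar φ p) = fun p => (Complex.I / y) * w p := by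
      ext p
      have := hf0 p
      have h1 := d1 p
      field_simp
      linear_combination Complex.I * h1 + y * dbar φ p * Complex.I_sq
    rw [e, del_mul (φ := fun _ => Complex.I / (y:ℂ)) (by fun_prop)
      ((hwc.differentiable (by simp)).differentiableAt)]
    have : del (fun _ => Complex.I / (y:ℂ)) z = 0 := by simp [del]
    rw [this]
    push_cast
    have h2 := d2 z
    field_simp
    linear_combination h2
  obtain ⟨h1, h2⟩ := dirac_of_chartEigen (hf.smooth ()) (hf.pos ()) hφc hE
  refine ⟨fun _ => _, ⟨fun _ => h1, ?_⟩, ⟨(), ?_⟩, fun _ => h2⟩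
  · rintro ⟨m, n⟩ z -
    have hp : f () (z + (m + n * (⟨x, y⟩ : ℂ))) = f () z := by
      simpa [nontrivialSpinTorus, flatTorus] using (hf.compat (m, n) z (mem_univ _)).symm
    have hφp : φ (z + (m + n * ζ)) = (-1 : ℂ) ^ n * φ z := by
      simp only [φ]
      rw [latticeInv_add_int (ζ := ζ) hy.ne', hU.twist]
    simp only [nontrivialSpinTorus, flatTorus, torus_sign, conj_neg_one_zpow]
    rw [hp, hφp]
    ext i
    fin_cases i
    · simp [Matrix.mulVec, dotProduct, Fin.sum_univ_two]
      linear_combination (-(√(f () z) : ℂ)⁻¹ * φ z) * neg_one_zpow_mul_self n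
    · simp [Matrix.mulVec, dotProduct, Fin.sum_univ_two]
  · intro h0
    apply hne
    rw [hUφ]
    ext p
    have := congrFun (congrFun h0 (latticeMap ζ p)) 0
    have hs : (√(f () (latticeMap ζ p)) : ℂ) ≠ 0 := by
      exact_mod_cast (Real.sqrt_pos.2 (hf.pos () _)).ne'
    simpa [hs] using this

/-- If both rescaled components vanished, so would the spinor. A nonvanishing one is an admissible
function whose Rayleigh quotient is ν y². -/
theorem torus_eigenvalue_ge {f : Unit → ℂ → ℝ} (hy : 0 < y)
    (hf : (nontrivialSpinTorus x y).IsMetric f) {μ ν : ℝ}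
    (hμ : ∀ Φ, Twisted Φ → μ * torusMass (fun p => f () (latticeMap ⟨x, y⟩ p)) Φ ≤
        torusEnergy ⟨x, y⟩ (fun p => f () (latticeMap ⟨x, y⟩ p)) Φ)
    (hν : (nontrivialSpinTorus x y).IsDiracSqEigenvalue f ν) : μ / y ^ 2 ≤ ν := by
  obtain ⟨ψ, hψ, ⟨i, hi⟩, he⟩ := hν
  have hF := torusMetric_of_isMetric hf
  obtain ⟨t1, t2⟩ := twisted_components hf hψ
  obtain ⟨c1, c2⟩ := chartEigen_of_dirac (hf.smooth ()) (hf.pos ()) (hψ.smooth ()) (he ())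
  have hs := contDiff_sqrt_ofReal (hf.smooth ()) (hf.pos ())
  have key {φ : ℂ → ℂ} (hφ : ContDiff ℝ ∞ φ) (hE : ChartEigen (f ()) φ ν)
      (hΦ : Twisted fun p => φ (latticeMap ⟨x, y⟩ p)) (hne : φ ≠ 0) : μ / y ^ 2 ≤ ν := by
    have h1 := torus_energy_of_chartEigen (hf.smooth ()) (hf.pos ()) hφ hE hF hΦ
    have h2 := hμ _ hΦ
    have h3 := hF.mass_pos hΦ fun h0 => hne (by
      ext z
      have := congrFun h0 (latticeInv ⟨x, y⟩ z)
      simp only [latticeMap_latticeInv (ζ := ⟨x, y⟩) hy.ne'] at this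
      exact this)
    rw [h1] at h2
    rw [div_le_iff₀ (by positivity)]
    exact le_of_mul_le_mul_right h2 h3
  by_contra hcon
  apply hi
  have z1 : (fun p => (√(f () p) : ℂ) * ψ () p 0) = 0 := by
    by_contra h
    exact hcon (key (hs.mul (contDiff_pi.1 (hψ.smooth ()) 0)) c1 t1 h)
  have z2 : (fun p => (starRingEnd ℂ) ((√(f () p) : ℂ) * ψ () p 1)) = 0 := by
    by_contra h
    exact hcon (key (Complex.conjCLE.contDiff.comp (hs.mul (contDiff_pi.1 (hψ.smooth ()) 1))) c2 t2 h)
  ext z j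
  have hs0 : (√(f () z) : ℂ) ≠ 0 := by exact_mod_cast (Real.sqrt_pos.2 (hf.pos () _)).ne'
  fin_cases j
  · simpa [hs0] using congrFun z1 z
  · simpa [hs0] using congrFun z2 z

theorem torus_firstEigenvalue {f : Unit → ℂ → ℝ} (hy : 0 < y)
    (hf : (nontrivialSpinTorus x y).IsMetric f) : ∃ μ,
      (nontrivialSpinTorus x y).firstEigenvalue f = μ / y ^ 2 ∧ 0 ≤ μ ∧
      (∀ Φ, Twisted Φ → μ * torusMass (fun p => f () (latticeMap ⟨x, y⟩ p)) Φ ≤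
        torusEnergy ⟨x, y⟩ (fun p => f () (latticeMap ⟨x, y⟩ p)) Φ) ∧
      ∃ Φ, Twisted Φ ∧ Φ ≠ 0 ∧ torusEnergy ⟨x, y⟩ (fun p => f () (latticeMap ⟨x, y⟩ p)) Φ =
        μ * torusMass (fun p => f () (latticeMap ⟨x, y⟩ p)) Φ := by
  obtain ⟨μ, h1, h2, Φ, hΦ, hne, he⟩ := torus_exists_eigenvalue hy hf
  have hF := torusMetric_of_isMetric hf
  refine ⟨μ, ?_, ?_, h2, Φ, hΦ, hne, he⟩
  · exact IsLeast.csInf_eq ⟨h1, fun ν hν => torus_eigenvalue_ge hy hf h2 hν⟩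
  · have := hF.energy_nonneg (Φ := Φ) ⟨x, y⟩
    rw [he] at this
    exact nonneg_of_mul_nonneg_left this (hF.mass_pos hΦ hne)

/-! ### The torus invariant as a best constant, and its continuity -/

theorem lamMin_bddBelow {ι J : Type} [Fintype ι] (S : SpinAtlas ι J) :
    BddBelow {v : ℝ | ∃ f, S.IsMetric f ∧ v = √(S.firstEigenvalue f) * √(S.area f)} :=
  ⟨0, by rintro _ ⟨f, -, rfl⟩; positivity⟩

/-- For each metric the Rayleigh minimum μ gives λ₁ · Area = μ · `torusArea` / y. Since this minimum
is attained, a gap bound for all functions and a lower bound for λ₁ · Area carry the same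
information. -/
theorem gapBound_iff_le_lamMin (hy : 0 < y) {κ : ℝ} (hκ : 0 < κ) :
    GapBound ⟨x, y⟩ κ ↔ (κ * √y)⁻¹ ≤ (nontrivialSpinTorus x y).lamMin := by
  have hsq : √y ^ 2 = y := Real.sq_sqrt hy.le
  have hsy : 0 < √y := Real.sqrt_pos.2 hy
  have val {f : Unit → ℂ → ℝ} {μ : ℝ} (hμ : 0 ≤ μ)
      (h : (nontrivialSpinTorus x y).firstEigenvalue f = μ / y ^ 2) :
      (κ * √y)⁻¹ ≤ √((nontrivialSpinTorus x y).firstEigenvalue f) *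
        √((nontrivialSpinTorus x y).area f) ↔
      1 ≤ κ ^ 2 * (μ * torusArea fun p => f () (latticeMap ⟨x, y⟩ p)) := by
    have hA := TorusMetric.area_nonneg (F := fun p => f () (latticeMap ⟨x, y⟩ p))
    rw [h, torus_area hy, ← Real.sqrt_mul (by positivity), Real.le_sqrt' (by positivity),
      inv_pow, mul_pow, hsq, inv_le_iff_one_le_mul₀ (by positivity)]
    have : κ ^ 2 * y * (μ / y ^ 2 * (y * torusArea fun p => f () (latticeMap ⟨x, y⟩ p))) =
        κ ^ 2 * (μ * torusArea fun p => f () (latticeMap ⟨x, y⟩ p)) := by field_simp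
    rw [mul_comm (μ / y ^ 2 * _), this]
  constructor
  · intro hG
    refine le_csInf ?_ ?_
    -- The flat metric shows that the infimum defining the invariant runs over a nonempty set.
    · have h1 : TorusMetric fun _ => 1 := ⟨⟨contDiff_const, fun _ _ _ => rfl⟩, fun _ => one_pos⟩
      exact ⟨_, _, h1.isMetric hy.ne', rfl⟩
    · rintro _ ⟨f, hf, rfl⟩
      obtain ⟨μ, h1, h0, h2, Φ, hΦ, hne, he⟩ := torus_firstEigenvalue hy hf
      rw [val h0 h1]
      have hF := torusMetric_of_isMetric hf
      have h3 := hG _ _ hF hΦ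
      have h4 := hF.mass_pos hΦ hne
      rw [he] at h3
      refine le_of_mul_le_mul_right ?_ h4
      linarith
  · intro h F Φ hF hΦ
    have hf := hF.isMetric (x := x) hy.ne'
    obtain ⟨μ, h1, h0, h2, -⟩ := torus_firstEigenvalue hy hf
    have h3 := (val h0 h1).1 (h.trans (csInf_le (lamMin_bddBelow _) ⟨_, hf, rfl⟩))
    have e : (fun p => F (latticeInv ⟨x, y⟩ (latticeMap ⟨x, y⟩ p))) = F := by
      ext p; rw [latticeInv_latticeMap (ζ := ⟨x, y⟩) hy.ne']
    simp only [e] at h2 h3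
    have h4 := h2 Φ hΦ
    have h5 := hF.mass_nonneg (Φ := Φ)
    calc torusMass F Φ ≤ κ ^ 2 * (μ * torusArea F) * torusMass F Φ := le_mul_of_one_le_left h5 h3
      _ = κ ^ 2 * (torusArea F * (μ * torusMass F Φ)) := by ring
      _ ≤ _ := by gcongr; exact TorusMetric.area_nonneg

theorem torus_lamMin_pos (hy : 0 < y) : 0 < (nontrivialSpinTorus x y).lamMin := by
  obtain ⟨κ, hκ, h⟩ := exists_gapBound (ζ := ⟨x, y⟩) hy.ne'
  exact lt_of_lt_of_le (by positivity) ((gapBound_iff_le_lamMin hy hκ).1 h)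

theorem lamMin_sq_mul_le (hy : 0 < y) {F : ℝ × ℝ → ℝ} {Φ : ℝ × ℝ → ℂ} (hF : TorusMetric F)
    (hΦ : Twisted Φ) : (nontrivialSpinTorus x y).lamMin ^ 2 * (y * torusMass F Φ) ≤
      torusArea F * torusEnergy ⟨x, y⟩ F Φ := by
  set l := (nontrivialSpinTorus x y).lamMin with hl
  have hl0 : 0 < l := torus_lamMin_pos hy
  have hsq : √y ^ 2 = y := Real.sq_sqrt hy.le
  have hsy : 0 < √y := Real.sqrt_pos.2 hy
  have := (gapBound_iff_le_lamMin (x := x) hy (κ := (l * √y)⁻¹) (by positivity)).2 (by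
    rw [← hl, mul_inv, inv_inv, mul_assoc, mul_inv_cancel₀ hsy.ne', mul_one]) F Φ hF hΦ
  rw [inv_pow, mul_pow, hsq, inv_mul_eq_div, le_div_iff₀ (by positivity)] at this
  linarith

/-- The best constant in the spectral gap inequality. -/
def bestGap (ζ : ℂ) : ℝ := ((nontrivialSpinTorus ζ.re ζ.im).lamMin * √ζ.im)⁻¹

theorem bestGap_pos {ζ : ℂ} (hζ : 0 < ζ.im) : 0 < bestGap ζ :=
  inv_pos.2 (mul_pos (torus_lamMin_pos hζ) (Real.sqrt_pos.2 hζ))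

theorem gapBound_iff {ζ : ℂ} (hζ : 0 < ζ.im) {κ : ℝ} (hκ : 0 < κ) :
    GapBound ζ κ ↔ bestGap ζ ≤ κ := by
  have hl := torus_lamMin_pos (x := ζ.re) hζ
  have hs := Real.sqrt_pos.2 hζ
  have := gapBound_iff_le_lamMin (x := ζ.re) hζ hκ
  rw [this, bestGap, inv_le_iff_one_le_mul₀ (by positivity), inv_le_iff_one_le_mul₀ (by positivity)]
  constructor <;> intro h <;> linarith

/-- Both implications of `GapBound.perturb`, applied to best constants, bound their difference by a
multiple of |ζ - ζ₀|/|Im ζ|, which tends to zero as long as Im ζ₀ > 0. -/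
theorem continuousAt_bestGap {ζ₀ : ℂ} (h₀ : 0 < ζ₀.im) : ContinuousAt bestGap ζ₀ := by
  obtain ⟨c, hc, hs⟩ := exists_symb_lower h₀.ne'
  have hev : ∀ᶠ ζ in 𝓝 ζ₀, 0 < ζ.im :=
    (isOpen_lt continuous_const Complex.continuous_im).mem_nhds h₀
  rw [ContinuousAt, tendsto_iff_dist_tendsto_zero]
  refine squeeze_zero' (g := fun ζ => 16 / c * (‖ζ - ζ₀‖ / |ζ.im|))
    (Eventually.of_forall fun _ => dist_nonneg) ?_ ?_
  · filter_upwards [hev] with ζ hζ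
    have b1 := bestGap_pos hζ
    have b0 := bestGap_pos h₀
    have hr : 0 ≤ 16 / c * (‖ζ - ζ₀‖ / |ζ.im|) := by positivity
    have p1 := (GapBound.perturb hζ.ne' h₀.ne' hc hs b0.le).1 ((gapBound_iff h₀ b0).2 le_rfl)
    have p2 := (GapBound.perturb hζ.ne' h₀.ne' hc hs b1.le).2 ((gapBound_iff hζ b1).2 le_rfl)
    rw [gapBound_iff hζ (by linarith)] at p1
    rw [gapBound_iff h₀ (by linarith)] at p2
    rw [Real.dist_eq, abs_le]
    constructor <;> linarith
  · have : ContinuousAt (fun ζ : ℂ => 16 / c * (‖ζ - ζ₀‖ / |ζ.im|)) ζ₀ := by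
      have : ζ₀.im ≠ 0 := h₀.ne'
      refine ContinuousAt.mul continuousAt_const (ContinuousAt.div (by fun_prop)
        (Complex.continuous_im.abs.continuousAt) (abs_ne_zero.2 this))
    simpa [ContinuousAt] using this

theorem continuousAt_lamMin {p₀ : ℝ × ℝ} (h₀ : 0 < p₀.2) :
    ContinuousAt (fun p : ℝ × ℝ => (nontrivialSpinTorus p.1 p.2).lamMin) p₀ := by
  have hev : ∀ᶠ p in 𝓝 p₀, 0 < p.2 :=
    (isOpen_lt continuous_const continuous_snd).mem_nhds h₀
  have hc : Continuous fun p : ℝ × ℝ => (⟨p.1, p.2⟩ : ℂ) :=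
    Complex.equivRealProdCLM.symm.continuous
  have hg : ContinuousAt (fun p : ℝ × ℝ => bestGap ⟨p.1, p.2⟩) p₀ :=
    ContinuousAt.comp (f := fun p : ℝ × ℝ => (⟨p.1, p.2⟩ : ℂ))
      (continuousAt_bestGap (ζ₀ := ⟨p₀.1, p₀.2⟩) h₀) hc.continuousAt
  have hs : ContinuousAt (fun p : ℝ × ℝ => √p.2) p₀ := by fun_prop
  have hb := bestGap_pos (ζ := ⟨p₀.1, p₀.2⟩) h₀
  refine ((hg.mul hs).inv₀ (mul_pos hb (Real.sqrt_pos.2 h₀)).ne').congr ?_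
  filter_upwards [hev] with p hp
  have hl := torus_lamMin_pos (x := p.1) hp
  have := Real.sqrt_pos.2 hp
  simp only [Pi.mul_apply, Pi.inv_apply, bestGap]
  field_simp

end Torus

/-! ## Interior regularity in the unit square -/

/-- Smooth functions with compact support in the open unit square. -/
structure Cutoff (η : ℝ × ℝ → ℂ) : Prop where
  smooth : ContDiff ℝ ∞ η
  supp : tsupport η ⊆ Ioo (0 : ℝ) 1 ×ˢ Ioo (0 : ℝ) 1

theorem cauchyOp_mul {g η : ℝ × ℝ → ℂ} {p : ℝ × ℝ} (ζ : ℂ) (hg : DifferentiableAt ℝ g p)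
    (hη : DifferentiableAt ℝ η p) : cauchyOp ζ (fun q => g q * η q) p =
      g p * cauchyOp ζ η p + η p * cauchyOp ζ g p := by
  simp only [cauchyOp, fderiv_fun_mul hg hη, add_apply, smul_apply, smul_eq_mul]
  ring

namespace Cutoff

variable {η g : ℝ × ℝ → ℂ}

protected theorem continuous (h : Cutoff η) : Continuous η := h.smooth.continuous

theorem hasCompactSupport (h : Cutoff η) : HasCompactSupport η :=
  (isCompact_Icc.prod isCompact_Icc).of_isClosed_subset (isClosed_tsupport η)
    (h.supp.trans (prod_mono Ioo_subset_Icc_self Ioo_subset_Icc_self))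

theorem mul_left (h : Cutoff η) (hg : ContDiff ℝ ∞ g) : Cutoff fun p => g p * η p :=
  ⟨hg.mul h.smooth, (tsupport_mul_subset_right (f := g)).trans h.supp⟩

theorem fderiv_apply (h : Cutoff η) (v : ℝ × ℝ) : Cutoff fun p => fderiv ℝ η p v :=
  ⟨(h.smooth.fderiv_right (m := ∞) (by simp)).clm_apply contDiff_const,
    (tsupport_fderiv_apply_subset ℝ v).trans h.supp⟩

theorem add (h : Cutoff η) (hg : Cutoff g) : Cutoff fun p => η p + g p :=
  ⟨h.smooth.add hg.smooth, (tsupport_add η g).trans (union_subset h.supp hg.supp)⟩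

theorem cauchyOp (h : Cutoff η) (ζ : ℂ) : Cutoff (cauchyOp ζ η) := by
  have := (h.fderiv_apply (0, 1)).add
    ((h.fderiv_apply (1, 0)).mul_left (contDiff_const (c := -ζ)))
  have e : _root_.cauchyOp ζ η = fun p => fderiv ℝ η p (0, 1) + -ζ * fderiv ℝ η p (1, 0) := by
    ext p; rw [_root_.cauchyOp]; ring
  rwa [e]

theorem eq_zero (h : Cutoff η) {p : ℝ × ℝ} (hp : p ∉ Ioo (0 : ℝ) 1 ×ˢ Ioo (0 : ℝ) 1) : η p = 0 :=
  image_eq_zero_of_notMem_tsupport fun h' => hp (h.supp h')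

theorem integral_cell (h : Cutoff η) (u : ℝ × ℝ → ℂ) : ∫ p, u p * η p ∂cell = ∫ p, u p * η p :=
  setIntegral_eq_integral_of_forall_compl_eq_zero fun p hp => by
    rw [h.eq_zero fun h' => hp (prod_mono Ioo_subset_Ioc_self Ioo_subset_Ioc_self h'), mul_zero]

theorem integral_fderiv_mul (h : Cutoff η) (hg : ContDiff ℝ ∞ g) (v : ℝ × ℝ) :
    ∫ p, g p * fderiv ℝ η p v ∂cell = -∫ p, fderiv ℝ g p v * η p ∂cell := by
  have hg' : ContDiff ℝ ∞ fun p => fderiv ℝ g p v :=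
    (hg.fderiv_right (m := ∞) (by simp)).clm_apply contDiff_const
  have int {a : ℝ × ℝ → ℂ} (ha : Cutoff a) : Integrable a :=
    ha.continuous.integrable_of_hasCompactSupport ha.hasCompactSupport
  rw [h.integral_cell, (h.fderiv_apply v).integral_cell]
  exact integral_mul_fderiv_eq_neg_fderiv_mul_of_integrable (int (h.mul_left hg'))
    (int ((h.fderiv_apply v).mul_left hg)) (int (h.mul_left hg))
    (fun p _ => (hg.differentiable (by simp)).differentiableAt)
    (fun p _ => (h.smooth.differentiable (by simp)).differentiableAt)

theorem integral_cauchyOp_mul (h : Cutoff η) (hg : ContDiff ℝ ∞ g) (ζ : ℂ) :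
    ∫ p, g p * _root_.cauchyOp ζ η p ∂cell = -∫ p, _root_.cauchyOp ζ g p * η p ∂cell := by
  have hg' (v) : ContDiff ℝ ∞ fun p => fderiv ℝ g p v :=
    (hg.fderiv_right (m := ∞) (by simp)).clm_apply contDiff_const
  simp only [_root_.cauchyOp, sub_mul, mul_sub, mul_assoc, mul_left_comm _ ζ]
  have i1 (v) : Integrable (fun p => g p * fderiv ℝ η p v) cell :=
    integrable_of_continuous (hg.continuous.mul (h.fderiv_apply v).continuous)
  have i2 (v) : Integrable (fun p => fderiv ℝ g p v * η p) cell :=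
    integrable_of_continuous ((hg' v).continuous.mul h.continuous)
  rw [integral_sub (i1 _) ((i1 _).const_mul _), integral_sub (i2 _) ((i2 _).const_mul _),
    integral_const_mul, integral_const_mul, h.integral_fderiv_mul hg, h.integral_fderiv_mul hg]
  ring

theorem memLp_mul (h : Cutoff η) {u : ℝ × ℝ → ℂ} (hu : MemLp u 2 cell) :
    MemLp (fun p => η p * u p) 2 cell := by
  obtain ⟨C, hC⟩ := h.hasCompactSupport.exists_bound_of_continuous h.continuous
  refine MemLp.of_le_mul (c := C) hu (h.continuous.aestronglyMeasurable.mul hu.1)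
    (Eventually.of_forall fun p => ?_)
  rw [norm_mul]
  exact mul_le_mul_of_nonneg_right (hC p) (norm_nonneg _)

end Cutoff

theorem contDiff_conj_expo (k : ℤ × ℤ) : ContDiff ℝ ∞ fun p => (starRingEnd ℂ) (expo k p) :=
  Complex.conjCLE.contDiff.comp (contDiff_expo k)

theorem cauchyOp_conj_expo (ζ : ℂ) (k : ℤ × ℤ) (p : ℝ × ℝ) :
    cauchyOp ζ (fun q => (starRingEnd ℂ) (expo k q)) p =
      -symb ζ k * (starRingEnd ℂ) (expo k p) := by
  rw [cauchyOp_conj, cauchyOp_expo, map_mul, conj_symb, Complex.conj_conj]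

/-- Localization of a weak equation `∂_t u - ζ ∂_s u = G w` in the unit square. -/
theorem symb_mul_coef_of_weak {ζ : ℂ} {u w G : ℝ × ℝ → ℂ} (hu : MemLp u 2 cell)
    (hw : MemLp w 2 cell) (hG : ContDiff ℝ ∞ G)
    (h : ∀ η, Cutoff η → ∫ p, u p * cauchyOp ζ η p ∂cell = -∫ p, G p * w p * η p ∂cell)
    {η : ℝ × ℝ → ℂ} (hη : Cutoff η) (k : ℤ × ℤ) :
    symb ζ k * coef (fun p => η p * u p) k =
      coef (fun p => (G p * η p) * w p + cauchyOp ζ η p * u p) k := by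
  have hk := contDiff_conj_expo k
  have h1 := h _ (hη.mul_left hk)
  have d1 : ∀ p, cauchyOp ζ (fun p => (starRingEnd ℂ) (expo k p) * η p) p =
      (starRingEnd ℂ) (expo k p) * cauchyOp ζ η p - symb ζ k * (η p * (starRingEnd ℂ) (expo k p)) :=
    fun p => by
      rw [cauchyOp_mul ζ (hk.differentiable (by simp)).differentiableAt
        (hη.smooth.differentiable (by simp)).differentiableAt, cauchyOp_conj_expo]
      ring
  simp only [d1] at h1
  have i1 := integrable_mul_conj_expo (hη.memLp_mul hu) k
  have i2 := integrable_mul_conj_expo ((hη.cauchyOp ζ).memLp_mul hu) k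
  have hGη := hη.mul_left hG
  rw [coef_add (hGη.memLp_mul hw) ((hη.cauchyOp ζ).memLp_mul hu)]
  simp only [coef] at *
  have e1 : ∫ p, u p * ((starRingEnd ℂ) (expo k p) * cauchyOp ζ η p -
      symb ζ k * (η p * (starRingEnd ℂ) (expo k p))) ∂cell =
      ∫ p, cauchyOp ζ η p * u p * (starRingEnd ℂ) (expo k p) ∂cell -
      symb ζ k * ∫ p, η p * u p * (starRingEnd ℂ) (expo k p) ∂cell := by
    rw [← integral_const_mul, ← integral_sub i2 (i1.const_mul _)]
    congr 1 with p
    ring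
  have e2 : ∫ p, G p * w p * ((starRingEnd ℂ) (expo k p) * η p) ∂cell =
      ∫ p, G p * η p * w p * (starRingEnd ℂ) (expo k p) ∂cell := by
    congr 1 with p
    ring
  rw [e1, e2] at h1
  linear_combination -h1

/-- Interior regularity for a weak first order elliptic system. -/
theorem Cutoff.exists_twisted_of_weak {ζ ζ' : ℂ} (hζ : ζ.im ≠ 0) (hζ' : ζ'.im ≠ 0)
    {u w G H : ℝ × ℝ → ℂ} (hu : MemLp u 2 cell) (hw : MemLp w 2 cell) (hG : ContDiff ℝ ∞ G)
    (hH : ContDiff ℝ ∞ H)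
    (h : ∀ η, Cutoff η → ∫ p, u p * _root_.cauchyOp ζ η p ∂cell = -∫ p, G p * w p * η p ∂cell)
    (h' : ∀ η, Cutoff η → ∫ p, w p * _root_.cauchyOp ζ' η p ∂cell = -∫ p, H p * u p * η p ∂cell)
    {η : ℝ × ℝ → ℂ} (hη : Cutoff η) :
    (∃ U, Twisted U ∧ (fun p => η p * u p) =ᵐ[cell] U) ∧
    ∃ W, Twisted W ∧ (fun p => η p * w p) =ᵐ[cell] W := by
  -- The induction runs over all cutoffs at once: localization produces G η and the derivative of η,
  -- which are again cutoffs and are covered by the previous stage.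
  have key (n : ℕ) : ∀ η, Cutoff η → Sob n (fun p => η p * u p) ∧ Sob n (fun p => η p * w p) := by
    induction n with
    | zero => exact fun η hη => ⟨sob_zero (hη.memLp_mul hu), sob_zero (hη.memLp_mul hw)⟩
    | succ n ih =>
      exact fun η hη =>
        ⟨Sob.of_symb hζ (hη.memLp_mul hu) ((ih _ (hη.mul_left hG)).2.add (ih _ (hη.cauchyOp ζ)).1)
          (symb_mul_coef_of_weak hu hw hG h hη),
        Sob.of_symb hζ' (hη.memLp_mul hw) ((ih _ (hη.mul_left hH)).1.add (ih _ (hη.cauchyOp ζ')).2)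
          (symb_mul_coef_of_weak hw hu hH h' hη)⟩
  exact ⟨exists_twisted_ae_eq fun n => (key n η hη).1, exists_twisted_ae_eq fun n => (key n η hη).2⟩

theorem eqOn_of_ae_eq_cell {Φ Ψ : ℝ × ℝ → ℂ} (hΦ : Continuous Φ) (hΨ : Continuous Ψ)
    (h : Φ =ᵐ[cell] Ψ) : EqOn Φ Ψ (Ioo (0 : ℝ) 1 ×ˢ Ioo (0 : ℝ) 1) := by
  refine Measure.eqOn_open_of_ae_eq (μ := volume) ?_ (isOpen_Ioo.prod isOpen_Ioo)
    hΦ.continuousOn hΨ.continuousOn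
  exact ae_restrict_of_ae_restrict_of_subset
    (prod_mono Ioo_subset_Ioc_self Ioo_subset_Ioc_self) h

/-- The antiperiodic extension of a function with compact support in the unit square. -/
theorem Cutoff.exists_twisted {η : ℝ × ℝ → ℂ} (hη : Cutoff η) :
    ∃ U, Twisted U ∧ EqOn η U (Ioo (0 : ℝ) 1 ×ˢ Ioo (0 : ℝ) 1) := by
  have hI : Complex.I.im ≠ 0 := by simp
  -- Interior regularity is applied to the trivial solution u = 1, w = 0 of the homogeneous system;
  -- the smooth antiperiodic function equal to η · 1 is then the desired extension.
  have hu : MemLp (fun _ : ℝ × ℝ => (1 : ℂ)) 2 cell := memLp_of_continuous continuous_const 2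
  have hw : MemLp (fun _ : ℝ × ℝ => (0 : ℂ)) 2 cell := memLp_of_continuous continuous_const 2
  have h (ζ : ℂ) (η) (hη : Cutoff η) : ∫ p, 1 * _root_.cauchyOp ζ η p ∂cell = 0 := by
    rw [hη.integral_cauchyOp_mul contDiff_const]
    simp [_root_.cauchyOp]
  obtain ⟨⟨U, hU, e⟩, -⟩ := Cutoff.exists_twisted_of_weak (ζ := Complex.I) (ζ' := Complex.I) hI hI
    hu hw (contDiff_const (c := (0 : ℂ))) (contDiff_const (c := (0 : ℂ)))
    (fun η hη => by rw [h _ η hη]; simp) (fun η hη => by simp) hη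
  exact ⟨U, hU, eqOn_of_ae_eq_cell hη.continuous hU.continuous (by simpa using e)⟩

theorem ae_mem_openCell : ∀ᵐ p ∂cell, p ∈ Ioo (0 : ℝ) 1 ×ˢ Ioo (0 : ℝ) 1 := by
  have h : cell = volume.restrict (Ioo (0:ℝ) 1 ×ˢ Ioo (0:ℝ) 1) := by
    rw [cell]
    refine Measure.restrict_congr_set ?_
    rw [Measure.volume_eq_prod]
    exact Measure.set_prod_ae_eq Ioo_ae_eq_Ioc.symm Ioo_ae_eq_Ioc.symm
  rw [h]
  exact ae_restrict_mem (measurableSet_Ioo.prod measurableSet_Ioo)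

theorem cauchyOp_eqOn_openCell {Φ Ψ : ℝ × ℝ → ℂ} (ζ : ℂ)
    (h : EqOn Φ Ψ (Ioo (0 : ℝ) 1 ×ˢ Ioo (0 : ℝ) 1)) :
    EqOn (cauchyOp ζ Φ) (cauchyOp ζ Ψ) (Ioo (0 : ℝ) 1 ×ˢ Ioo (0 : ℝ) 1) := fun p hp => by
  have : Φ =ᶠ[𝓝 p] Ψ := by
    filter_upwards [(isOpen_Ioo.prod isOpen_Ioo).mem_nhds hp] with q hq using h hq
  rw [cauchyOp, cauchyOp, this.fderiv_eq]

/-- Interior compactness. -/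
theorem Cutoff.exists_subseq_cauchy (η : ℝ × ℝ → ℂ) (hη : Cutoff η) (v : ℕ → ℝ × ℝ → ℂ)
    (hv : ∀ n, ContDiff ℝ ∞ (v n)) {ζ : ℂ} (hζ : ζ.im ≠ 0) {M : ℝ}
    (h1 : ∀ n, ∫ p, ‖v n p‖ ^ 2 ∂cell ≤ M) (h2 : ∀ n, ∫ p, ‖_root_.cauchyOp ζ (v n) p‖ ^ 2 ∂cell ≤ M) :
    ∃ g : ℕ → ℕ, StrictMono g ∧ ∀ ε > 0, ∃ N, ∀ n ≥ N, ∀ m ≥ N,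
      ∫ p, ‖η p * (v (g n) p - v (g m) p)‖ ^ 2 ∂cell ≤ ε := by
  obtain ⟨c, hc, hs⟩ := exists_symb_lower hζ
  obtain ⟨C1, hC1⟩ := hη.hasCompactSupport.exists_bound_of_continuous hη.continuous
  obtain ⟨C2, hC2⟩ := (hη.cauchyOp ζ).hasCompactSupport.exists_bound_of_continuous
    (hη.cauchyOp ζ).continuous
  have cut (n) : Cutoff fun p => v n p * η p := hη.mul_left (hv n)
  have mem (n) : MemLp (fun p => v n p * η p) 2 cell := memLp_of_continuous (cut n).continuous 2
  -- A function supported inside the square need not be antiperiodic on the plane, but integration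
  -- by parts against exponentials has no boundary terms for it either.
  have hcoef (n) (k) : coef (_root_.cauchyOp ζ fun p => v n p * η p) k =
      symb ζ k * coef (fun p => v n p * η p) k := by
    have := (cut n).integral_cauchyOp_mul (contDiff_conj_expo k) ζ
    simp only [cauchyOp_conj_expo] at this
    simp only [coef]
    rw [← integral_const_mul]
    simp only [mul_comm _ ((starRingEnd ℂ) (expo k _))]
    rw [this, ← integral_neg]
    congr 1 with p
    ring
  have key (n) := summable_wt_sq_of_coef_eq hc hs
    (memLp_of_continuous ((cut n).cauchyOp ζ).continuous 2) (hcoef n)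
  have bound (n) : ∫ p, ‖_root_.cauchyOp ζ (fun p => v n p * η p) p‖ ^ 2 ∂cell ≤
      2 * C2 ^ 2 * M + 2 * C1 ^ 2 * M := by
    have hcv : Continuous (_root_.cauchyOp ζ (v n)) := by
      have hd (e : ℝ × ℝ) : Continuous fun p => fderiv ℝ (v n) p e :=
        ((hv n).fderiv_right (m := ∞) (by simp)).continuous.clm_apply continuous_const
      exact (hd _).sub (continuous_const.mul (hd _))
    have i1 : Integrable (fun p => ‖v n p‖ ^ 2) cell :=
      integrable_of_continuous ((hv n).continuous.norm.pow 2)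
    have i2 : Integrable (fun p => ‖_root_.cauchyOp ζ (v n) p‖ ^ 2) cell :=
      integrable_of_continuous (hcv.norm.pow 2)
    calc _ ≤ ∫ p, (2 * C2 ^ 2 * ‖v n p‖ ^ 2 + 2 * C1 ^ 2 * ‖_root_.cauchyOp ζ (v n) p‖ ^ 2) ∂cell := by
          refine integral_mono (integrable_of_continuous (((cut n).cauchyOp ζ).continuous.norm.pow 2))
            ((i1.const_mul _).add (i2.const_mul _)) fun p => ?_
          simp only
          rw [cauchyOp_mul ζ ((hv n).differentiable (by simp)).differentiableAt
            (hη.smooth.differentiable (by simp)).differentiableAt]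
          have a1 : ‖v n p * _root_.cauchyOp ζ η p + η p * _root_.cauchyOp ζ (v n) p‖ ≤
              C2 * ‖v n p‖ + C1 * ‖_root_.cauchyOp ζ (v n) p‖ := by
            refine (norm_add_le _ _).trans (add_le_add ?_ ?_)
            · rw [norm_mul, mul_comm]
              exact mul_le_mul_of_nonneg_right (hC2 p) (norm_nonneg _)
            · rw [norm_mul]
              exact mul_le_mul_of_nonneg_right (hC1 p) (norm_nonneg _)
          have := pow_le_pow_left₀ (norm_nonneg _) a1 2
          nlinarith [sq_nonneg (C2 * ‖v n p‖ - C1 * ‖_root_.cauchyOp ζ (v n) p‖)]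
      _ = 2 * C2 ^ 2 * ∫ p, ‖v n p‖ ^ 2 ∂cell +
          2 * C1 ^ 2 * ∫ p, ‖_root_.cauchyOp ζ (v n) p‖ ^ 2 ∂cell := by
        rw [integral_add (i1.const_mul _) (i2.const_mul _), integral_const_mul, integral_const_mul]
      _ ≤ _ := by gcongr; exacts [h1 n, h2 n]
  obtain ⟨g, hg, hg2⟩ := _root_.exists_subseq_cauchy (fun n p => v n p * η p) mem
    (1 / c ^ 2 * (2 * C2 ^ 2 * M + 2 * C1 ^ 2 * M)) (fun n => (key n).1)
    (fun n => (key n).2.trans (mul_le_mul_of_nonneg_left (bound n) (by positivity)))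
  refine ⟨g, hg, fun ε hε => ?_⟩
  obtain ⟨N, hN⟩ := hg2 ε hε
  refine ⟨N, fun n hn m hm => le_trans (le_of_eq ?_) (hN n hn m hm)⟩
  congr 1 with p
  rw [← sub_mul, mul_comm]

/-! ## Interior regularity and compactness in the plane -/

/-- The parametrization of the square with side `r` and center `0` by the unit square. -/
def squareMap (r : ℝ) (p : ℝ × ℝ) : ℂ := r * (latticeMap Complex.I p - (1 + Complex.I) / 2)

/-- The inverse of `squareMap`. -/
def squareInv (r : ℝ) (z : ℂ) : ℝ × ℝ := (z.re / r + 1 / 2, z.im / r + 1 / 2)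

theorem squareMap_re (r : ℝ) (p : ℝ × ℝ) : (squareMap r p).re = r * (p.1 - 1 / 2) := by
  simp [squareMap, latticeMap_apply]

theorem squareMap_im (r : ℝ) (p : ℝ × ℝ) : (squareMap r p).im = r * (p.2 - 1 / 2) := by
  simp [squareMap, latticeMap_apply]

theorem squareMap_squareInv {r : ℝ} (hr : r ≠ 0) (z : ℂ) : squareMap r (squareInv r z) = z := by
  apply Complex.ext
  · rw [squareMap_re, squareInv]; field_simp; ring
  · rw [squareMap_im, squareInv]; field_simp; ring

theorem squareInv_squareMap {r : ℝ} (hr : r ≠ 0) (p : ℝ × ℝ) : squareInv r (squareMap r p) = p := by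
  ext
  · simp only [squareInv, squareMap_re]; field_simp; ring
  · simp only [squareInv, squareMap_im]; field_simp; ring

theorem contDiff_squareMap (r : ℝ) : ContDiff ℝ ∞ (squareMap r) :=
  contDiff_const.mul ((latticeMap _).contDiff.sub contDiff_const)

theorem contDiff_squareInv (r : ℝ) : ContDiff ℝ ∞ (squareInv r) :=
  ((Complex.reCLM.contDiff.div_const r).add contDiff_const).prodMk
    ((Complex.imCLM.contDiff.div_const r).add contDiff_const)

theorem squareMap_eq (r : ℝ) : squareMap r =
    (fun z : ℂ => z + -(r * ((1 + Complex.I) / 2))) ∘ (fun z : ℂ => r • z) ∘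
      Complex.measurableEquivRealProd.symm := by
  ext p
  apply Complex.ext
  · rw [squareMap_re]; simp [Complex.measurableEquivRealProd]; ring
  · rw [squareMap_im]; simp [Complex.measurableEquivRealProd]; ring

theorem map_squareMap {r : ℝ} (hr : r ≠ 0) :
    Measure.map (squareMap r) volume = ENNReal.ofReal |(r ^ 2)⁻¹| • volume := by
  rw [squareMap_eq, ← Measure.map_map (by fun_prop) (by fun_prop),
    ← Measure.map_map (by fun_prop) (by fun_prop),
    Complex.volume_preserving_equiv_real_prod.symm.map_eq,
    Measure.map_addHaar_smul volume hr, Complex.finrank_real_complex, Measure.map_smul,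
    map_add_right_eq_self]

theorem measurableEmbedding_squareMap {r : ℝ} (hr : r ≠ 0) : MeasurableEmbedding (squareMap r) :=
  (contDiff_squareMap r).continuous.measurableEmbedding
    (Function.LeftInverse.injective (squareInv_squareMap hr))

theorem integral_comp_square {E : Type*} [NormedAddCommGroup E] [NormedSpace ℝ E] {r : ℝ}
    (hr : r ≠ 0) (h : ℂ → E) : ∫ z, h z = r ^ 2 • ∫ p, h (squareMap r p) := by
  have h2 := (measurableEmbedding_squareMap hr).integral_map (μ := volume) h
  rw [map_squareMap hr, integral_smul_measure, ENNReal.toReal_ofReal (abs_nonneg _),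
    abs_of_nonneg (by positivity)] at h2
  rw [← h2, smul_smul, mul_inv_cancel₀ (by positivity), one_smul]

theorem ae_comp_square_iff {r : ℝ} (hr : r ≠ 0) {P : ℂ → Prop} :
    (∀ᵐ z, P z) ↔ ∀ᵐ p, P (squareMap r p) := by
  have h := (measurableEmbedding_squareMap hr).ae_map_iff (μ := volume) (p := P)
  rw [← h, map_squareMap hr, Measure.ae_ennreal_smul_measure_iff]
  simpa using hr

theorem MemLp.comp_squareMap {r : ℝ} (hr : r ≠ 0) {u : ℂ → ℂ} (hu : MemLp u 2 volume) :
    MemLp (fun p => u (squareMap r p)) 2 volume := by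
  refine (measurableEmbedding_squareMap hr).memLp_map_measure_iff.1 ?_
  rw [map_squareMap hr]
  exact hu.smul_measure ENNReal.ofReal_ne_top

theorem cauchyOp_comp_square {φ : ℂ → ℂ} (hφ : Differentiable ℝ φ) (r : ℝ) (p : ℝ × ℝ) :
    cauchyOp Complex.I (fun p => φ (squareMap r p)) p = -(Complex.I * r) * dbar φ (squareMap r p) ∧
    cauchyOp (-Complex.I) (fun p => φ (squareMap r p)) p =
      (Complex.I * r) * del φ (squareMap r p) := by
  set a : ℂ → ℂ := fun z => r * (z - (1 + Complex.I) / 2) with ha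
  have had : Differentiable ℝ a := by fun_prop
  have hfa (z v : ℂ) : fderiv ℝ (fun z => φ (a z)) z v = r * fderiv ℝ φ (a z) v := by
    have h1 : HasFDerivAt a ((r : ℝ) • ContinuousLinearMap.id ℝ ℂ) z := by
      have := ((hasFDerivAt_id (𝕜 := ℝ) z).sub_const ((1 + Complex.I) / 2)).const_smul r
      exact this.congr_of_eventuallyEq (Eventually.of_forall fun w => by simp [a])
    have := (hφ.differentiableAt.hasFDerivAt (x := a z)).comp z h1
    have e : fderiv ℝ (fun z => φ (a z)) z = _ := this.fderiv
    rw [e]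
    simp
  have h := cauchyOp_comp_lattice (φ := fun z => φ (a z)) (hφ.comp had) Complex.I p
  have e1 : dbar (fun z => φ (a z)) (latticeMap Complex.I p) = r * dbar φ (squareMap r p) := by
    simp only [dbar, hfa]; simp only [a, squareMap]; ring
  have e2 : del (fun z => φ (a z)) (latticeMap Complex.I p) = r * del φ (squareMap r p) := by
    simp only [del, hfa]; simp only [a, squareMap]; ring
  rw [e1, e2, Complex.conj_I] at h
  simp only [Complex.I_im, Complex.ofReal_one, mul_one] at h
  refine ⟨h.1.trans (by ring), h.2.trans (by ring)⟩

theorem norm_squareMap_le {r : ℝ} (hr : 0 < r) {p : ℝ × ℝ}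
    (hp : p ∈ Ioc (0 : ℝ) 1 ×ˢ Ioc (0 : ℝ) 1) : ‖squareMap r p‖ ≤ r := by
  obtain ⟨⟨h1, h2⟩, h3, h4⟩ := hp
  refine (Complex.norm_le_abs_re_add_abs_im _).trans ?_
  rw [squareMap_re, squareMap_im, abs_mul, abs_mul, abs_of_pos hr]
  have a1 : |p.1 - 1 / 2| ≤ 1 / 2 := abs_le.2 ⟨by linarith, by linarith⟩
  have a2 : |p.2 - 1 / 2| ≤ 1 / 2 := abs_le.2 ⟨by linarith, by linarith⟩
  nlinarith

theorem norm_squareInv_sub_le {r : ℝ} (hr : 0 < r) {z : ℂ} (hz : ‖z‖ ≤ r / 4) :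
    squareInv r z ∈ Metric.closedBall ((1 / 2, 1 / 2) : ℝ × ℝ) (1 / 4) := by
  have h1 := (Complex.abs_re_le_norm z).trans hz
  have h2 := (Complex.abs_im_le_norm z).trans hz
  rw [Metric.mem_closedBall, Prod.dist_eq, Real.dist_eq, Real.dist_eq, max_le_iff]
  simp only [squareInv, add_sub_cancel_right, abs_div, abs_of_pos hr]
  constructor <;> rw [div_le_iff₀ hr] <;> linarith

theorem exists_cutoff_eq_one : ∃ η : ℝ × ℝ → ℂ, Cutoff η ∧
    (∀ p ∈ Metric.closedBall ((1 / 2, 1 / 2) : ℝ × ℝ) (1 / 4), η p = 1) := by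
  let b : ContDiffBump ((1 / 2, 1 / 2) : ℝ × ℝ) := ⟨1 / 4, 1 / 3, by norm_num, by norm_num⟩
  refine ⟨fun p => (b p : ℂ), ⟨Complex.ofRealCLM.contDiff.comp b.contDiff, ?_⟩, fun p hp => ?_⟩
  · have h1 : tsupport (fun p => (b p : ℂ)) ⊆ tsupport b := by
      refine closure_mono fun p hp => ?_
      simpa using hp
    refine h1.trans ?_
    rw [b.tsupport_eq]
    intro p hp
    rw [Metric.mem_closedBall, Prod.dist_eq, Real.dist_eq, Real.dist_eq, max_le_iff] at hp
    obtain ⟨h2, h3⟩ := hp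
    rw [abs_le] at h2 h3
    simp only [b] at h2 h3
    exact ⟨⟨by linarith [h2.1], by linarith [h2.2]⟩, ⟨by linarith [h3.1], by linarith [h3.2]⟩⟩
  · simp [b.one_of_mem_closedBall hp]

/-- Two smooth representatives agree on the smaller ball by continuity, so they glue to a global
one. -/
theorem exists_contDiff_of_ball {u : ℂ → ℂ} (h : ∀ n : ℕ, ∃ A : ℂ → ℂ, ContDiff ℝ ∞ A ∧
    ∀ᵐ z, z ∈ Metric.ball (0 : ℂ) (n + 1) → u z = A z) :
    ∃ A : ℂ → ℂ, ContDiff ℝ ∞ A ∧ u =ᵐ[volume] A := by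
  choose A hA hu using h
  have hle {n m : ℕ} (hnm : n ≤ m) : EqOn (A n) (A m) (Metric.ball (0 : ℂ) (n + 1)) := by
    refine Measure.eqOn_open_of_ae_eq (μ := volume) ?_ Metric.isOpen_ball
      (hA n).continuous.continuousOn (hA m).continuous.continuousOn
    rw [EventuallyEq, ae_restrict_iff' measurableSet_ball]
    filter_upwards [hu n, hu m] with z h1 h2 hz
    rw [← h1 hz, ← h2 (Metric.ball_subset_ball (by gcongr) hz)]
  have heq (n m : ℕ) {z : ℂ} (hn : z ∈ Metric.ball (0 : ℂ) (n + 1))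
      (hm : z ∈ Metric.ball (0 : ℂ) (m + 1)) : A n z = A m z := by
    rcases le_total n m with h | h
    · exact hle h hn
    · exact (hle h hm).symm
  have hmem (z : ℂ) : z ∈ Metric.ball (0 : ℂ) (⌈‖z‖⌉₊ + 1) := by
    rw [mem_ball_zero_iff]
    linarith [Nat.le_ceil ‖z‖]
  refine ⟨fun z => A ⌈‖z‖⌉₊ z, ?_, ?_⟩
  · rw [contDiff_iff_contDiffAt]
    intro z
    refine (hA ⌈‖z‖⌉₊).contDiffAt.congr_of_eventuallyEq ?_
    filter_upwards [Metric.isOpen_ball.mem_nhds (hmem z)] with x hx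
    exact heq _ _ (hmem x) hx
  · filter_upwards [ae_all_iff.2 hu] with z hz using hz _ (hmem z)

theorem integral_mul_fderiv_plane {A α : ℂ → ℂ} (hA : ContDiff ℝ ∞ A) (hα : ContDiff ℝ ∞ α)
    (hc : HasCompactSupport α) (v : ℂ) :
    ∫ z, A z * fderiv ℝ α z v = -∫ z, fderiv ℝ A z v * α z := by
  have hA' := contDiff_fderiv_apply hA v
  have hα' := contDiff_fderiv_apply hα v
  refine integral_mul_fderiv_eq_neg_fderiv_mul_of_integrable ?_ ?_ ?_
    (fun p _ => (hA.differentiable (by simp)).differentiableAt)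
    (fun p _ => (hα.differentiable (by simp)).differentiableAt)
  · exact (hA'.continuous.mul hα.continuous).integrable_of_hasCompactSupport hc.mul_left
  · exact (hA.continuous.mul hα'.continuous).integrable_of_hasCompactSupport
      (hc.fderiv_apply (𝕜 := ℝ) v).mul_left
  · exact (hA.continuous.mul hα.continuous).integrable_of_hasCompactSupport hc.mul_left

theorem integral_mul_dbar {A α : ℂ → ℂ} (hA : ContDiff ℝ ∞ A) (hα : ContDiff ℝ ∞ α)
    (hc : HasCompactSupport α) :
    ∫ z, A z * dbar α z = -∫ z, dbar A z * α z ∧ ∫ z, A z * del α z = -∫ z, del A z * α z := by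
  have i1 (v : ℂ) : Integrable fun z => A z * fderiv ℝ α z v :=
    (hA.continuous.mul (contDiff_fderiv_apply hα v).continuous).integrable_of_hasCompactSupport
      (hc.fderiv_apply (𝕜 := ℝ) v).mul_left
  have i2 (v : ℂ) : Integrable fun z => fderiv ℝ A z v * α z :=
    ((contDiff_fderiv_apply hA v).continuous.mul hα.continuous).integrable_of_hasCompactSupport
      hc.mul_left
  simp only [dbar, del, mul_add, mul_sub, add_mul, sub_mul, mul_left_comm _ Complex.I, mul_assoc]
  rw [integral_add (i1 _) ((i1 _).const_mul _), integral_sub (i1 _) ((i1 _).const_mul _),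
    integral_add (i2 _) ((i2 _).const_mul _), integral_sub (i2 _) ((i2 _).const_mul _),
    integral_const_mul, integral_const_mul, integral_mul_fderiv_plane hA hα hc,
    integral_mul_fderiv_plane hA hα hc]
  constructor <;> ring

theorem eq_of_forall_integral_mul {g h : ℂ → ℂ} (hg : Continuous g) (hh : Continuous h)
    (H : ∀ α : ℂ → ℂ, ContDiff ℝ ∞ α → HasCompactSupport α →
      ∫ z, g z * α z = ∫ z, h z * α z) : g = h := by
  have hae := ae_eq_zero_of_integral_contDiff_smul_eq_zero (μ := volume)
    (hg.sub hh).locallyIntegrable fun a ha hc => by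
    have hc' : HasCompactSupport fun z => (a z : ℂ) :=
      hc.comp_left (g := ((↑) : ℝ → ℂ)) Complex.ofReal_zero
    have ha' : ContDiff ℝ ∞ fun z => (a z : ℂ) := Complex.ofRealCLM.contDiff.comp ha
    have i1 : Integrable fun z => g z * a z :=
      (hg.mul ha'.continuous).integrable_of_hasCompactSupport hc'.mul_left
    have i2 : Integrable fun z => h z * a z :=
      (hh.mul ha'.continuous).integrable_of_hasCompactSupport hc'.mul_left
    have := H _ ha' hc'
    rw [← sub_eq_zero, ← integral_sub i1 i2] at this
    rw [← this]
    congr 1 with z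
    simp only [Pi.sub_apply, Complex.real_smul]
    ring
  refine Continuous.ae_eq_iff_eq volume hg hh |>.1 ?_
  filter_upwards [hae] with z hz
  exact sub_eq_zero.1 hz

/-- Interior regularity for the weak system `dbar u = G w`, `del w = H u` in the plane. -/
theorem exists_contDiff_of_weak {u w G H : ℂ → ℂ} (hG : ContDiff ℝ ∞ G) (hH : ContDiff ℝ ∞ H)
    (hu : ∀ r : ℝ, 0 < r → MemLp (fun p => u (squareMap r p)) 2 cell)
    (hw : ∀ r : ℝ, 0 < r → MemLp (fun p => w (squareMap r p)) 2 cell)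
    (h1 : ∀ α : ℂ → ℂ, ContDiff ℝ ∞ α → HasCompactSupport α →
      ∫ z, u z * dbar α z = -∫ z, G z * w z * α z)
    (h2 : ∀ α : ℂ → ℂ, ContDiff ℝ ∞ α → HasCompactSupport α →
      ∫ z, w z * del α z = -∫ z, H z * u z * α z) :
    ∃ A B : ℂ → ℂ, ContDiff ℝ ∞ A ∧ ContDiff ℝ ∞ B ∧ u =ᵐ[volume] A ∧ w =ᵐ[volume] B ∧
      (∀ z, dbar A z = G z * B z) ∧ ∀ z, del B z = H z * A z := by
  obtain ⟨χ, hχ, hχ1⟩ := exists_cutoff_eq_one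
  have hI : Complex.I.im ≠ 0 := by simp
  have hI' : (-Complex.I).im ≠ 0 := by simp
  have loc (r : ℝ) (hr : 0 < r) :
      (∃ A : ℂ → ℂ, ContDiff ℝ ∞ A ∧ ∀ᵐ z, z ∈ Metric.ball (0 : ℂ) (r / 4) → u z = A z) ∧
      ∃ A : ℂ → ℂ, ContDiff ℝ ∞ A ∧ ∀ᵐ z, z ∈ Metric.ball (0 : ℂ) (r / 4) → w z = A z := by
    have hrc : (r : ℂ) ≠ 0 := by exact_mod_cast hr.ne'
    have test {η : ℝ × ℝ → ℂ} (hη : Cutoff η) :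
        ContDiff ℝ ∞ (fun z => η (squareInv r z)) ∧
        HasCompactSupport (fun z => η (squareInv r z)) := by
      refine ⟨hη.smooth.comp (contDiff_squareInv r), ?_⟩
      refine HasCompactSupport.of_support_subset_isCompact
        (hη.hasCompactSupport.isCompact.image (contDiff_squareMap r).continuous) fun z hz => ?_
      exact ⟨squareInv r z, subset_tsupport _ hz, squareMap_squareInv hr.ne' z⟩
    have back (η : ℝ × ℝ → ℂ) : (fun p => (fun z => η (squareInv r z)) (squareMap r p)) = η := by
      ext p; simp only [squareInv_squareMap hr.ne']
    have trans {v : ℂ → ℂ} {η : ℝ × ℝ → ℂ} (hη : Cutoff η) :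
        ∫ z, v z * η (squareInv r z) = r ^ 2 * ∫ p, v (squareMap r p) * η p ∂cell := by
      rw [integral_comp_square hr.ne', Complex.real_smul, hη.integral_cell]
      simp only [squareInv_squareMap hr.ne']
      push_cast
      rfl
    have e1 (η : ℝ × ℝ → ℂ) (hη : Cutoff η) :
        ∫ p, u (squareMap r p) * cauchyOp Complex.I η p ∂cell =
        -∫ p, (-(Complex.I * r) * G (squareMap r p)) * w (squareMap r p) * η p ∂cell := by
      obtain ⟨t1, t2⟩ := test hη
      -- Rescaling to the unit square turns ∂̄ into ∂_t - i∂_s up to -ir, which accounts for the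
      -- coefficient in front of G.
      have hd : dbar (fun z => η (squareInv r z)) = fun z =>
          (Complex.I / r) * cauchyOp Complex.I η (squareInv r z) := by
        ext z
        have := (cauchyOp_comp_square (t1.differentiable (by simp)) r (squareInv r z)).1
        rw [back, squareMap_squareInv hr.ne'] at this
        rw [this]
        field_simp
        linear_combination (dbar (fun z => η (squareInv r z)) z) * Complex.I_sq
      have := h1 _ t1 t2
      have l : ∫ z, u z * (Complex.I / r * cauchyOp Complex.I η (squareInv r z)) =
          Complex.I / r * (r ^ 2 * ∫ p, u (squareMap r p) * cauchyOp Complex.I η p ∂cell) := by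
        rw [← trans (hη.cauchyOp _), ← integral_const_mul]
        congr 1 with z
        ring
      have l2 : ∫ p, (-(Complex.I * r) * G (squareMap r p)) * w (squareMap r p) * η p ∂cell =
          -(Complex.I * r) * ∫ p, G (squareMap r p) * w (squareMap r p) * η p ∂cell := by
        rw [← integral_const_mul]
        congr 1 with p
        ring
      rw [hd, l, trans (v := fun z => G z * w z) hη] at this
      rw [l2]
      generalize ∫ p, u (squareMap r p) * cauchyOp Complex.I η p ∂cell = X at this ⊢
      generalize ∫ p, G (squareMap r p) * w (squareMap r p) * η p ∂cell = K at this ⊢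
      field_simp at this
      linear_combination (-Complex.I) * this + X * Complex.I_sq
    have e2 (η : ℝ × ℝ → ℂ) (hη : Cutoff η) :
        ∫ p, w (squareMap r p) * cauchyOp (-Complex.I) η p ∂cell =
        -∫ p, ((Complex.I * r) * H (squareMap r p)) * u (squareMap r p) * η p ∂cell := by
      obtain ⟨t1, t2⟩ := test hη
      have hd : del (fun z => η (squareInv r z)) = fun z =>
          (-Complex.I / r) * cauchyOp (-Complex.I) η (squareInv r z) := by
        ext z
        have := (cauchyOp_comp_square (t1.differentiable (by simp)) r (squareInv r z)).2
        rw [back, squareMap_squareInv hr.ne'] at this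
        rw [this]
        field_simp
        linear_combination (del (fun z => η (squareInv r z)) z) * Complex.I_sq
      have := h2 _ t1 t2
      have l : ∫ z, w z * (-Complex.I / r * cauchyOp (-Complex.I) η (squareInv r z)) =
          -Complex.I / r * (r ^ 2 * ∫ p, w (squareMap r p) * cauchyOp (-Complex.I) η p ∂cell) := by
        rw [← trans (hη.cauchyOp _), ← integral_const_mul]
        congr 1 with z
        ring
      have l2 : ∫ p, ((Complex.I * r) * H (squareMap r p)) * u (squareMap r p) * η p ∂cell =
          (Complex.I * r) * ∫ p, H (squareMap r p) * u (squareMap r p) * η p ∂cell := by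
        rw [← integral_const_mul]
        congr 1 with p
        ring
      rw [hd, l, trans (v := fun z => H z * u z) hη] at this
      rw [l2]
      generalize ∫ p, w (squareMap r p) * cauchyOp (-Complex.I) η p ∂cell = X at this ⊢
      generalize ∫ p, H (squareMap r p) * u (squareMap r p) * η p ∂cell = K at this ⊢
      field_simp at this
      linear_combination Complex.I * this + X * Complex.I_sq
    have hsq := contDiff_squareMap r
    have fin {v : ℂ → ℂ} (h : ∃ U, Twisted U ∧ (fun p => χ p * v (squareMap r p)) =ᵐ[cell] U) :
        ∃ A : ℂ → ℂ, ContDiff ℝ ∞ A ∧ ∀ᵐ z, z ∈ Metric.ball (0 : ℂ) (r / 4) → v z = A z := by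
      obtain ⟨U, hU, hUe⟩ := h
      refine ⟨fun z => U (squareInv r z), hU.smooth.comp (contDiff_squareInv r), ?_⟩
      rw [ae_comp_square_iff hr.ne']
      rw [EventuallyEq, cell, ae_restrict_iff' (measurableSet_Ioc.prod measurableSet_Ioc)] at hUe
      filter_upwards [hUe] with p hp hz
      have h3 := norm_squareInv_sub_le hr (mem_ball_zero_iff.1 hz).le
      rw [squareInv_squareMap hr.ne'] at h3 ⊢
      have h4 : p ∈ Ioc (0 : ℝ) 1 ×ˢ Ioc (0 : ℝ) 1 := by
        rw [Metric.mem_closedBall, Prod.dist_eq, Real.dist_eq, Real.dist_eq, max_le_iff, abs_le,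
          abs_le] at h3
        obtain ⟨⟨a1, a2⟩, a3, a4⟩ := h3
        dsimp only at a1 a2 a3 a4
        exact ⟨⟨by linarith, by linarith⟩, ⟨by linarith, by linarith⟩⟩
      rw [← hp h4, hχ1 p h3, one_mul]
    have := Cutoff.exists_twisted_of_weak hI hI' (hu r hr) (hw r hr)
      (contDiff_const.mul (hG.comp hsq)) (contDiff_const.mul (hH.comp hsq)) e1 e2 hχ
    exact ⟨fin this.1, fin this.2⟩
  -- The cutoff equals one only on the ball of a quarter of the side length, so side 4(n + 1) covers
  -- radius n + 1.
  have loc' (n : ℕ) := loc (4 * (n + 1)) (by positivity)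
  simp only [mul_div_cancel_left₀ _ (four_ne_zero' ℝ)] at loc'
  obtain ⟨A, hA, hAu⟩ := exists_contDiff_of_ball fun n => (loc' n).1
  obtain ⟨B, hB, hBw⟩ := exists_contDiff_of_ball fun n => (loc' n).2
  refine ⟨A, B, hA, hB, hAu, hBw, ?_, ?_⟩
  · refine congrFun (eq_of_forall_integral_mul (contDiff_dbar hA).continuous
      (hG.continuous.mul hB.continuous) fun α hα hc => ?_)
    have h3 := h1 α hα hc
    have a1 : ∫ z, u z * dbar α z = ∫ z, A z * dbar α z :=
      integral_congr_ae (by filter_upwards [hAu] with z hz; rw [hz])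
    have a2 : ∫ z, G z * w z * α z = ∫ z, G z * B z * α z :=
      integral_congr_ae (by filter_upwards [hBw] with z hz; rw [hz])
    rw [a1, a2, (integral_mul_dbar hA hα hc).1] at h3
    exact neg_injective h3
  · refine congrFun (eq_of_forall_integral_mul (contDiff_del hB).continuous
      (hH.continuous.mul hA.continuous) fun α hα hc => ?_)
    have h3 := h2 α hα hc
    have a1 : ∫ z, w z * del α z = ∫ z, B z * del α z :=
      integral_congr_ae (by filter_upwards [hBw] with z hz; rw [hz])
    have a2 : ∫ z, H z * u z * α z = ∫ z, H z * A z * α z :=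
      integral_congr_ae (by filter_upwards [hAu] with z hz; rw [hz])
    rw [a1, a2, (integral_mul_dbar hB hα hc).2] at h3
    exact neg_injective h3

theorem integral_cell_comp_square_le {h : ℂ → ℝ} (hh : Continuous h) (h0 : ∀ z, 0 ≤ h z) {r : ℝ}
    (hr : 0 < r) : ∫ p, h (squareMap r p) ∂cell ≤
      (r ^ 2)⁻¹ * ∫ z in Metric.closedBall (0 : ℂ) r, h z := by
  have hm : MeasurableSet (Metric.closedBall (0 : ℂ) r) := Metric.isClosed_closedBall.measurableSet
  have hint : Integrable ((Metric.closedBall (0 : ℂ) r).indicator h) :=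
    (integrable_indicator_iff hm).2
      (hh.continuousOn.integrableOn_compact (isCompact_closedBall 0 r))
  rw [← integral_indicator hm, integral_comp_square hr.ne', smul_eq_mul,
    inv_mul_cancel_left₀ (by positivity), cell,
    ← integral_indicator (measurableSet_Ioc.prod measurableSet_Ioc)]
  have hint2 : Integrable fun p => (Metric.closedBall (0 : ℂ) r).indicator h (squareMap r p) := by
    refine ((measurableEmbedding_squareMap hr.ne').integrable_map_iff
      (g := (Metric.closedBall (0 : ℂ) r).indicator h) (μ := volume)).1 ?_
    rw [map_squareMap hr.ne']
    exact hint.smul_measure ENNReal.ofReal_ne_top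
  refine integral_mono_of_nonneg (Eventually.of_forall fun p => indicator_nonneg (fun _ _ => h0 _) _)
    hint2 (Eventually.of_forall fun p => ?_)
  simp only
  by_cases hp : p ∈ Ioc (0 : ℝ) 1 ×ˢ Ioc (0 : ℝ) 1
  · rw [indicator_of_mem hp, indicator_of_mem (by simpa using norm_squareMap_le hr hp)]
  · rw [indicator_of_notMem hp]
    exact indicator_nonneg (fun _ _ => h0 _) _

/-- Interior compactness in the plane. -/
theorem exists_subseq_cauchy_plane (x : ℕ → ℂ → ℂ) (hx : ∀ n, ContDiff ℝ ∞ (x n)) {M : ℝ}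
    (h1 : ∀ n, ∫ z in Metric.closedBall (0 : ℂ) 4, ‖x n z‖ ^ 2 ≤ M)
    (h2 : ∀ n, ∫ z in Metric.closedBall (0 : ℂ) 4, ‖dbar (x n) z‖ ^ 2 ≤ M) :
    ∃ g : ℕ → ℕ, StrictMono g ∧ ∀ ε > 0, ∃ N, ∀ n ≥ N, ∀ m ≥ N,
      ∫ z in Metric.closedBall (0 : ℂ) 1, ‖x (g n) z - x (g m) z‖ ^ 2 ≤ ε := by
  have h4 : (0 : ℝ) < 4 := by norm_num
  obtain ⟨χ, hχ, hχ1⟩ := exists_cutoff_eq_one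
  have hM : 0 ≤ M := (integral_nonneg fun z => by positivity).trans (h1 0)
  have b1 (n) : ∫ p, ‖x n (squareMap 4 p)‖ ^ 2 ∂cell ≤ M := by
    have h3 := integral_cell_comp_square_le (h := fun z => ‖x n z‖ ^ 2)
      ((hx n).continuous.norm.pow 2) (fun z => by positivity) h4
    have := h1 n
    linarith
  have b2 (n) : ∫ p, ‖cauchyOp Complex.I (fun p => x n (squareMap 4 p)) p‖ ^ 2 ∂cell ≤ M := by
    have e (p) : ‖cauchyOp Complex.I (fun p => x n (squareMap 4 p)) p‖ ^ 2 =
        16 * ‖dbar (x n) (squareMap 4 p)‖ ^ 2 := by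
      rw [(cauchyOp_comp_square ((hx n).differentiable (by simp)) 4 p).1, norm_mul, norm_neg,
        norm_mul, Complex.norm_I, Complex.norm_real, Real.norm_of_nonneg h4.le]
      ring
    simp only [e]
    rw [integral_const_mul]
    have h3 := integral_cell_comp_square_le (h := fun z => ‖dbar (x n) z‖ ^ 2)
      ((contDiff_dbar (hx n)).continuous.norm.pow 2) (fun z => by positivity) h4
    have := h2 n
    linarith
  obtain ⟨g, hg, hg2⟩ := Cutoff.exists_subseq_cauchy χ hχ (fun n p => x n (squareMap 4 p))
    (fun n => (hx n).comp (contDiff_squareMap 4)) (ζ := Complex.I) (by simp) b1 b2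
  refine ⟨g, hg, fun ε hε => ?_⟩
  obtain ⟨N, hN⟩ := hg2 (ε / 16) (by positivity)
  refine ⟨N, fun n hn m hm => ?_⟩
  have h5 := hN n hn m hm
  set d : ℂ → ℂ := fun z => x (g n) z - x (g m) z with hd
  have hdc : Continuous d := (hx _).continuous.sub (hx _).continuous
  have hmeas : MeasurableSet (Metric.closedBall (0 : ℂ) 1) := Metric.isClosed_closedBall.measurableSet
  -- The square has side 4, so 16 is its Jacobian, and the unit disc lies where the cutoff equals
  -- one.
  have h6 : ∫ z in Metric.closedBall (0 : ℂ) 1, ‖d z‖ ^ 2 ≤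
      16 * ∫ p, ‖χ p * d (squareMap 4 p)‖ ^ 2 ∂cell := by
    rw [← integral_indicator hmeas, integral_comp_square h4.ne', smul_eq_mul]
    have hc : Cutoff fun p => d (squareMap 4 p) * χ p :=
      hχ.mul_left (((hx _).sub (hx _)).comp (contDiff_squareMap 4))
    have e : ∫ p, ‖χ p * d (squareMap 4 p)‖ ^ 2 ∂cell = ∫ p, ‖χ p * d (squareMap 4 p)‖ ^ 2 := by
      refine setIntegral_eq_integral_of_forall_compl_eq_zero fun p hp => ?_
      rw [hχ.eq_zero fun h' => hp (prod_mono Ioo_subset_Ioc_self Ioo_subset_Ioc_self h')]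
      simp
    rw [e]
    have : (4 : ℝ) ^ 2 = 16 := by norm_num
    rw [this]
    refine mul_le_mul_of_nonneg_left ?_ (by norm_num)
    refine integral_mono_of_nonneg (Eventually.of_forall fun p =>
      indicator_nonneg (fun _ _ => by positivity) _) ?_ (Eventually.of_forall fun p => ?_)
    · refine ((hχ.continuous.mul (hdc.comp (contDiff_squareMap 4).continuous)).norm.pow 2
        |>.integrable_of_hasCompactSupport ?_)
      refine HasCompactSupport.of_support_subset_isCompact hχ.hasCompactSupport.isCompact
        fun p hp => subset_tsupport _ ?_
      contrapose! hp
      simp only [Function.mem_support, ne_eq, not_not] at hp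
      simp [hp]
    · simp only
      by_cases hz : squareMap 4 p ∈ Metric.closedBall (0 : ℂ) 1
      · have h7 := norm_squareInv_sub_le h4 (z := squareMap 4 p) (by
          rw [mem_closedBall_zero_iff] at hz; linarith)
        rw [squareInv_squareMap h4.ne'] at h7
        rw [indicator_of_mem hz, hχ1 p h7, one_mul]
      · rw [indicator_of_notMem hz]
        positivity
  linarith

/-! ## Inversion of the plane -/

/-- The change of variables z ↦ 1/z has real Jacobian |z|⁻⁴; the origin is a null set. -/
theorem integral_comp_inv {E : Type*} [NormedAddCommGroup E] [NormedSpace ℝ E] (g : ℂ → E) :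
    ∫ z, g z = ∫ z, (‖z‖ ^ 4)⁻¹ • g z⁻¹ := by
  have hr : (volume : Measure ℂ).restrict ({0} : Set ℂ)ᶜ = volume :=
    Measure.restrict_eq_self_of_ae_mem (by rw [ae_iff]; simp)
  have himg : (fun z : ℂ => z⁻¹) '' {0}ᶜ = {0}ᶜ := by
    ext z
    constructor
    · rintro ⟨w, hw, rfl⟩
      simpa using hw
    · intro hz
      exact ⟨z⁻¹, by simpa using hz, inv_inv z⟩
  set c : ℂ → ℂ := fun z => -(z ^ 2)⁻¹ with hcdef
  have hder (z : ℂ) (hz : z ∈ ({0}ᶜ : Set ℂ)) : HasFDerivWithinAt (fun z : ℂ => z⁻¹)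
      ((ContinuousLinearMap.toSpanSingleton ℂ (c z)).restrictScalars ℝ) {0}ᶜ z :=
    ((hasDerivAt_inv (by simpa using hz)).hasFDerivAt.restrictScalars ℝ).hasFDerivWithinAt
  have hdet (z : ℂ) : |((ContinuousLinearMap.toSpanSingleton ℂ (c z)).restrictScalars ℝ :
      ℂ →L[ℝ] ℂ).det| = (‖z‖ ^ 4)⁻¹ := by
    have e : (((ContinuousLinearMap.toSpanSingleton ℂ (c z)).restrictScalars ℝ : ℂ →L[ℝ] ℂ) :
        ℂ →ₗ[ℝ] ℂ) = Algebra.lmul ℝ ℂ (c z) := by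
      ext
      all_goals simp [mul_comm]
    rw [ContinuousLinearMap.det, e, ← Algebra.norm_apply, Algebra.norm_complex_apply,
      abs_of_nonneg (Complex.normSq_nonneg _), Complex.normSq_eq_norm_sq]
    simp only [c, norm_neg, norm_inv, norm_pow, inv_pow]
    ring
  have h := integral_image_eq_integral_abs_det_fderiv_smul (volume : Measure ℂ)
    (measurableSet_singleton (0 : ℂ)).compl hder inv_injective.injOn g
  rw [himg, hr] at h
  rw [h]
  congr 1 with z
  rw [hdet]

/-- The inner map is complex differentiable at the point, so its real derivative is multiplication
by c, and the antilinear part of the outer derivative picks up the conjugate. -/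
theorem dbar_comp {b h : ℂ → ℂ} {z c : ℂ} (hb : DifferentiableAt ℝ b (h z)) (hh : HasDerivAt h c z) :
    dbar (fun p => b (h p)) z = (starRingEnd ℂ) c * dbar b (h z) := by
  have h1 := hb.hasFDerivAt.comp z (hh.hasFDerivAt.restrictScalars ℝ)
  have e : fderiv ℝ (fun p => b (h p)) z = _ := h1.fderiv
  have key (v : ℂ) : fderiv ℝ (fun p => b (h p)) z v = fderiv ℝ b (h z) (v * c) := by
    rw [e]; simp
  have lin (v : ℂ) : fderiv ℝ b (h z) v =
      v.re * fderiv ℝ b (h z) 1 + v.im * fderiv ℝ b (h z) Complex.I := by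
    have : v = v.re • (1 : ℂ) + v.im • Complex.I := by apply Complex.ext <;> simp
    conv_lhs => rw [this]
    rw [map_add, map_smul, map_smul]
    simp
  have hcc : (starRingEnd ℂ) c = c.re - c.im * Complex.I := by apply Complex.ext <;> simp
  simp only [dbar]
  rw [key, key, lin (1 * c), lin (Complex.I * c), hcc]
  simp only [one_mul, Complex.mul_re, Complex.mul_im, Complex.I_re, Complex.I_im, zero_mul, zero_sub,
    zero_add]
  push_cast
  linear_combination (c.im * fderiv ℝ b (h z) Complex.I) * Complex.I_sq

theorem dbar_holo {h : ℂ → ℂ} {z c : ℂ} (hh : HasDerivAt h c z) : dbar h z = 0 := by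
  have := dbar_comp (b := fun w => w) (by fun_prop) hh
  rw [this]
  simp only [dbar, fderiv_fun_id, ContinuousLinearMap.coe_id', id_eq, Complex.I_mul_I]
  ring

/-! ## Densities on the sphere -/

/-- A continuous density on the sphere, in the two charts. -/
structure SphereDensity {E : Type*} [NormedAddCommGroup E] [NormedSpace ℝ E] (m₁ m₂ : ℂ → E) :
    Prop where
  cont₁ : Continuous m₁
  cont₂ : Continuous m₂
  compat : ∀ z, z ≠ 0 → m₁ z = (‖z‖ ^ 4)⁻¹ • m₂ z⁻¹

namespace SphereDensity

variable {E : Type*} [NormedAddCommGroup E] [NormedSpace ℝ E] {m₁ m₂ : ℂ → E}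

theorem integral_eq (h : SphereDensity m₁ m₂) : ∫ z, m₁ z = ∫ z, m₂ z := by
  rw [integral_comp_inv m₂]
  refine integral_congr_ae ?_
  have : ∀ᵐ z : ℂ, z ≠ 0 := by
    rw [ae_iff]; simp
  filter_upwards [this] with z hz using h.compat z hz

theorem exists_bound (h : SphereDensity m₁ m₂) :
    ∃ C, 0 < C ∧ (∀ z, ‖z‖ ≤ 1 → ‖m₁ z‖ ≤ C) ∧ ∀ z, 1 ≤ ‖z‖ → ‖m₁ z‖ ≤ C * (‖z‖ ^ 4)⁻¹ := by
  obtain ⟨C1, h1⟩ := (isCompact_closedBall (0 : ℂ) 1).exists_bound_of_continuousOn h.cont₁.continuousOn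
  obtain ⟨C2, h2⟩ := (isCompact_closedBall (0 : ℂ) 1).exists_bound_of_continuousOn h.cont₂.continuousOn
  refine ⟨max 1 (max C1 C2), by positivity, fun z hz => ?_, fun z hz => ?_⟩
  · exact (h1 z (by simpa using hz)).trans ((le_max_left _ _).trans (le_max_right _ _))
  · have hz0 : z ≠ 0 := norm_pos_iff.1 (one_pos.trans_le hz)
    rw [h.compat z hz0, norm_smul, norm_inv, norm_pow, norm_norm, mul_comm]
    refine mul_le_mul_of_nonneg_right ?_ (by positivity)
    refine (h2 _ ?_).trans ((le_max_right _ _).trans (le_max_right _ _))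
    rw [mem_closedBall_zero_iff, norm_inv]
    exact inv_le_one_of_one_le₀ hz

/-- A density continuous in both charts decays like |z|⁻⁴ at infinity, which is integrable in the
plane. -/
theorem integrable (h : SphereDensity m₁ m₂) : Integrable m₁ := by
  obtain ⟨C, hC, h1, h2⟩ := h.exists_bound
  have hi := integrable_rpow_neg_one_add_norm_sq (E := ℂ) (μ := volume) (r := 4)
    (by rw [Complex.finrank_real_complex]; norm_num)
  refine (hi.const_mul (4 * C)).mono' h.cont₁.aestronglyMeasurable (Eventually.of_forall fun z => ?_)
  have hp : 0 < 1 + ‖z‖ ^ 2 := by positivity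
  have e : (1 + ‖z‖ ^ 2) ^ (-4 / 2 : ℝ) = ((1 + ‖z‖ ^ 2) ^ 2)⁻¹ := by
    rw [show (-4 / 2 : ℝ) = -(2 : ℕ) by norm_num, Real.rpow_neg hp.le, Real.rpow_natCast]
  rw [e, ← div_eq_mul_inv, le_div_iff₀ (by positivity)]
  rcases le_total ‖z‖ 1 with hz | hz
  · have : (1 + ‖z‖ ^ 2) ^ 2 ≤ 4 := by nlinarith [norm_nonneg z, pow_le_one₀ (n := 2) (norm_nonneg z) hz]
    calc _ ≤ C * 4 := mul_le_mul (h1 z hz) this (by positivity) hC.le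
      _ = _ := mul_comm _ _
  · have h3 : (1 + ‖z‖ ^ 2) ^ 2 ≤ 4 * ‖z‖ ^ 4 := by nlinarith [one_le_pow₀ (n := 2) hz]
    have h4 : 0 < ‖z‖ ^ 4 := by positivity
    calc _ ≤ C * (‖z‖ ^ 4)⁻¹ * (4 * ‖z‖ ^ 4) := mul_le_mul (h2 z hz) h3 (by positivity) (by positivity)
      _ = _ := by field_simp

/-- The exterior of the unit disc in one chart is carried by inversion into the unit disc of the
other, so two discs account for the whole sphere. -/
theorem integral_le {m₁ m₂ : ℂ → ℝ} (h : SphereDensity m₁ m₂)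
    (h2 : ∀ z, 0 ≤ m₂ z) : ∫ z, m₁ z ≤
      (∫ z in Metric.closedBall (0 : ℂ) 1, m₁ z) + ∫ z in Metric.closedBall (0 : ℂ) 1, m₂ z := by
  have hm : MeasurableSet (Metric.closedBall (0 : ℂ) 1) := Metric.isClosed_closedBall.measurableSet
  have hcb : IsCompact (Metric.closedBall (0 : ℂ) 1) := isCompact_closedBall 0 1
  rw [← integral_add_compl hm h.integrable]
  gcongr
  rw [← integral_indicator hm.compl, ← integral_indicator hm,
    integral_comp_inv ((Metric.closedBall (0 : ℂ) 1).indicator m₂)]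
  have hd : Integrable fun z : ℂ => (‖z‖ ^ 4)⁻¹ • (Metric.closedBall (0 : ℂ) 1).indicator m₂ z⁻¹ := by
    refine h.integrable.indicator (hm.compl.union (Metric.isClosed_sphere (x := (0 : ℂ)) (ε := 1)).measurableSet)
      |>.congr ?_
    have : ∀ᵐ z : ℂ, z ≠ 0 := by
      rw [ae_iff]; simp
    filter_upwards [this] with z hz
    have hzp : 0 < ‖z‖ := norm_pos_iff.2 hz
    by_cases h1z : 1 ≤ ‖z‖
    · rw [indicator_of_mem, indicator_of_mem, h.compat z hz]
      · rw [mem_closedBall_zero_iff, norm_inv]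
        exact inv_le_one_of_one_le₀ h1z
      · rcases h1z.eq_or_lt with h' | h'
        · right; simp [← h']
        · left; simpa using h'
    · rw [indicator_of_notMem, indicator_of_notMem, smul_zero]
      · rw [mem_closedBall_zero_iff, norm_inv, not_le]
        exact (one_lt_inv₀ hzp).2 (not_le.1 h1z)
      · rintro (h' | h')
        · simp at h'; exact h1z h'.le
        · simp at h'; exact h1z h'.ge
  refine integral_mono_ae (h.integrable.indicator hm.compl) hd (Eventually.of_forall fun z => ?_)
  simp only
  by_cases hz : z ∈ Metric.closedBall (0 : ℂ) 1
  · rw [indicator_of_notMem (by simpa using hz)]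
    exact smul_nonneg (by positivity) (indicator_nonneg (fun _ _ => h2 _) _)
  · rw [indicator_of_mem (by simpa using hz)]
    rw [mem_closedBall_zero_iff, not_le] at hz
    have hz0 : z ≠ 0 := norm_pos_iff.1 (one_pos.trans hz)
    rw [indicator_of_mem, h.compat z hz0]
    rw [mem_closedBall_zero_iff, norm_inv]
    exact inv_le_one_of_one_le₀ hz.le

end SphereDensity

/-! ## Metrics and half-spinors on the sphere in the two charts -/

/-- A conformal metric on the sphere, in the two charts. -/
structure SphereMetric (f₁ f₂ : ℂ → ℝ) : Prop where
  smooth₁ : ContDiff ℝ ∞ f₁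
  smooth₂ : ContDiff ℝ ∞ f₂
  pos₁ : ∀ z, 0 < f₁ z
  pos₂ : ∀ z, 0 < f₂ z
  compat : ∀ z, z ≠ 0 → f₁ z = (‖z‖ ^ 2)⁻¹ * f₂ z⁻¹

/-- A rescaled spinor component on the sphere, in the two charts. -/
structure SphereSection (a b : ℂ → ℂ) : Prop where
  smooth₁ : ContDiff ℝ ∞ a
  smooth₂ : ContDiff ℝ ∞ b
  -- The spin transition i z̄/|z| = i|z|/z multiplied by the factor 1/|z| from the square root of
  -- the conformal factor. The result is holomorphic, so the rescaled components interact well with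
  -- ∂̄.
  compat : ∀ z, z ≠ 0 → a z = (Complex.I / z) * b z⁻¹

theorem SphereMetric.swap {f₁ f₂ : ℂ → ℝ} (h : SphereMetric f₁ f₂) : SphereMetric f₂ f₁ :=
  ⟨h.smooth₂, h.smooth₁, h.pos₂, h.pos₁, fun z hz => by
    have hn : ‖z‖ ≠ 0 := norm_ne_zero_iff.2 hz
    rw [h.compat z⁻¹ (inv_ne_zero hz), inv_inv, norm_inv]
    field_simp⟩

namespace SphereSection

variable {a b a' b' : ℂ → ℂ} {f₁ f₂ : ℂ → ℝ}

/-- The sign is forced: two successive changes of chart multiply by (i/z)(iz) = -1. -/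
theorem swap (h : SphereSection a b) : SphereSection b (fun z => -a z) :=
  ⟨h.smooth₂, h.smooth₁.neg, fun z hz => by
    rw [h.compat z⁻¹ (inv_ne_zero hz), inv_inv]
    field_simp
    rw [Complex.I_sq]
    ring⟩

/-- The factor i/z is holomorphic and passes through ∂̄; the chain rule contributes the conjugate
derivative of the inversion. -/
theorem dbar_compat (h : SphereSection a b) {z : ℂ} (hz : z ≠ 0) :
    dbar a z = -(Complex.I / z) * ((starRingEnd ℂ) z ^ 2)⁻¹ * dbar b z⁻¹ := by
  have h1 : HasDerivAt (fun w : ℂ => w⁻¹) (-(z ^ 2)⁻¹) z := hasDerivAt_inv hz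
  have h2 := h1.const_mul Complex.I
  have hb : DifferentiableAt ℝ b z⁻¹ := (h.smooth₂.differentiable (by simp)).differentiableAt
  have hinv : DifferentiableAt ℝ (fun w : ℂ => w⁻¹) z := h1.differentiableAt.restrictScalars ℝ
  have hbi : DifferentiableAt ℝ (fun w : ℂ => b w⁻¹) z := hb.comp z hinv
  have e : a =ᶠ[𝓝 z] fun w => (Complex.I * w⁻¹) * b w⁻¹ := by
    filter_upwards [isOpen_ne.mem_nhds hz] with w hw
    rw [h.compat w hw, div_eq_mul_inv]
  have e2 : dbar a z = dbar (fun w => (Complex.I * w⁻¹) * b w⁻¹) z := by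
    simp only [dbar, e.fderiv_eq]
  rw [e2, dbar_mul (hinv.const_mul _) hbi, dbar_holo h2, dbar_comp hb h1]
  simp only [map_neg, map_inv₀, map_pow]
  ring

theorem massDensity (h : SphereSection a b) (h' : SphereSection a' b') (hf : SphereMetric f₁ f₂) :
    SphereDensity (fun z => (f₁ z : ℂ) * (a z * (starRingEnd ℂ) (a' z)))
      (fun z => (f₂ z : ℂ) * (b z * (starRingEnd ℂ) (b' z))) where
  cont₁ := (Complex.continuous_ofReal.comp hf.smooth₁.continuous).mul
    (h.smooth₁.continuous.mul (Complex.continuous_conj.comp h'.smooth₁.continuous))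
  cont₂ := (Complex.continuous_ofReal.comp hf.smooth₂.continuous).mul
    (h.smooth₂.continuous.mul (Complex.continuous_conj.comp h'.smooth₂.continuous))
  compat z hz := by
    have hn : (‖z‖ : ℂ) ≠ 0 := by simpa using hz
    have hcz : (starRingEnd ℂ) z ≠ 0 := by simpa using hz
    rw [hf.compat z hz, h.compat z hz, h'.compat z hz, Complex.real_smul]
    push_cast
    simp only [map_mul, map_div₀, Complex.conj_I]
    have := Complex.mul_conj' z
    field_simp
    rw [← this]
    linear_combination (-(z * (starRingEnd ℂ) z) * f₂ (1 / z) * b (1 / z) *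
      (starRingEnd ℂ) (b' (1 / z))) * Complex.I_sq

theorem energyDensity (h : SphereSection a b) (h' : SphereSection a' b')
    (hf : SphereMetric f₁ f₂) :
    SphereDensity (fun z => ((f₁ z)⁻¹ : ℂ) * (dbar a z * (starRingEnd ℂ) (dbar a' z)))
      (fun z => ((f₂ z)⁻¹ : ℂ) * (dbar b z * (starRingEnd ℂ) (dbar b' z))) where
  cont₁ := (contDiff_inv_ofReal hf.smooth₁ hf.pos₁).continuous.mul
    ((contDiff_dbar h.smooth₁).continuous.mul
      (Complex.continuous_conj.comp (contDiff_dbar h'.smooth₁).continuous))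
  cont₂ := (contDiff_inv_ofReal hf.smooth₂ hf.pos₂).continuous.mul
    ((contDiff_dbar h.smooth₂).continuous.mul
      (Complex.continuous_conj.comp (contDiff_dbar h'.smooth₂).continuous))
  compat z hz := by
    have hn : (‖z‖ : ℂ) ≠ 0 := by simpa using hz
    have hcz : (starRingEnd ℂ) z ≠ 0 := by simpa using hz
    have hf0 : (f₂ z⁻¹ : ℂ) ≠ 0 := by exact_mod_cast (hf.pos₂ _).ne'
    rw [hf.compat z hz, h.dbar_compat hz, h'.dbar_compat hz, Complex.real_smul]
    push_cast
    simp only [map_mul, map_div₀, Complex.conj_I, map_neg, map_inv₀, map_pow, Complex.conj_conj]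
    have := Complex.mul_conj' z
    field_simp
    have h6 : (‖z‖ : ℂ) ^ 6 = (z * (starRingEnd ℂ) z) ^ 3 := by rw [this]; ring
    rw [Complex.I_sq]
    linear_combination (dbar b (1 / z) * (starRingEnd ℂ) (dbar b' (1 / z)) *
      (f₂ (1 / z) : ℂ)⁻¹) * h6

end SphereSection

theorem SphereMetric.areaDensity {f₁ f₂ : ℂ → ℝ} (hf : SphereMetric f₁ f₂) :
    SphereDensity (fun z => f₁ z ^ 2) (fun z => f₂ z ^ 2) where
  cont₁ := hf.smooth₁.continuous.pow 2
  cont₂ := hf.smooth₂.continuous.pow 2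
  compat z hz := by rw [hf.compat z hz, smul_eq_mul]; ring

/-- The normed version of `SphereSection.massDensity`. -/
theorem SphereSection.massDensity_norm {a b : ℂ → ℂ} {f₁ f₂ : ℂ → ℝ} (h : SphereSection a b)
    (hf : SphereMetric f₁ f₂) :
    SphereDensity (fun z => f₁ z * ‖a z‖ ^ 2) (fun z => f₂ z * ‖b z‖ ^ 2) where
  cont₁ := hf.smooth₁.continuous.mul (h.smooth₁.continuous.norm.pow 2)
  cont₂ := hf.smooth₂.continuous.mul (h.smooth₂.continuous.norm.pow 2)
  compat z hz := by
    rw [hf.compat z hz, h.compat z hz, smul_eq_mul, norm_mul, norm_div, Complex.norm_I]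
    ring

theorem SphereSection.energyDensity_norm {a b : ℂ → ℂ} {f₁ f₂ : ℂ → ℝ} (h : SphereSection a b)
    (hf : SphereMetric f₁ f₂) :
    SphereDensity (fun z => (f₁ z)⁻¹ * ‖dbar a z‖ ^ 2) (fun z => (f₂ z)⁻¹ * ‖dbar b z‖ ^ 2) where
  cont₁ := (hf.smooth₁.continuous.inv₀ fun z => (hf.pos₁ z).ne').mul
    ((contDiff_dbar h.smooth₁).continuous.norm.pow 2)
  cont₂ := (hf.smooth₂.continuous.inv₀ fun z => (hf.pos₂ z).ne').mul
    ((contDiff_dbar h.smooth₂).continuous.norm.pow 2)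
  compat z hz := by
    have hn : ‖z‖ ≠ 0 := norm_ne_zero_iff.2 hz
    have := (hf.pos₂ z⁻¹).ne'
    rw [hf.compat z hz, h.dbar_compat hz, smul_eq_mul]
    simp only [norm_mul, norm_neg, norm_div, Complex.norm_I, norm_inv, norm_pow, RCLike.norm_conj]
    field_simp

/-! ## Minimizers on the sphere -/

theorem dbar_add {φ χ : ℂ → ℂ} {z : ℂ} (h : DifferentiableAt ℝ φ z) (h' : DifferentiableAt ℝ χ z) :
    dbar (fun p => φ p + χ p) z = dbar φ z + dbar χ z := by
  simp only [dbar, fderiv_fun_add h h', add_apply]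
  ring

theorem dbar_const_mul (c : ℂ) {φ : ℂ → ℂ} {z : ℂ} (h : DifferentiableAt ℝ φ z) :
    dbar (fun p => c * φ p) z = c * dbar φ z := by
  simp only [dbar, fderiv_const_mul h, smul_apply, smul_eq_mul]
  ring

/-- A smooth section with compact support in one chart. -/
theorem sphereSection_of_hasCompactSupport {α : ℂ → ℂ} (hα : ContDiff ℝ ∞ α)
    (hc : HasCompactSupport α) : SphereSection α fun w => -(Complex.I / w) * α w⁻¹ := by
  refine ⟨hα, ?_, fun z hz => ?_⟩
  · obtain ⟨R, hR⟩ := hc.isCompact.isBounded.exists_norm_le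
    rw [contDiff_iff_contDiffAt]
    intro w
    by_cases hw : w = 0
    · have : (fun w => -(Complex.I / w) * α w⁻¹) =ᶠ[𝓝 w] fun _ => 0 := by
        have hR' : 0 < (|R| + 1)⁻¹ := by positivity
        -- Compact support in one chart means vanishing near the origin of the other, at radius
        -- 1/(|R| + 1).
        filter_upwards [Metric.ball_mem_nhds w hR'] with v hv
        rw [hw, mem_ball_zero_iff] at hv
        by_cases hv0 : v = 0
        · simp [hv0]
        suffices h : α v⁻¹ = 0 by rw [h, mul_zero]
        refine image_eq_zero_of_notMem_tsupport fun h' => ?_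
        have h1 := hR _ h'
        rw [norm_inv] at h1
        have h2 : |R| + 1 < ‖v‖⁻¹ := (lt_inv_comm₀ (norm_pos_iff.2 hv0) (by positivity)).1 hv
        linarith [le_abs_self R]
      exact contDiffAt_const.congr_of_eventuallyEq this
    · have hi : ContDiffAt ℝ ∞ (fun v : ℂ => v⁻¹) w := contDiffAt_inv ℝ hw
      have : ContDiffAt ℝ ∞ (fun v => (-Complex.I * v⁻¹) * α v⁻¹) w :=
        (contDiffAt_const.mul hi).mul (hα.contDiffAt.comp w hi)
      refine this.congr_of_eventuallyEq (Eventually.of_forall fun v => ?_)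
      simp only [div_eq_mul_inv]
      ring
  · rw [inv_inv]
    field_simp
    rw [Complex.I_sq]
    ring

/-- Smooth rescaled spinor components on the sphere. -/
def sphereSpace : Submodule ℂ ((ℂ → ℂ) × (ℂ → ℂ)) where
  carrier := {x | SphereSection x.1 x.2}
  add_mem' {x y} (h : SphereSection x.1 x.2) (h' : SphereSection y.1 y.2) :=
    ⟨h.smooth₁.add h'.smooth₁, h.smooth₂.add h'.smooth₂, fun z hz => by
      simp [h.compat z hz, h'.compat z hz]; ring⟩
  zero_mem' := ⟨contDiff_const, contDiff_const, fun z hz => by simp⟩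
  smul_mem' c x (h : SphereSection x.1 x.2) :=
    ⟨contDiff_const.mul h.smooth₁, contDiff_const.mul h.smooth₂, fun z hz => by
      simp [h.compat z hz]; ring⟩

theorem sphereSpace_section (x : sphereSpace) : SphereSection x.1.1 x.1.2 := x.2

/-- Exchanging the two charts. -/
def sphereSwap : sphereSpace →ₗ[ℂ] sphereSpace where
  toFun x := ⟨(x.1.2, fun z => -x.1.1 z), (sphereSpace_section x).swap⟩
  map_add' x y := by
    ext z
    · rfl
    · simp; ring
  map_smul' c x := by
    ext z
    · rfl
    · simp

theorem inner_toL2_toL2 {α V : Type*} [MeasurableSpace α] {μ : Measure α} [AddCommGroup V]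
    [Module ℂ V] (T : V →ₗ[ℂ] (α → ℂ)) (h : ∀ v, MemLp (T v) 2 μ) (v w : V) :
    inner ℂ (toL2 T h v) (toL2 T h w) = ∫ x, T w x * (starRingEnd ℂ) (T v x) ∂μ :=
  inner_toLp_toLp (h v) (h w)

namespace SphereMetric

variable {f₁ f₂ : ℂ → ℝ}

theorem memLp_of_density {m : ℂ → ℂ} (hm : Continuous m) (h : Integrable fun z => ‖m z‖ ^ 2) :
    MemLp m 2 volume :=
  (memLp_two_iff_integrable_sq_norm hm.aestronglyMeasurable).2 h

theorem sqrt_ne_zero (hf : SphereMetric f₁ f₂) (z : ℂ) : (√(f₁ z) : ℂ) ≠ 0 := by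
  exact_mod_cast (Real.sqrt_pos.2 (hf.pos₁ z)).ne'

theorem ofReal_eq (hf : SphereMetric f₁ f₂) (z : ℂ) : (f₁ z : ℂ) = (√(f₁ z) : ℂ) ^ 2 := by
  rw [← Complex.ofReal_pow, Real.sq_sqrt (hf.pos₁ z).le]

theorem continuous_sqrt (hf : SphereMetric f₁ f₂) : Continuous fun z => (√(f₁ z) : ℂ) :=
  (contDiff_sqrt_ofReal hf.smooth₁ hf.pos₁).continuous

theorem continuous_sqrt_inv (hf : SphereMetric f₁ f₂) : Continuous fun z => (√(f₁ z) : ℂ)⁻¹ :=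
  hf.continuous_sqrt.inv₀ hf.sqrt_ne_zero

theorem norm_sqrt_mul_sq (hf : SphereMetric f₁ f₂) (z w : ℂ) :
    ‖(√(f₁ z) : ℂ) * w‖ ^ 2 = f₁ z * ‖w‖ ^ 2 := by
  rw [norm_mul, mul_pow, Complex.norm_real, Real.norm_eq_abs, sq_abs, Real.sq_sqrt (hf.pos₁ z).le]

theorem norm_sqrt_inv_mul_sq (hf : SphereMetric f₁ f₂) (z w : ℂ) :
    ‖(√(f₁ z) : ℂ)⁻¹ * w‖ ^ 2 = (f₁ z)⁻¹ * ‖w‖ ^ 2 := by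
  rw [norm_mul, mul_pow, norm_inv, Complex.norm_real, Real.norm_eq_abs, inv_pow, sq_abs,
    Real.sq_sqrt (hf.pos₁ z).le]

/-- `√f a` in `L²`. -/
def massMap (hf : SphereMetric f₁ f₂) : sphereSpace →ₗ[ℂ] Lp ℂ 2 (volume : Measure ℂ) :=
  toL2 (V := sphereSpace)
    { toFun := fun x z => (√(f₁ z) : ℂ) * x.1.1 z
      map_add' := fun x y => by ext z; simp; ring
      map_smul' := fun c x => by ext z; simp; ring }
    fun x => memLp_of_density (hf.continuous_sqrt.mul (sphereSpace_section x).smooth₁.continuous) (by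
      simp only [LinearMap.coe_mk, AddHom.coe_mk, hf.norm_sqrt_mul_sq]
      exact ((sphereSpace_section x).massDensity_norm hf).integrable)

/-- `√f⁻¹ dbar a` in `L²`. -/
def energyMap (hf : SphereMetric f₁ f₂) : sphereSpace →ₗ[ℂ] Lp ℂ 2 (volume : Measure ℂ) :=
  toL2 (V := sphereSpace)
    { toFun := fun x z => (√(f₁ z) : ℂ)⁻¹ * dbar x.1.1 z
      map_add' := fun x y => by
        ext z
        have := dbar_add (((sphereSpace_section x).smooth₁.differentiable (by simp)).differentiableAt (x := z))
          (((sphereSpace_section y).smooth₁.differentiable (by simp)).differentiableAt (x := z))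
        simp only [Pi.add_apply, ← mul_add, ← this]
        rfl
      map_smul' := fun c x => by
        ext z
        have := dbar_const_mul c
          (((sphereSpace_section x).smooth₁.differentiable (by simp)).differentiableAt (x := z))
        simp only [Pi.smul_apply, smul_eq_mul, RingHom.id_apply, mul_left_comm c, ← this]
        rfl }
    fun x => memLp_of_density
      (hf.continuous_sqrt_inv.mul (contDiff_dbar (sphereSpace_section x).smooth₁).continuous) (by
        simp only [LinearMap.coe_mk, AddHom.coe_mk, hf.norm_sqrt_inv_mul_sq]
        exact ((sphereSpace_section x).energyDensity_norm hf).integrable)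

theorem norm_sq_massMap (hf : SphereMetric f₁ f₂) (x : sphereSpace) :
    ‖hf.massMap x‖ ^ 2 = ∫ z, f₁ z * ‖x.1.1 z‖ ^ 2 := by
  rw [massMap, norm_sq_toL2]
  simp only [LinearMap.coe_mk, AddHom.coe_mk, hf.norm_sqrt_mul_sq]

theorem norm_sq_energyMap (hf : SphereMetric f₁ f₂) (x : sphereSpace) :
    ‖hf.energyMap x‖ ^ 2 = ∫ z, (f₁ z)⁻¹ * ‖dbar x.1.1 z‖ ^ 2 := by
  rw [energyMap, norm_sq_toL2]
  simp only [LinearMap.coe_mk, AddHom.coe_mk, hf.norm_sqrt_inv_mul_sq]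

/-- The mass form is the integral of a density, so it can be computed in either chart, and the
exchange of charts is an isometry. The same holds for the energy form. -/
theorem inner_massMap_swap (hf : SphereMetric f₁ f₂) (x y : sphereSpace) :
    inner ℂ (hf.swap.massMap (sphereSwap x)) (hf.swap.massMap (sphereSwap y)) =
      inner ℂ (hf.massMap x) (hf.massMap y) := by
  have h := ((sphereSpace_section y).massDensity (sphereSpace_section x) hf).integral_eq
  rw [massMap, massMap, inner_toL2_toL2, inner_toL2_toL2]
  refine Eq.trans ?_ (h.symm.trans ?_)
  · congr 1 with z
    simp only [LinearMap.coe_mk, AddHom.coe_mk, sphereSwap, map_mul, Complex.conj_ofReal]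
    rw [hf.swap.ofReal_eq]
    ring
  · congr 1 with z
    simp only [LinearMap.coe_mk, AddHom.coe_mk, map_mul, Complex.conj_ofReal]
    rw [hf.ofReal_eq]
    ring

theorem inner_energyMap_swap (hf : SphereMetric f₁ f₂) (x y : sphereSpace) :
    inner ℂ (hf.swap.energyMap (sphereSwap x)) (hf.swap.energyMap (sphereSwap y)) =
      inner ℂ (hf.energyMap x) (hf.energyMap y) := by
  have h := ((sphereSpace_section y).energyDensity (sphereSpace_section x) hf).integral_eq
  rw [energyMap, energyMap, inner_toL2_toL2, inner_toL2_toL2]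
  refine Eq.trans ?_ (h.symm.trans ?_)
  · congr 1 with z
    simp only [LinearMap.coe_mk, AddHom.coe_mk, sphereSwap, map_mul, Complex.conj_ofReal, map_inv₀]
    rw [hf.swap.ofReal_eq]
    ring
  · congr 1 with z
    simp only [LinearMap.coe_mk, AddHom.coe_mk, map_mul, Complex.conj_ofReal, map_inv₀]
    rw [hf.ofReal_eq]
    ring

theorem norm_massMap_swap (hf : SphereMetric f₁ f₂) (x : sphereSpace) :
    ‖hf.swap.massMap (sphereSwap x)‖ = ‖hf.massMap x‖ := by
  have h := hf.inner_massMap_swap x x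
  rw [inner_self_eq_norm_sq_to_K, inner_self_eq_norm_sq_to_K] at h
  have h2 : ‖hf.swap.massMap (sphereSwap x)‖ ^ 2 = ‖hf.massMap x‖ ^ 2 := by exact_mod_cast h
  exact (pow_left_inj₀ (norm_nonneg _) (norm_nonneg _) two_ne_zero).1 h2

theorem norm_energyMap_swap (hf : SphereMetric f₁ f₂) (x : sphereSpace) :
    ‖hf.swap.energyMap (sphereSwap x)‖ = ‖hf.energyMap x‖ := by
  have h := hf.inner_energyMap_swap x x
  rw [inner_self_eq_norm_sq_to_K, inner_self_eq_norm_sq_to_K] at h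
  have h2 : ‖hf.swap.energyMap (sphereSwap x)‖ ^ 2 = ‖hf.energyMap x‖ ^ 2 := by exact_mod_cast h
  exact (pow_left_inj₀ (norm_nonneg _) (norm_nonneg _) two_ne_zero).1 h2

/-- On the closed disc of radius 4 the conformal factor and its inverse are bounded, so weighted
bounds give plain ones, and interior compactness yields convergence on the unit disc. -/
theorem exists_subseq_cauchy_chart (hf : SphereMetric f₁ f₂) (a : ℕ → sphereSpace) {M : ℝ}
    (h1 : ∀ n, ‖hf.massMap (a n)‖ ≤ 1) (h2 : ∀ n, ‖hf.energyMap (a n)‖ ^ 2 ≤ M) :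
    ∃ g : ℕ → ℕ, StrictMono g ∧ ∀ ε > 0, ∃ N, ∀ n ≥ N, ∀ m ≥ N,
      ∫ z in Metric.closedBall (0 : ℂ) 1, f₁ z * ‖(a (g n) - a (g m)).1.1 z‖ ^ 2 ≤ ε := by
  have hci : Continuous fun z => (f₁ z)⁻¹ := hf.smooth₁.continuous.inv₀ fun z => (hf.pos₁ z).ne'
  have hm : MeasurableSet (Metric.closedBall (0 : ℂ) 4) := Metric.isClosed_closedBall.measurableSet
  have hm1 : MeasurableSet (Metric.closedBall (0 : ℂ) 1) := Metric.isClosed_closedBall.measurableSet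
  obtain ⟨C1, hC1⟩ := (isCompact_closedBall (0 : ℂ) 4).exists_bound_of_continuousOn
    hf.smooth₁.continuous.continuousOn
  obtain ⟨C2, hC2⟩ := (isCompact_closedBall (0 : ℂ) 4).exists_bound_of_continuousOn hci.continuousOn
  set C := max 1 (max C1 C2) with hC
  have hCpos : 0 < C := by positivity
  have b1 (z) (hz : z ∈ Metric.closedBall (0 : ℂ) 4) : f₁ z ≤ C :=
    (le_abs_self _).trans ((hC1 z hz).trans ((le_max_left _ _).trans (le_max_right _ _)))
  have b2 (z) (hz : z ∈ Metric.closedBall (0 : ℂ) 4) : (f₁ z)⁻¹ ≤ C :=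
    (le_abs_self _).trans ((hC2 z hz).trans ((le_max_right _ _).trans (le_max_right _ _)))
  have local_le {g h : ℂ → ℝ} (hg : Continuous g) (hh : Integrable h) (hh0 : ∀ z, 0 ≤ h z)
      (hgh : ∀ z ∈ Metric.closedBall (0 : ℂ) 4, g z ≤ C * h z) :
      ∫ z in Metric.closedBall (0 : ℂ) 4, g z ≤ C * ∫ z, h z := by
    rw [← integral_const_mul]
    refine le_trans (setIntegral_mono_on (hg.continuousOn.integrableOn_compact
      (isCompact_closedBall 0 4)) (hh.const_mul C).integrableOn hm hgh)
      (setIntegral_le_integral (hh.const_mul C) (Eventually.of_forall fun z => ?_))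
    exact mul_nonneg hCpos.le (hh0 z)
  have s (n) := sphereSpace_section (a n)
  have k1 (n) : ∫ z in Metric.closedBall (0 : ℂ) 4, ‖(a n).1.1 z‖ ^ 2 ≤ C * max 1 M := by
    refine (local_le (g := fun z => ‖(a n).1.1 z‖ ^ 2) ((s n).smooth₁.continuous.norm.pow 2) ((s n).massDensity_norm hf).integrable
      (fun z => mul_nonneg (hf.pos₁ z).le (by positivity)) fun z hz => ?_).trans
      (mul_le_mul_of_nonneg_left ?_ hCpos.le)
    · have := hf.pos₁ z
      rw [← mul_assoc]
      refine le_mul_of_one_le_left (by positivity) ?_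
      have := b2 z hz
      rwa [inv_le_iff_one_le_mul₀ (hf.pos₁ z)] at this
    · rw [← norm_sq_massMap]
      exact (pow_le_one₀ (norm_nonneg _) (h1 n)).trans (le_max_left _ _)
  have k2 (n) : ∫ z in Metric.closedBall (0 : ℂ) 4, ‖dbar (a n).1.1 z‖ ^ 2 ≤ C * max 1 M := by
    refine (local_le (g := fun z => ‖dbar (a n).1.1 z‖ ^ 2) ((contDiff_dbar (s n).smooth₁).continuous.norm.pow 2)
      ((s n).energyDensity_norm hf).integrable
      (fun z => mul_nonneg (inv_nonneg.2 (hf.pos₁ z).le) (by positivity)) fun z hz => ?_).trans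
      (mul_le_mul_of_nonneg_left ?_ hCpos.le)
    · have := hf.pos₁ z
      rw [← mul_assoc, ← div_eq_mul_inv]
      exact le_mul_of_one_le_left (by positivity) ((one_le_div this).2 (b1 z hz))
    · rw [← norm_sq_energyMap]
      exact (h2 n).trans (le_max_right _ _)
  obtain ⟨g, hg, hcau⟩ := exists_subseq_cauchy_plane (fun n => (a n).1.1) (fun n => (s n).smooth₁) k1 k2
  refine ⟨g, hg, fun ε hε => ?_⟩
  obtain ⟨N, hN⟩ := hcau (ε / C) (by positivity)
  refine ⟨N, fun n hn m hm => ?_⟩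
  have h3 := hN n hn m hm
  have hcd : Continuous fun z => (a (g n)).1.1 z - (a (g m)).1.1 z :=
    (s _).smooth₁.continuous.sub (s _).smooth₁.continuous
  have i1 : IntegrableOn (fun z => f₁ z * ‖(a (g n)).1.1 z - (a (g m)).1.1 z‖ ^ 2)
      (Metric.closedBall (0 : ℂ) 1) :=
    (hf.smooth₁.continuous.mul (hcd.norm.pow 2)).continuousOn.integrableOn_compact
      (isCompact_closedBall 0 1)
  have i2 : IntegrableOn (fun z => ‖(a (g n)).1.1 z - (a (g m)).1.1 z‖ ^ 2)
      (Metric.closedBall (0 : ℂ) 1) :=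
    (hcd.norm.pow 2).continuousOn.integrableOn_compact (isCompact_closedBall 0 1)
  calc _ = ∫ z in Metric.closedBall (0 : ℂ) 1, f₁ z * ‖(a (g n)).1.1 z - (a (g m)).1.1 z‖ ^ 2 := rfl
    _ ≤ ∫ z in Metric.closedBall (0 : ℂ) 1, C * ‖(a (g n)).1.1 z - (a (g m)).1.1 z‖ ^ 2 := by
      refine setIntegral_mono_on i1 (i2.const_mul C) hm1 fun z hz => ?_
      exact mul_le_mul_of_nonneg_right (b1 z (Metric.closedBall_subset_closedBall (by norm_num) hz))
        (by positivity)
    _ ≤ C * (ε / C) := by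
      rw [integral_const_mul]
      exact mul_le_mul_of_nonneg_left h3 hCpos.le
    _ = ε := by field_simp

/-- A further subsequence converges on the unit disc of the second chart too, and the two discs
cover the sphere. -/
theorem precompact (hf : SphereMetric f₁ f₂) (a : ℕ → sphereSpace) (M : ℝ)
    (h1 : ∀ n, ‖hf.massMap (a n)‖ ≤ 1) (h2 : ∀ n, ‖hf.energyMap (a n)‖ ^ 2 ≤ M) :
    ∃ g : ℕ → ℕ, StrictMono g ∧ CauchySeq fun n => hf.massMap (a (g n)) := by
  obtain ⟨g, hg, hc⟩ := hf.exists_subseq_cauchy_chart a h1 h2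
  obtain ⟨g', hg', hc'⟩ := hf.swap.exists_subseq_cauchy_chart (fun n => sphereSwap (a (g n)))
    (M := M) (fun n => by rw [hf.norm_massMap_swap]; exact h1 _)
    (fun n => by rw [hf.norm_energyMap_swap]; exact h2 _)
  refine ⟨fun n => g (g' n), hg.comp hg', Metric.cauchySeq_iff.2 fun ε hε => ?_⟩
  obtain ⟨N, hN⟩ := hc (ε ^ 2 / 4) (by positivity)
  obtain ⟨N', hN'⟩ := hc' (ε ^ 2 / 4) (by positivity)
  refine ⟨max N N', fun n hn m hm => ?_⟩
  rw [dist_eq_norm, ← map_sub]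
  refine lt_of_pow_lt_pow_left₀ 2 hε.le ?_
  rw [norm_sq_massMap]
  have h3 := hN (g' n) ((le_max_left _ _).trans (hn.trans (hg'.id_le n))) (g' m)
    ((le_max_left _ _).trans (hm.trans (hg'.id_le m)))
  have h4 := hN' n ((le_max_right _ _).trans hn) m ((le_max_right _ _).trans hm)
  rw [← map_sub] at h4
  have h5 := ((sphereSpace_section (a (g (g' n)) - a (g (g' m)))).massDensity_norm hf).integral_le
    (fun z => mul_nonneg (hf.pos₂ z).le (by positivity))
  have h6 : ∫ z in Metric.closedBall (0 : ℂ) 1,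
      f₂ z * ‖(sphereSwap (a (g (g' n)) - a (g (g' m)))).1.1 z‖ ^ 2 =
      ∫ z in Metric.closedBall (0 : ℂ) 1, f₂ z * ‖(a (g (g' n)) - a (g (g' m))).1.2 z‖ ^ 2 := rfl
  rw [h6] at h4
  nlinarith [show 0 < ε ^ 2 by positivity]

/-- A limit of a minimizing sequence is smooth in a chart and solves the eigenvalue equation. -/
theorem exists_chartEigen_of_limit (hf : SphereMetric f₁ f₂) {μ : ℝ} {x : ℕ → sphereSpace}
    {u w : Lp ℂ 2 (volume : Measure ℂ)} (hu : Tendsto (fun n => hf.massMap (x n)) atTop (𝓝 u))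
    (hw : Tendsto (fun n => hf.energyMap (x n)) atTop (𝓝 w))
    (hEL : ∀ v, inner ℂ (hf.energyMap v) w = μ * inner ℂ (hf.massMap v) u) :
    ∃ A : ℂ → ℂ, ContDiff ℝ ∞ A ∧ u =ᵐ[volume] (fun z => (√(f₁ z) : ℂ) * A z) ∧
      ChartEigen f₁ A μ := by
  have hs := hf.continuous_sqrt
  have hsi := hf.continuous_sqrt_inv
  have hs0 := hf.sqrt_ne_zero
  have mem (v : Lp ℂ 2 (volume : Measure ℂ)) (r : ℝ) (hr : 0 < r) :
      MemLp (fun p => (√(f₁ (squareMap r p)) : ℂ)⁻¹ * v (squareMap r p)) 2 cell :=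
    memLp_bounded_mul (F := fun p => (√(f₁ (squareMap r p)) : ℂ)⁻¹)
      (hsi.comp (contDiff_squareMap r).continuous)
      ((MemLp.comp_squareMap hr.ne' (Lp.memLp v)).restrict _)
  -- The weak equation ∂̄u = f w for the unweighted limits: integration by parts along the sequence,
  -- then a limit in both inner products.
  have e1 (α : ℂ → ℂ) (hα : ContDiff ℝ ∞ α) (hc : HasCompactSupport α) :
      ∫ z, ((√(f₁ z) : ℂ)⁻¹ * u z) * dbar α z =
        -∫ z, (f₁ z : ℂ) * ((√(f₁ z) : ℂ)⁻¹ * w z) * α z := by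
    have hcd : HasCompactSupport (dbar α) :=
      (hc.fderiv_apply (𝕜 := ℝ) 1).add
        ((hc.fderiv_apply (𝕜 := ℝ) Complex.I).mul_left (f := fun _ => Complex.I))
    have m1 : MemLp (fun z => (√(f₁ z) : ℂ)⁻¹ * (starRingEnd ℂ) (dbar α z)) 2 volume := by
      refine Continuous.memLp_of_hasCompactSupport (hsi.mul
        (Complex.continuous_conj.comp (contDiff_dbar hα).continuous)) ?_
      exact HasCompactSupport.mul_left (hcd.comp_left (map_zero _))
    have m2 : MemLp (fun z => (√(f₁ z) : ℂ) * (starRingEnd ℂ) (α z)) 2 volume := by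
      refine Continuous.memLp_of_hasCompactSupport (hs.mul
        (Complex.continuous_conj.comp hα.continuous)) ?_
      exact HasCompactSupport.mul_left (hc.comp_left (map_zero _))
    have l1 := (tendsto_const_nhds (x := m1.toLp)).inner (𝕜 := ℂ) hu
    have l2 := ((tendsto_const_nhds (x := m2.toLp)).inner (𝕜 := ℂ) hw).neg
    have heq := tendsto_nhds_unique l1 (l2.congr fun n => ?_)
    · rw [inner_toLp, inner_toLp] at heq
      convert heq using 2
      · ext z; simp only [map_mul, map_inv₀, Complex.conj_ofReal, Complex.conj_conj]; ring
      · congr 1 with z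
        simp only [map_mul, Complex.conj_ofReal, Complex.conj_conj]
        rw [hf.ofReal_eq]
        have := hs0 z
        field_simp
    · rw [massMap, energyMap, inner_toLp_toL2, inner_toLp_toL2]
      have := (integral_mul_dbar (sphereSpace_section (x n)).smooth₁ hα hc).1
      refine Eq.trans ?_ (this.symm.trans ?_)
      · congr 2 with z
        simp only [LinearMap.coe_mk, AddHom.coe_mk, map_mul, Complex.conj_ofReal, Complex.conj_conj]
        have := hs0 z
        field_simp
      · congr 1 with z
        simp only [LinearMap.coe_mk, AddHom.coe_mk, map_mul, Complex.conj_ofReal, Complex.conj_conj,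
          map_inv₀]
        have := hs0 z
        field_simp
  have e2 (α : ℂ → ℂ) (hα : ContDiff ℝ ∞ α) (hc : HasCompactSupport α) :
      ∫ z, ((√(f₁ z) : ℂ)⁻¹ * w z) * del α z =
        -∫ z, (-μ * (f₁ z : ℂ)) * ((√(f₁ z) : ℂ)⁻¹ * u z) * α z := by
    -- The Euler-Lagrange equation is tested on the section obtained from the conjugate of α by
    -- extension by zero.
    have hα' : ContDiff ℝ ∞ fun z => (starRingEnd ℂ) (α z) := Complex.conjCLE.contDiff.comp hα
    have hS := sphereSection_of_hasCompactSupport hα' (hc.comp_left (map_zero _))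
    have := hEL ⟨(_, _), hS⟩
    rw [massMap, energyMap, inner_toL2_left, inner_toL2_left] at this
    simp only [LinearMap.coe_mk, AddHom.coe_mk] at this
    refine Eq.trans ?_ (this.trans ?_)
    · congr 1 with z
      rw [dbar_conj, map_mul, map_inv₀, Complex.conj_ofReal, Complex.conj_conj]
      ring
    · rw [← integral_const_mul, ← integral_neg]
      congr 1 with z
      rw [map_mul, Complex.conj_ofReal, Complex.conj_conj, hf.ofReal_eq]
      have := hs0 z
      field_simp
  have hfc : ContDiff ℝ ∞ fun z => (f₁ z : ℂ) := Complex.ofRealCLM.contDiff.comp hf.smooth₁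
  obtain ⟨A, B, hA, hB, huA, -, d1, d2⟩ := exists_contDiff_of_weak hfc
    (H := fun z => -μ * (f₁ z : ℂ)) (contDiff_const.mul hfc) (mem u) (mem w) e1 e2
  refine ⟨A, hA, ?_, fun z => ?_⟩
  · filter_upwards [huA] with z hz
    rw [← hz, mul_inv_cancel_left₀ (hs0 z)]
  · have : (fun p => (f₁ p : ℂ)⁻¹ * dbar A p) = B := by
      ext p
      have : (f₁ p : ℂ) ≠ 0 := by exact_mod_cast (hf.pos₁ p).ne'
      rw [d1, inv_mul_cancel_left₀ this]
    rw [this, d2, mul_assoc]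

/-- The Rayleigh quotient on the sphere has a smooth minimizer, which solves the eigenvalue
equation. -/
theorem exists_chartEigen (hf : SphereMetric f₁ f₂) :
    ∃ (μ : ℝ) (A B : ℂ → ℂ), SphereSection A B ∧ A ≠ 0 ∧ ChartEigen f₁ A μ ∧ ChartEigen f₂ B μ := by
  have hne : ∃ v, hf.massMap v ≠ 0 := by
    let b : ContDiffBump (0 : ℂ) := ⟨1, 2, one_pos, one_lt_two⟩
    have hb : ContDiff ℝ ∞ fun z => (b z : ℂ) := Complex.ofRealCLM.contDiff.comp b.contDiff
    have hc : HasCompactSupport fun z => (b z : ℂ) :=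
      b.hasCompactSupport.comp_left (g := ((↑) : ℝ → ℂ)) Complex.ofReal_zero
    refine ⟨⟨(_, _), sphereSection_of_hasCompactSupport hb hc⟩, fun h0 => ?_⟩
    have h1 := hf.norm_sq_massMap ⟨(_, _), sphereSection_of_hasCompactSupport hb hc⟩
    rw [h0, norm_zero, zero_pow two_ne_zero] at h1
    have hcont : Continuous fun z => f₁ z * ‖(b z : ℂ)‖ ^ 2 :=
      hf.smooth₁.continuous.mul (hb.continuous.norm.pow 2)
    have h2 := hcont.integral_pos_of_hasCompactSupport_nonneg_nonzero (μ := volume)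
      (hc.norm.comp_left (g := fun t : ℝ => t ^ 2) (by simp)).mul_left
      (fun z => mul_nonneg (hf.pos₁ z).le (by positivity)) (x := 0) (by
        rw [b.one_of_mem_closedBall (by simp [b.rIn_pos.le])]
        simpa using (hf.pos₁ 0).ne')
    exact h2.ne h1
  obtain ⟨μ, -, x, u, w, hu, hw, hu1, hEL⟩ :=
    exists_minimizing_sequence hf.massMap hf.energyMap hf.precompact hne
  -- The same minimizing sequence converges in the second chart, and since every section is an
  -- exchange of another the limits satisfy the same Euler-Lagrange equation. Regularity is then
  -- applied in each chart.
  have cau1 : CauchySeq fun n => hf.swap.massMap (sphereSwap (x n)) := by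
    refine Metric.cauchySeq_iff.2 fun ε hε => ?_
    obtain ⟨N, hN⟩ := Metric.cauchySeq_iff.1 hu.cauchySeq ε hε
    refine ⟨N, fun n hn m hm => ?_⟩
    have := hN n hn m hm
    rw [dist_eq_norm, ← map_sub] at this ⊢
    rwa [← map_sub, hf.norm_massMap_swap]
  have cau2 : CauchySeq fun n => hf.swap.energyMap (sphereSwap (x n)) := by
    refine Metric.cauchySeq_iff.2 fun ε hε => ?_
    obtain ⟨N, hN⟩ := Metric.cauchySeq_iff.1 hw.cauchySeq ε hε
    refine ⟨N, fun n hn m hm => ?_⟩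
    have := hN n hn m hm
    rw [dist_eq_norm, ← map_sub] at this ⊢
    rwa [← map_sub, hf.norm_energyMap_swap]
  obtain ⟨u', hu'⟩ := cauchySeq_tendsto_of_complete cau1
  obtain ⟨w', hw'⟩ := cauchySeq_tendsto_of_complete cau2
  have im (v) : inner ℂ (hf.swap.massMap (sphereSwap v)) u' = inner ℂ (hf.massMap v) u :=
    tendsto_nhds_unique (tendsto_const_nhds.inner hu')
      ((tendsto_const_nhds.inner hu).congr fun n => (hf.inner_massMap_swap v (x n)).symm)
  have ie (v) : inner ℂ (hf.swap.energyMap (sphereSwap v)) w' = inner ℂ (hf.energyMap v) w :=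
    tendsto_nhds_unique (tendsto_const_nhds.inner hw')
      ((tendsto_const_nhds.inner hw).congr fun n => (hf.inner_energyMap_swap v (x n)).symm)
  have swap_swap (v : sphereSpace) : sphereSwap (sphereSwap v) = -v := by
    ext z <;> simp [sphereSwap]
  have hEL' (v) : inner ℂ (hf.swap.energyMap v) w' = μ * inner ℂ (hf.swap.massMap v) u' := by
    have h1 : v = sphereSwap (-sphereSwap v) := by rw [map_neg, swap_swap, neg_neg]
    rw [h1, im, ie]
    exact hEL _
  obtain ⟨A, hA, huA, eA⟩ := hf.exists_chartEigen_of_limit hu hw hEL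
  obtain ⟨B, hB, huB, eB⟩ := hf.swap.exists_chartEigen_of_limit hu' hw' hEL'
  refine ⟨μ, A, B, ⟨hA, hB, ?_⟩, ?_, eA, eB⟩
  -- The smooth limits A and B were found separately. That they form one section is checked by
  -- pairing with test functions supported away from the origin, where both charts compute the same
  -- inner product.
  · set h : ℂ → ℂ := fun z => f₁ z * (A z - (Complex.I / z) * B z⁻¹) with hh
    have hcont : ContinuousOn h {0}ᶜ := by
      intro z hz
      have hz : z ≠ 0 := by simpa using hz
      have hi : ContinuousAt (fun z : ℂ => z⁻¹) z := continuousAt_inv₀ hz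
      refine ContinuousAt.continuousWithinAt ?_
      exact (Complex.continuous_ofReal.comp hf.smooth₁.continuous).continuousAt.mul
        (hA.continuous.continuousAt.sub ((continuousAt_const.div continuousAt_id hz).mul
          (ContinuousAt.comp (f := fun z : ℂ => z⁻¹) hB.continuous.continuousAt hi)))
    have hopen : IsOpen ({0}ᶜ : Set ℂ) := isOpen_compl_singleton
    have hae := hopen.ae_eq_zero_of_integral_contDiff_smul_eq_zero (μ := volume) (f := h)
      (hcont.locallyIntegrableOn hopen.measurableSet) fun α hα hc hsupp => by
      have hα' : ContDiff ℝ ∞ fun z => (α z : ℂ) := Complex.ofRealCLM.contDiff.comp hα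
      have hc' : HasCompactSupport fun z => (α z : ℂ) :=
        hc.comp_left (g := ((↑) : ℝ → ℂ)) Complex.ofReal_zero
      have h1 : ∫ z, u' z * (starRingEnd ℂ) ((√(f₂ z) : ℂ) * (-(Complex.I / z) * α z⁻¹)) =
          ∫ z, u z * (starRingEnd ℂ) ((√(f₁ z) : ℂ) * α z) := by
        have := im ⟨(_, _), sphereSection_of_hasCompactSupport hα' hc'⟩
        rw [massMap, massMap, inner_toL2_left, inner_toL2_left] at this
        exact this
      have r1 : ∫ z, u z * (starRingEnd ℂ) ((√(f₁ z) : ℂ) * α z) = ∫ z, f₁ z * A z * α z := by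
        refine integral_congr_ae ?_
        filter_upwards [huA] with z hz
        rw [hz, map_mul, Complex.conj_ofReal, Complex.conj_ofReal, hf.ofReal_eq]
        ring
      have r2 : ∫ z, u' z * (starRingEnd ℂ) ((√(f₂ z) : ℂ) * (-(Complex.I / z) * α z⁻¹)) =
          ∫ z, f₁ z * ((Complex.I / z) * B z⁻¹) * α z := by
        rw [integral_congr_ae (g := fun z => f₂ z * B z * ((starRingEnd ℂ) (-(Complex.I / z)) * α z⁻¹))
          (by
            filter_upwards [huB] with z hz
            rw [hz, map_mul, Complex.conj_ofReal, map_mul, Complex.conj_ofReal, hf.swap.ofReal_eq]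
            ring), integral_comp_inv]
        congr 1 with z
        by_cases hz : z = 0
        · simp [hz]
        have hcz : (starRingEnd ℂ) z ≠ 0 := by simpa using hz
        have hn : (‖z‖ : ℂ) ≠ 0 := by simpa using hz
        have hzz := Complex.mul_conj' z
        rw [hf.compat z hz, Complex.real_smul, inv_inv]
        push_cast
        simp only [map_neg, map_div₀, Complex.conj_I, map_inv₀]
        field_simp
        rw [← hzz]
        ring
      rw [r1, r2] at h1
      have hsub : Function.support (fun z => (f₁ z : ℂ) * ((Complex.I / z) * B z⁻¹) * α z) ⊆ tsupport α :=
        fun z hz => subset_tsupport _ (by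
          contrapose! hz
          simp only [Function.mem_support, ne_eq, not_not] at hz ⊢
          simp [hz])
      have i2 : Integrable fun z => (f₁ z : ℂ) * ((Complex.I / z) * B z⁻¹) * α z := by
        rw [← integrableOn_iff_integrable_of_support_subset hsub]
        refine ContinuousOn.integrableOn_compact hc.isCompact ?_
        intro z hz
        have hz : z ≠ 0 := by simpa using hsupp hz
        have hi : ContinuousAt (fun z : ℂ => z⁻¹) z := continuousAt_inv₀ hz
        refine ContinuousAt.continuousWithinAt ?_
        exact ((Complex.continuous_ofReal.comp hf.smooth₁.continuous).continuousAt.mul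
          ((continuousAt_const.div continuousAt_id hz).mul
          (ContinuousAt.comp (f := fun z : ℂ => z⁻¹) hB.continuous.continuousAt hi))).mul
            hα'.continuous.continuousAt
      have i1 : Integrable fun z => (f₁ z : ℂ) * A z * α z :=
        (((Complex.continuous_ofReal.comp hf.smooth₁.continuous).mul hA.continuous).mul
          hα'.continuous).integrable_of_hasCompactSupport hc'.mul_left
      rw [eq_comm, ← sub_eq_zero, ← integral_sub i1 i2] at h1
      rw [← h1]
      congr 1 with z
      simp only [h, Complex.real_smul]
      ring
    have heq : EqOn h (fun _ => 0) {0}ᶜ := by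
      refine Measure.eqOn_open_of_ae_eq (μ := volume) ?_ hopen hcont continuousOn_const
      rw [EventuallyEq, ae_restrict_iff' hopen.measurableSet]
      exact hae
    intro z hz
    have h1 := heq (show z ∈ ({0}ᶜ : Set ℂ) by simpa using hz)
    have hf0 : (f₁ z : ℂ) ≠ 0 := by exact_mod_cast (hf.pos₁ z).ne'
    simp only [h, mul_eq_zero, hf0, false_or] at h1
    exact sub_eq_zero.1 h1
  · rintro rfl
    have h1 := norm_sq_L2 u
    have h2 : ∫ z, ‖u z‖ ^ 2 = 0 := by
      refine integral_eq_zero_of_ae ?_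
      filter_upwards [huA] with z hz
      simp [hz]
    rw [hu1, h2] at h1
    norm_num at h1

end SphereMetric

/-! ## The Dirac spectrum of the sphere -/

section Sphere

variable {f : Bool → ℂ → ℝ}

theorem sphereMetric_of_isMetric (hf : sphere.IsMetric f) : SphereMetric (f true) (f false) :=
  ⟨hf.smooth _, hf.smooth _, hf.pos _, hf.pos _, fun z hz => by
    have := hf.compat () z (by simpa [sphere] using hz)
    simp only [sphere, deriv_inv, norm_neg, norm_inv, norm_pow] at this
    rw [this, mul_comm]⟩

theorem sphere_area (f : Bool → ℂ → ℝ) : sphere.area f = ∫ z, f true z ^ 2 := by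
  simp [SpinAtlas.area, sphere]

theorem sphere_exists_isMetric : ∃ f, sphere.IsMetric f := by
  refine ⟨fun _ z => 2 / (1 + ‖z‖ ^ 2), fun _ => ?_, fun _ z => by positivity, ?_⟩
  · exact contDiff_const.div (contDiff_const.add (contDiff_id.norm_sq ℝ)) fun z =>
      (by positivity : (0 : ℝ) < 1 + ‖z‖ ^ 2).ne'
  · intro j z hz
    have hz : z ≠ 0 := by simpa [sphere] using hz
    have hn : ‖z‖ ≠ 0 := norm_ne_zero_iff.2 hz
    simp only [sphere, deriv_inv, norm_neg, norm_inv, norm_pow]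
    field_simp
    ring

theorem sqrt_conformal (hf : sphere.IsMetric f) {z : ℂ} (hz : z ≠ 0) :
    (√(f true z) : ℂ) = (‖z‖ : ℂ)⁻¹ * (√(f false z⁻¹) : ℂ) := by
  rw [(sphereMetric_of_isMetric hf).compat z hz, Real.sqrt_mul (by positivity), Real.sqrt_inv,
    Real.sqrt_sq (norm_nonneg z)]
  push_cast
  rfl

theorem conj_div_norm {z : ℂ} (hz : z ≠ 0) :
    (starRingEnd ℂ) z / (‖z‖ : ℂ) = (‖z‖ : ℂ) / z := by
  have hn : (‖z‖ : ℂ) ≠ 0 := by simpa using hz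
  rw [div_eq_div_iff hn hz, mul_comm, Complex.mul_conj']
  ring

/-- Only the nonemptiness of the spectrum is used later: the infimum of the empty set of reals is
zero and would spoil a lower bound for the first eigenvalue. -/
theorem sphere_exists_eigenvalue (hf : sphere.IsMetric f) :
    ∃ μ, sphere.IsDiracSqEigenvalue f μ := by
  have hm := sphereMetric_of_isMetric hf
  obtain ⟨μ, A, B, hS, hA, eA, eB⟩ := hm.exists_chartEigen
  have dA := dirac_of_chartEigen hm.smooth₁ hm.pos₁ hS.smooth₁ eA
  have dB := dirac_of_chartEigen hm.smooth₂ hm.pos₂ hS.smooth₂ eB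
  refine ⟨μ, fun i p => ![(√(f i p) : ℂ)⁻¹ * (if i then A p else B p), 0], ⟨?_, ?_⟩, ⟨true, ?_⟩, ?_⟩
  · rintro (_ | _)
    · exact dB.1
    · exact dA.1
  · intro j z hz
    have hz : z ≠ 0 := by simpa [sphere] using hz
    have hn : (‖z‖ : ℂ) ≠ 0 := by simpa using hz
    have hr : (√(f false z⁻¹) : ℂ) ≠ 0 := hm.swap.sqrt_ne_zero _
    have hcz := conj_div_norm hz
    simp only [sphere]
    rw [mul_div_assoc, hcz]
    ext i
    fin_cases i
    · simp only [Fin.zero_eta, Matrix.cons_val_zero, Matrix.mulVec, dotProduct, Fin.sum_univ_two,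
        Matrix.of_apply, Matrix.cons_val', Matrix.cons_val_one, Matrix.cons_val_fin_one, mul_zero,
        if_true, Bool.false_eq_true, if_false, add_zero]
      rw [sqrt_conformal hf hz, hS.compat z hz]
      field_simp
    · simp [Matrix.mulVec, dotProduct, Fin.sum_univ_two]
  · intro h0
    apply hA
    ext p
    have := congrFun (congrFun h0 p) 0
    have hr := hm.sqrt_ne_zero p
    simpa [hr] using this
  · rintro (_ | _)
    · exact dB.2
    · exact dA.2

theorem eq_zero_of_sphereSection {a b : ℂ → ℂ} (h : SphereSection a b) (ha : a = 0) : b = 0 := by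
  have h1 : b =ᵐ[volume] 0 := by
    have : ∀ᵐ z : ℂ, z ≠ 0 := by
      rw [ae_iff]; simp
    filter_upwards [this] with z hz
    have := h.swap.compat z hz
    rw [ha] at this
    simpa using this
  exact (Continuous.ae_eq_iff_eq volume h.smooth₂.continuous continuous_const).1 h1

theorem exists_section_of_eigenvalue (hf : sphere.IsMetric f) {μ : ℝ}
    (h : sphere.IsDiracSqEigenvalue f μ) :
    ∃ a b, SphereSection a b ∧ a ≠ 0 ∧ ChartEigen (f true) a μ := by
  have hm := sphereMetric_of_isMetric hf
  obtain ⟨ψ, hψ, ⟨i, hi⟩, he⟩ := h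
  have hs (i) := contDiff_sqrt_ofReal (hf.smooth i) (hf.pos i)
  have hc (z : ℂ) (hz : z ≠ 0) : ψ true z 0 = Complex.I * (‖z‖ / z) * ψ false z⁻¹ 0 ∧
      (starRingEnd ℂ) (ψ true z 1) = Complex.I * (‖z‖ / z) * (starRingEnd ℂ) (ψ false z⁻¹ 1) := by
    have := hψ.compat () z (by simpa [sphere] using hz)
    simp only [sphere] at this
    rw [mul_div_assoc, conj_div_norm hz] at this
    have h0 := congrFun this 0
    have h1 := congrArg (starRingEnd ℂ) (congrFun this 1)
    simp only [Matrix.mulVec, dotProduct, Fin.sum_univ_two, Matrix.of_apply, Matrix.cons_val',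
      Matrix.cons_val_zero, Matrix.cons_val_one, Matrix.cons_val_fin_one, zero_mul, zero_add,
      add_zero, map_mul, Complex.conj_conj] at h0 h1
    exact ⟨h0, by simpa using h1⟩
  have s1 : SphereSection (fun p => (√(f true p) : ℂ) * ψ true p 0)
      (fun p => (√(f false p) : ℂ) * ψ false p 0) :=
    ⟨(hs _).mul (contDiff_pi.1 (hψ.smooth _) 0), (hs _).mul (contDiff_pi.1 (hψ.smooth _) 0),
      fun z hz => by
        have hn : (‖z‖ : ℂ) ≠ 0 := by simpa using hz
        rw [sqrt_conformal hf hz, (hc z hz).1]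
        field_simp⟩
  have s2 : SphereSection (fun p => (starRingEnd ℂ) ((√(f true p) : ℂ) * ψ true p 1))
      (fun p => (starRingEnd ℂ) ((√(f false p) : ℂ) * ψ false p 1)) :=
    ⟨Complex.conjCLE.contDiff.comp ((hs _).mul (contDiff_pi.1 (hψ.smooth _) 1)),
      Complex.conjCLE.contDiff.comp ((hs _).mul (contDiff_pi.1 (hψ.smooth _) 1)),
      fun z hz => by
        have hn : (‖z‖ : ℂ) ≠ 0 := by simpa using hz
        rw [map_mul, map_mul, (hc z hz).2, sqrt_conformal hf hz]
        simp only [map_mul, map_inv₀, Complex.conj_ofReal]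
        field_simp⟩
  obtain ⟨c1, c2⟩ := chartEigen_of_dirac (hf.smooth true) (hf.pos true) (hψ.smooth true) (he true)
  by_contra hcon
  push Not at hcon
  have z1 : (fun p => (√(f true p) : ℂ) * ψ true p 0) = 0 := by
    by_contra h
    exact hcon _ _ s1 h c1
  have z2 : (fun p => (starRingEnd ℂ) ((√(f true p) : ℂ) * ψ true p 1)) = 0 := by
    by_contra h
    exact hcon _ _ s2 h c2
  -- A section that vanishes in the chart `true` vanishes in the other chart by continuity at its
  -- origin, so a nonzero spinor cannot hide at infinity.
  have z1' := eq_zero_of_sphereSection s1 z1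
  have z2' := eq_zero_of_sphereSection s2 z2
  apply hi
  have hr (i z) : (√(f i z) : ℂ) ≠ 0 := by exact_mod_cast (Real.sqrt_pos.2 (hf.pos i z)).ne'
  ext z j
  cases i <;> fin_cases j
  · simpa [hr] using congrFun z1' z
  · simpa [hr] using congrFun z2' z
  · simpa [hr] using congrFun z1 z
  · simpa [hr] using congrFun z2 z

end Sphere

/-! ## The spectral gap inequality of a torus, for compactly supported functions in the plane -/

/-- The parametrization of a large copy of the fundamental parallelogram, with center `0`, by the
unit square. -/
def cellMap (ζ : ℂ) (r : ℝ) (p : ℝ × ℝ) : ℂ := r * (latticeMap ζ p - (1 + ζ) / 2)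

theorem contDiff_cellMap (ζ : ℂ) (r : ℝ) : ContDiff ℝ ∞ (cellMap ζ r) :=
  contDiff_const.mul ((latticeMap ζ).contDiff.sub contDiff_const)

theorem integral_comp_cellMap {ζ : ℂ} (hζ : 0 < ζ.im) {r : ℝ} (hr : r ≠ 0) (m : ℂ → ℝ) :
    ∫ p, m (cellMap ζ r p) = (r ^ 2 * ζ.im)⁻¹ * ∫ z, m z := by
  have h1 := integral_comp_lattice hζ fun z => m (r * (z - (1 + ζ) / 2))
  have h2 : ∫ z : ℂ, m (r * (z - (1 + ζ) / 2)) = (r ^ 2)⁻¹ * ∫ z, m z := by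
    rw [integral_sub_right_eq_self (fun z : ℂ => m (r * z))]
    have := Measure.integral_comp_smul (volume : Measure ℂ) m r
    simp only [Complex.real_smul, Complex.finrank_real_complex, smul_eq_mul] at this
    rw [this, abs_of_nonneg (by positivity)]
  rw [h2, smul_eq_mul] at h1
  simp only [cellMap]
  generalize (∫ p, m (r * (latticeMap ζ p - (1 + ζ) / 2))) = K at h1 ⊢
  rw [mul_inv, mul_right_comm, h1]
  field_simp

theorem cauchyOp_comp_cellMap {φ : ℂ → ℂ} (hφ : Differentiable ℝ φ) (ζ : ℂ) (r : ℝ) (p : ℝ × ℝ) :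
    cauchyOp ζ (fun p => φ (cellMap ζ r p)) p =
      -(Complex.I * ζ.im) * (r * dbar φ (cellMap ζ r p)) := by
  have had : Differentiable ℝ fun z : ℂ => (r : ℂ) * (z - (1 + ζ) / 2) := by fun_prop
  have h := (cauchyOp_comp_lattice (φ := fun z => φ (r * (z - (1 + ζ) / 2))) (hφ.comp had) ζ p).1
  have hd : HasDerivAt (fun z : ℂ => (r : ℂ) * (z - (1 + ζ) / 2)) r (latticeMap ζ p) := by
    simpa using ((hasDerivAt_id (latticeMap ζ p)).sub_const ((1 + ζ) / 2)).const_mul (r : ℂ)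
  rw [dbar_comp hφ.differentiableAt hd, Complex.conj_ofReal] at h
  exact h

/-- The condition on r keeps the lattice coordinates of the rescaled support at distance less than
1/2 from the center of the square. -/
theorem cutoff_comp_cellMap {ζ : ℂ} (hζ : ζ.im ≠ 0) {ρ r : ℝ} (hr : 0 < r)
    (hρ : 2 * (‖latticeInv ζ‖ * ρ) < r) {α : ℂ → ℂ} (hα : ContDiff ℝ ∞ α)
    (hsupp : tsupport α ⊆ Metric.closedBall 0 ρ) : Cutoff fun p => α (cellMap ζ r p) := by
  refine ⟨hα.comp (contDiff_cellMap ζ r), fun p hp => ?_⟩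
  have h1 : cellMap ζ r p ∈ Metric.closedBall (0 : ℂ) ρ := by
    refine hsupp ?_
    have hcl : IsClosed (cellMap ζ r ⁻¹' tsupport α) :=
      (isClosed_tsupport α).preimage (contDiff_cellMap ζ r).continuous
    have h0 : tsupport (fun p => α (cellMap ζ r p)) ⊆ cellMap ζ r ⁻¹' tsupport α :=
      closure_minimal (fun q hq => subset_tsupport α hq) hcl
    exact h0 hp
  rw [mem_closedBall_zero_iff] at h1
  have hrc : (r : ℂ) ≠ 0 := by exact_mod_cast hr.ne'
  have h2 : p = r⁻¹ • latticeInv ζ (cellMap ζ r p) + (1 / 2, 1 / 2) := by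
    have hc : (1 + ζ) / 2 = latticeMap ζ (1 / 2, 1 / 2) := by
      rw [latticeMap_apply]; push_cast; ring
    rw [← map_smul]
    have : r⁻¹ • cellMap ζ r p = latticeMap ζ p - latticeMap ζ (1 / 2, 1 / 2) := by
      rw [cellMap, Complex.real_smul, hc]
      push_cast
      field_simp
    rw [this, map_sub, latticeInv_latticeMap hζ, latticeInv_latticeMap hζ, sub_add_cancel]
  have h3 : ‖r⁻¹ • latticeInv ζ (cellMap ζ r p)‖ < 1 / 2 := by
    rw [norm_smul, norm_inv, Real.norm_of_nonneg hr.le, inv_mul_lt_iff₀ hr]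
    have := ((latticeInv ζ).le_opNorm (cellMap ζ r p)).trans
      (mul_le_mul_of_nonneg_left h1 (norm_nonneg _))
    linarith
  rw [Prod.norm_def, max_lt_iff, Real.norm_eq_abs, Real.norm_eq_abs, abs_lt, abs_lt] at h3
  obtain ⟨⟨a1, a2⟩, a3, a4⟩ := h3
  rw [h2]
  exact ⟨⟨by simp only [Prod.fst_add]; linarith, by simp only [Prod.fst_add]; linarith⟩,
    ⟨by simp only [Prod.snd_add]; linarith, by simp only [Prod.snd_add]; linarith⟩⟩

theorem integral_cell_comp_cellMap {ζ : ℂ} (hζ : 0 < ζ.im) {ρ r : ℝ} (hr : 0 < r)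
    (hρ : 2 * (‖latticeInv ζ‖ * ρ) < r) {α : ℂ → ℂ} (hα : ContDiff ℝ ∞ α)
    (hsupp : tsupport α ⊆ Metric.closedBall 0 ρ) {m : ℂ → ℝ} (hm : ∀ z, α z = 0 → m z = 0) :
    ∫ p, m (cellMap ζ r p) ∂cell = (r ^ 2 * ζ.im)⁻¹ * ∫ z, m z := by
  rw [← integral_comp_cellMap hζ hr.ne']
  refine setIntegral_eq_integral_of_forall_compl_eq_zero fun p hp => hm _ ?_
  exact (cutoff_comp_cellMap hζ.ne' hr hρ hα hsupp).eq_zero fun h' =>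
    hp (prod_mono Ioo_subset_Ioc_self Ioo_subset_Ioc_self h')

/-- A compact part of the plane is placed inside a large copy of the fundamental parallelogram,
where α and a truncation of h become data on the torus. The inequality is invariant under scaling,
so the size of the copy drops out. -/
theorem lamMin_sq_mul_le_of_hasCompactSupport {x y : ℝ} (hy : 0 < y) {h : ℂ → ℝ}
    (hh : ContDiff ℝ ∞ h) (hpos : ∀ z, 0 < h z) (hint : Integrable fun z => h z ^ 2) {α : ℂ → ℂ}
    (hα : ContDiff ℝ ∞ α) (hc : HasCompactSupport α) :
    (nontrivialSpinTorus x y).lamMin ^ 2 * ∫ z, h z * ‖α z‖ ^ 2 ≤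
      (∫ z, h z ^ 2) * ∫ z, (h z)⁻¹ * ‖dbar α z‖ ^ 2 := by
  set ζ : ℂ := ⟨x, y⟩ with hζdef
  have hζ : 0 < ζ.im := hy
  set l := (nontrivialSpinTorus x y).lamMin with hl
  obtain ⟨R, hR⟩ := hc.isCompact.isBounded.exists_norm_le
  set ρ₀ := max 1 R with hρ₀
  have hρ₀pos : 0 < ρ₀ := by positivity
  let b : ContDiffBump (0 : ℂ) := ⟨ρ₀, 2 * ρ₀, hρ₀pos, by linarith⟩
  -- The square root of h is truncated and extended antiperiodically. The square of the absolute
  -- value of the extension is smooth and doubly periodic, so it serves as the periodic conformal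
  -- factor up to a positive constant.
  set g : ℂ → ℂ := fun z => (b z : ℂ) * (√(h z) : ℂ) with hg
  have hgc : ContDiff ℝ ∞ g :=
    (Complex.ofRealCLM.contDiff.comp b.contDiff).mul (contDiff_sqrt_ofReal hh hpos)
  have hgs : tsupport g ⊆ Metric.closedBall 0 (2 * ρ₀) := by
    refine closure_minimal (fun z hz => ?_) Metric.isClosed_closedBall
    have : b z ≠ 0 := by
      intro h0
      simp [g, h0] at hz
    have h2 : z ∈ Function.support b := this
    rw [b.support_eq] at h2
    exact Metric.ball_subset_closedBall h2
  have hαs : tsupport α ⊆ Metric.closedBall 0 (2 * ρ₀) := fun z hz => by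
    rw [mem_closedBall_zero_iff]
    have := hR z hz
    have := le_max_right 1 R
    linarith
  have hgn (z) : ‖g z‖ ^ 2 = b z ^ 2 * h z := by
    rw [hg, norm_mul, mul_pow, Complex.norm_real, Complex.norm_real, Real.norm_eq_abs,
      Real.norm_eq_abs, sq_abs, sq_abs, Real.sq_sqrt (hpos z).le]
  have hb1 {z} (hz : z ∈ tsupport α) : b z = 1 := by
    refine b.one_of_mem_closedBall ?_
    rw [mem_closedBall_zero_iff]
    exact (hR z hz).trans (le_max_right _ _)
  have hα0 {z} (hz : z ∉ tsupport α) : α z = 0 := image_eq_zero_of_notMem_tsupport hz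
  have hdα0 {z} (hz : z ∉ tsupport α) : dbar α z = 0 := by
    have : fderiv ℝ α z = 0 :=
      image_eq_zero_of_notMem_tsupport fun h' => hz (tsupport_fderiv_subset ℝ h')
    simp [dbar, this]
  have hdsupp : tsupport (dbar α) ⊆ Metric.closedBall 0 (2 * ρ₀) := by
    refine (closure_minimal (fun z hz => ?_) (isClosed_tsupport α)).trans hαs
    by_contra h'
    exact hz (hdα0 h')
  -- Large enough for the supports of both α and g; the summand 1 makes the inequality strict.
  set r : ℝ := 2 * (‖latticeInv ζ‖ * (2 * ρ₀)) + 1 with hr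
  have hrpos : 0 < r := by positivity
  have hρ : 2 * (‖latticeInv ζ‖ * (2 * ρ₀)) < r := by rw [hr]; linarith
  have cα := cutoff_comp_cellMap hζ.ne' hrpos hρ hα hαs
  have cg := cutoff_comp_cellMap hζ.ne' hrpos hρ hgc hgs
  obtain ⟨U, hU, hUe⟩ := cα.exists_twisted
  obtain ⟨V, hV, hVe⟩ := cg.exists_twisted
  set N : ℝ × ℝ → ℝ := fun p => ‖V p‖ ^ 2 with hN
  have hNb : Biperiodic N := by
    refine ⟨hV.smooth.norm_sq ℝ, fun m n p => ?_⟩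
    simp only [N]
    rw [hV.twist, norm_mul, norm_neg_one_zpow, one_mul]
  have hNc : Continuous N := hNb.smooth.continuous
  -- The truncated factor can vanish, so a constant κ is added. On the support of α the bump is one,
  -- so the mass only grows and the energy only shrinks; the extra area disappears as κ → 0.
  have hF (κ : ℝ) (hκ : 0 < κ) : TorusMetric fun p => N p + κ :=
    ⟨⟨hNb.smooth.add contDiff_const, fun m n p => by rw [hNb.period]⟩, fun p =>
      add_pos_of_nonneg_of_pos (by positivity) hκ⟩
  have hUa : ∀ᵐ p ∂cell, U p = α (cellMap ζ r p) ∧ N p = b (cellMap ζ r p) ^ 2 * h (cellMap ζ r p) ∧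
      ‖cauchyOp ζ U p‖ ^ 2 = (y * r) ^ 2 * ‖dbar α (cellMap ζ r p)‖ ^ 2 := by
    filter_upwards [ae_mem_openCell] with p hp
    refine ⟨(hUe hp).symm, ?_, ?_⟩
    · change ‖V p‖ ^ 2 = _
      rw [← hVe hp, hgn]
    · rw [← cauchyOp_eqOn_openCell ζ hUe hp, cauchyOp_comp_cellMap (hα.differentiable (by simp)),
        norm_mul, norm_mul, norm_neg, norm_mul, Complex.norm_I, Complex.norm_real, Complex.norm_real,
        Real.norm_of_nonneg hζ.le, Real.norm_of_nonneg hrpos.le]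
      ring
  set M := ∫ z, h z * ‖α z‖ ^ 2 with hM
  set E := ∫ z, (h z)⁻¹ * ‖dbar α z‖ ^ 2 with hE
  set q := (r ^ 2 * y)⁻¹ with hq
  have hq0 : 0 < q := by positivity
  have mass (κ : ℝ) (hκ : 0 < κ) : q * M ≤ torusMass (fun p => N p + κ) U := by
    have h1 : ∫ p, h (cellMap ζ r p) * ‖α (cellMap ζ r p)‖ ^ 2 ∂cell = q * M :=
      integral_cell_comp_cellMap hζ hrpos hρ hα hαs (m := fun z => h z * ‖α z‖ ^ 2)
        fun z hz => by simp [hz]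
    rw [← h1, torusMass]
    refine integral_mono_ae
      (integrable_of_continuous ((hh.continuous.comp (contDiff_cellMap ζ r).continuous).mul
        (cα.continuous.norm.pow 2)))
      (integrable_of_continuous ((hNc.add continuous_const).mul (hU.continuous.norm.pow 2))) ?_
    filter_upwards [hUa] with p hp
    rw [hp.1, hp.2.1]
    by_cases hz : cellMap ζ r p ∈ tsupport α
    · rw [hb1 hz]
      gcongr
      linarith
    · rw [hα0 hz]; simp
  have energy (κ : ℝ) (hκ : 0 < κ) : torusEnergy ζ (fun p => N p + κ) U ≤ (y * r) ^ 2 * (q * E) := by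
    have h1 : ∫ p, (h (cellMap ζ r p))⁻¹ * ‖dbar α (cellMap ζ r p)‖ ^ 2 ∂cell = q * E :=
      integral_cell_comp_cellMap hζ hrpos hρ (contDiff_dbar hα) hdsupp
        (m := fun z => (h z)⁻¹ * ‖dbar α z‖ ^ 2) fun z hz => by simp [hz]
    rw [← h1, torusEnergy, ← integral_const_mul]
    refine integral_mono_ae
      (integrable_of_continuous ((hF κ hκ).continuous_inv.mul
        ((hU.cauchyOp ζ).continuous.norm.pow 2)))
      (integrable_of_continuous (continuous_const.mul
        (((hh.continuous.inv₀ fun z => (hpos z).ne').comp (contDiff_cellMap ζ r).continuous).mul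
        (((contDiff_dbar hα).continuous.comp (contDiff_cellMap ζ r).continuous).norm.pow 2)))) ?_
    filter_upwards [hUa] with p hp
    rw [hp.2.2, hp.2.1, mul_left_comm]
    refine mul_le_mul_of_nonneg_left ?_ (by positivity)
    by_cases hz : cellMap ζ r p ∈ tsupport α
    · rw [hb1 hz]
      have := hpos (cellMap ζ r p)
      gcongr
      linarith
    · rw [hdα0 hz]; simp
  have area (κ : ℝ) : torusArea (fun p => N p + κ) ≤
      q * (∫ z, h z ^ 2) + κ * (2 * ∫ p, N p ∂cell) + κ ^ 2 := by
    have i1 : Integrable (fun p => N p ^ 2) cell := integrable_of_continuous (hNc.pow 2)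
    have i2 : Integrable (fun p => κ * (2 * N p)) cell :=
      integrable_of_continuous (continuous_const.mul (continuous_const.mul hNc))
    have e : torusArea (fun p => N p + κ) =
        ∫ p, N p ^ 2 ∂cell + κ * (2 * ∫ p, N p ∂cell) + κ ^ 2 := by
      rw [torusArea, ← integral_const_mul, ← integral_const_mul, ← integral_add i1 i2]
      have : ∫ p, (N p ^ 2 + κ * (2 * N p)) ∂cell + κ ^ 2 =
          ∫ p, (N p ^ 2 + κ * (2 * N p) + κ ^ 2) ∂cell := by
        have i12 : Integrable (fun p => N p ^ 2 + κ * (2 * N p)) cell := i1.add i2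
        rw [integral_add i12 (integrable_const _)]
        simp
      rw [this]
      congr 1 with p
      ring
    rw [e]
    gcongr
    have h1 : ∫ p, N p ^ 2 ∂cell = q * ∫ z, ‖g z‖ ^ 4 := by
      rw [← integral_cell_comp_cellMap hζ hrpos hρ hgc hgs (m := fun z => ‖g z‖ ^ 4)
        fun z hz => by simp [hz]]
      refine integral_congr_ae ?_
      filter_upwards [hUa] with p hp
      rw [hp.2.1, ← hgn]
      ring
    rw [h1]
    refine mul_le_mul_of_nonneg_left ?_ hq0.le
    refine integral_mono_of_nonneg (Eventually.of_forall fun z => by positivity) hint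
      (Eventually.of_forall fun z => ?_)
    have e2 : ‖g z‖ ^ 4 = (b z ^ 2 * h z) ^ 2 := by rw [← hgn]; ring
    simp only [e2]
    have h3 : b z ^ 2 ≤ 1 := pow_le_one₀ b.nonneg b.le_one
    have := hpos z
    gcongr
    exact mul_le_of_le_one_left this.le h3
  have hEnn : 0 ≤ E := integral_nonneg fun z =>
    mul_nonneg (inv_nonneg.2 (hpos z).le) (by positivity)
  have key (κ : ℝ) (hκ : 0 < κ) : l ^ 2 * (y * (q * M)) ≤
      (q * (∫ z, h z ^ 2) + κ * (2 * ∫ p, N p ∂cell) + κ ^ 2) * ((y * r) ^ 2 * (q * E)) := by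
    have h1 := lamMin_sq_mul_le (x := x) hy (hF κ hκ) hU
    have hA := TorusMetric.area_nonneg (F := fun p => N p + κ)
    calc _ ≤ l ^ 2 * (y * torusMass (fun p => N p + κ) U) := by gcongr; exact mass κ hκ
      _ ≤ _ := h1
      _ ≤ _ := mul_le_mul (area κ) (energy κ hκ) ((hF κ hκ).energy_nonneg ζ) (hA.trans (area κ))
  have lim : Tendsto (fun κ : ℝ => (q * (∫ z, h z ^ 2) + κ * (2 * ∫ p, N p ∂cell) + κ ^ 2) *
      ((y * r) ^ 2 * (q * E))) (𝓝[>] 0) (𝓝 ((q * (∫ z, h z ^ 2) + 0 * (2 * ∫ p, N p ∂cell) + 0 ^ 2) *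
      ((y * r) ^ 2 * (q * E)))) := by
    refine Tendsto.mono_left (Continuous.tendsto ?_ 0) nhdsWithin_le_nhds
    fun_prop
  have fin := ge_of_tendsto lim (eventually_nhdsWithin_of_forall fun κ hκ => key κ hκ)
  have e3 : (q * (∫ z, h z ^ 2) + 0 * (2 * ∫ p, N p ∂cell) + 0 ^ 2) * ((y * r) ^ 2 * (q * E)) =
      (y * q) * ((∫ z, h z ^ 2) * E) := by
    have : q * (y * r) ^ 2 = y := by rw [hq]; field_simp
    linear_combination ((∫ z, h z ^ 2) * (q * E)) * this
  rw [e3] at fin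
  have : 0 < y * q := by positivity
  nlinarith [this]

/-! ## Transplantation of eigenspinors from the sphere to the plane -/

/-- The decay of half-spinors of the sphere in a chart. -/
def decay (z : ℂ) : ℝ := (√(1 + ‖z‖ ^ 2))⁻¹

theorem decay_pos (z : ℂ) : 0 < decay z := by unfold decay; positivity

theorem decay_pow (z : ℂ) (k : ℕ) : decay z ^ k = (1 + ‖z‖ ^ 2) ^ (-(k : ℝ) / 2) := by
  have hp : 0 ≤ 1 + ‖z‖ ^ 2 := by positivity
  rw [decay, Real.sqrt_eq_rpow, ← Real.rpow_neg hp, ← Real.rpow_natCast, ← Real.rpow_mul hp]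
  congr 1
  ring

theorem inv_le_decay {z : ℂ} {c : ℝ} (hc : 0 < c) (h : 1 + ‖z‖ ^ 2 ≤ c ^ 2) : c⁻¹ ≤ decay z := by
  rw [decay]
  exact inv_anti₀ (Real.sqrt_pos.2 (by positivity)) (Real.sqrt_le_left hc.le |>.2 h)

/-- The closed unit discs of the two charts are compact and cover the sphere; the transition factor
1/|z| gives the rate at infinity. -/
theorem exists_decay_bound {g : ℂ → ℂ} {m : ℂ → ℝ} (hg : Continuous g) (hm : Continuous m)
    (h : ∀ z, z ≠ 0 → ‖g z‖ = ‖z‖⁻¹ * m z⁻¹) : ∃ C, 0 < C ∧ ∀ z, ‖g z‖ ≤ C * decay z := by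
  obtain ⟨C1, h1⟩ := (isCompact_closedBall (0 : ℂ) 1).exists_bound_of_continuousOn hg.continuousOn
  obtain ⟨C2, h2⟩ := (isCompact_closedBall (0 : ℂ) 1).exists_bound_of_continuousOn hm.continuousOn
  have hC : 0 < max 1 (max C1 C2) := by positivity
  refine ⟨2 * max 1 (max C1 C2), by positivity, fun z => ?_⟩
  rw [mul_comm 2, mul_assoc]
  rcases le_total ‖z‖ 1 with hz | hz
  · have h3 : (2 : ℝ)⁻¹ ≤ decay z := inv_le_decay two_pos (by nlinarith [norm_nonneg z])
    have h4 := (h1 z (by simpa using hz)).trans ((le_max_left C1 C2).trans (le_max_right 1 _))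
    exact h4.trans (le_mul_of_one_le_right hC.le (by linarith))
  · have hz0 : z ≠ 0 := norm_pos_iff.1 (one_pos.trans_le hz)
    have h3 : (2 * ‖z‖)⁻¹ ≤ decay z := inv_le_decay (by positivity) (by nlinarith)
    have h4 : ‖z‖⁻¹ ≤ 2 * decay z := by
      rw [mul_inv] at h3
      linarith
    have h5 : m z⁻¹ ≤ max 1 (max C1 C2) := by
      refine (le_abs_self _).trans ((h2 _ ?_).trans ((le_max_right C1 C2).trans (le_max_right 1 _)))
      rw [mem_closedBall_zero_iff, norm_inv]
      exact inv_le_one_of_one_le₀ hz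
    rw [h z hz0, mul_comm]
    exact (mul_le_mul_of_nonneg_right h5 (by positivity)).trans
      (mul_le_mul_of_nonneg_left h4 hC.le)

/-- A fixed bump dilated by n + 1. Its derivative has size 1/(n + 1) on a set where |z| ≤ 2(n + 1),
hence a bound by `decay` uniform in n, which serves as a dominating function. -/
theorem exists_plane_cutoff : ∃ (η : ℕ → ℂ → ℂ) (C : ℝ), 0 < C ∧ (∀ n, ContDiff ℝ ∞ (η n)) ∧
    (∀ n, HasCompactSupport (η n)) ∧ (∀ n z, ‖η n z‖ ≤ 1) ∧
    (∀ n z, ‖dbar (η n) z‖ ≤ C * decay z) ∧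
    ∀ z, ∀ᶠ n in atTop, η n z = 1 ∧ dbar (η n) z = 0 := by
  let b : ContDiffBump (0 : ℂ) := ⟨1, 2, one_pos, one_lt_two⟩
  set χ : ℂ → ℂ := fun z => (b z : ℂ) with hχ
  have hχc : ContDiff ℝ ∞ χ := Complex.ofRealCLM.contDiff.comp b.contDiff
  have hs : tsupport χ ⊆ Metric.closedBall 0 2 := by
    refine closure_minimal (fun z hz => ?_) Metric.isClosed_closedBall
    have h2 : z ∈ Function.support b := fun h0 => hz (by simp [χ, h0])
    rw [b.support_eq] at h2
    exact Metric.ball_subset_closedBall h2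
  have hcs : HasCompactSupport χ :=
    (isCompact_closedBall (0 : ℂ) 2).of_isClosed_subset (isClosed_tsupport χ) hs
  have hd0 {z} (hz : z ∉ tsupport χ) : dbar χ z = 0 := by
    have : fderiv ℝ χ z = 0 :=
      image_eq_zero_of_notMem_tsupport fun h' => hz (tsupport_fderiv_subset ℝ h')
    simp [dbar, this]
  obtain ⟨K, hK⟩ := (isCompact_closedBall (0 : ℂ) 2).exists_bound_of_continuousOn
    (contDiff_dbar hχc).continuous.continuousOn
  have hK0 : 0 ≤ K := (norm_nonneg _).trans (hK 0 (by simp))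
  have hN (n : ℕ) : ((n : ℂ) + 1) ≠ 0 := by exact_mod_cast n.succ_ne_zero
  have hdη (n : ℕ) (z : ℂ) : dbar (fun p : ℂ => χ (((n : ℂ) + 1)⁻¹ * p)) z =
      ((n : ℂ) + 1)⁻¹ * dbar χ (((n : ℂ) + 1)⁻¹ * z) := by
    have h1 : HasDerivAt (fun p : ℂ => ((n : ℂ) + 1)⁻¹ * p) ((n : ℂ) + 1)⁻¹ z := by
      simpa using (hasDerivAt_id z).const_mul ((n : ℂ) + 1)⁻¹
    rw [dbar_comp (hχc.differentiable (by simp)).differentiableAt h1]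
    simp
  have hnn (n : ℕ) : ‖((n : ℂ) + 1)⁻¹‖ = ((n : ℝ) + 1)⁻¹ := by
    rw [norm_inv]
    congr 1
    exact_mod_cast Complex.norm_natCast (n + 1)
  refine ⟨fun n z => χ (((n : ℂ) + 1)⁻¹ * z), 3 * K + 1, by positivity, fun n => ?_, fun n => ?_,
    fun n z => ?_, fun n z => ?_, fun z => ?_⟩
  · exact hχc.comp (contDiff_const.mul contDiff_id)
  · exact hcs.comp_homeomorph (Homeomorph.mulLeft₀ _ (inv_ne_zero (hN n)))
  · simp only [χ, Complex.norm_real, Real.norm_of_nonneg b.nonneg]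
    exact b.le_one
  · rw [hdη, norm_mul, hnn]
    have hdec := decay_pos z
    by_cases hz : ((n : ℂ) + 1)⁻¹ * z ∈ tsupport χ
    · have h1 := hs hz
      have h2 := hK _ h1
      rw [mem_closedBall_zero_iff, norm_mul, hnn, inv_mul_le_iff₀ (by positivity)] at h1
      have hn : (0 : ℝ) ≤ n := n.cast_nonneg
      -- On the support 1 + |z|² ≤ 1 + 4(n + 1)² ≤ (3(n + 1))².
      have h3 : (3 * ((n : ℝ) + 1))⁻¹ ≤ decay z :=
        inv_le_decay (by positivity) (by nlinarith [norm_nonneg z])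
      rw [mul_inv] at h3
      have h4 : ((n : ℝ) + 1)⁻¹ ≤ 3 * decay z := by linarith
      calc _ ≤ (3 * decay z) * K := mul_le_mul h4 h2 (norm_nonneg _) (by positivity)
        _ ≤ _ := by nlinarith
    · rw [hd0 hz, norm_zero, mul_zero]
      positivity
  · obtain ⟨n₀, hn₀⟩ := exists_nat_gt ‖z‖
    filter_upwards [eventually_ge_atTop n₀] with n hn
    have h1 : ((n : ℂ) + 1)⁻¹ * z ∈ Metric.ball (0 : ℂ) 1 := by
      rw [mem_ball_zero_iff, norm_mul, hnn, inv_mul_lt_iff₀ (by positivity)]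
      have : (n₀ : ℝ) ≤ n := by exact_mod_cast hn
      linarith
    have h2 : EqOn χ (fun _ => 1) (Metric.ball 0 1) := fun u hu => by
      have : b u = 1 := b.one_of_mem_closedBall (Metric.ball_subset_closedBall hu)
      simp [χ, this]
    refine ⟨h2 h1, ?_⟩
    rw [hdη]
    have h3 : χ =ᶠ[𝓝 (((n : ℂ) + 1)⁻¹ * z)] fun _ => 1 :=
      h2.eventuallyEq_of_mem (Metric.isOpen_ball.mem_nhds h1)
    simp [dbar, h3.fderiv_eq]

theorem integrable_decay_cube : Integrable fun z => decay z ^ 3 := by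
  have := integrable_rpow_neg_one_add_norm_sq (E := ℂ) (μ := volume) (r := 3)
    (by rw [Complex.finrank_real_complex]; norm_num)
  refine this.congr (Eventually.of_forall fun z => ?_)
  simp only [decay_pow, Nat.cast_ofNat]

/-- A positive function on the plane that decays more slowly than the conformal factors of the
metrics of the sphere. -/
def slowFactor (z : ℂ) : ℝ := (1 + ‖z‖ ^ 2) ^ (-(3 / 4) : ℝ)

theorem slowFactor_pos (z : ℂ) : 0 < slowFactor z := Real.rpow_pos_of_pos (by positivity) _

theorem contDiff_slowFactor : ContDiff ℝ ∞ slowFactor :=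
  (contDiff_const.add (contDiff_id.norm_sq ℝ)).rpow_const_of_ne fun z => by positivity

theorem integrable_slowFactor_sq : Integrable fun z => slowFactor z ^ 2 := by
  refine integrable_decay_cube.congr (Eventually.of_forall fun z => ?_)
  have hp : 0 ≤ 1 + ‖z‖ ^ 2 := by positivity
  have h := Real.rpow_mul_natCast hp (-(3 / 4)) 2
  simp only [decay_pow, slowFactor]
  rw [← h]
  norm_num

/-- The integrand decays like |z|^(-5/2). The exponent -3/4 in `slowFactor` serves this bound and
the |z|⁻³ decay of its square; both are integrable in dimension two. -/
theorem integrable_slowFactor_inv_mul : Integrable fun z => (slowFactor z)⁻¹ * decay z ^ 4 := by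
  have := integrable_rpow_neg_one_add_norm_sq (E := ℂ) (μ := volume) (r := 5 / 2)
    (by rw [Complex.finrank_real_complex]; norm_num)
  refine this.congr (Eventually.of_forall fun z => ?_)
  have hp : 0 < 1 + ‖z‖ ^ 2 := by positivity
  simp only [decay_pow, slowFactor]
  rw [← Real.rpow_neg hp.le, ← Real.rpow_add hp]
  norm_num

section Transplant

variable {f₁ f₂ : ℂ → ℝ} {a b : ℂ → ℂ}

/-- The function f⁻¹ ∂̄a transforms, in absolute value, with the same factor 1/|z| as a, since f⁻¹
and ∂̄ contribute |z|² and |z|⁻². -/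
theorem SphereSection.exists_decay (h : SphereSection a b) (hf : SphereMetric f₁ f₂) :
    ∃ C, 0 < C ∧ ∀ z, ‖a z‖ ≤ C * decay z ∧ (f₁ z)⁻¹ * ‖dbar a z‖ ≤ C * decay z := by
  obtain ⟨C1, h1, h1'⟩ := exists_decay_bound (g := a) (m := fun z => ‖b z‖) h.smooth₁.continuous
    h.smooth₂.continuous.norm fun z hz => by
      rw [h.compat z hz, norm_mul, norm_div, Complex.norm_I, one_div]
  obtain ⟨C2, h2, h2'⟩ := exists_decay_bound (g := fun z => (f₁ z : ℂ)⁻¹ * dbar a z)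
    (m := fun z => (f₂ z)⁻¹ * ‖dbar b z‖)
    ((contDiff_inv_ofReal hf.smooth₁ hf.pos₁).mul (contDiff_dbar h.smooth₁)).continuous
    ((hf.smooth₂.continuous.inv₀ fun z => (hf.pos₂ z).ne').mul
      (contDiff_dbar h.smooth₂).continuous.norm) fun z hz => by
      have hn : ‖z‖ ≠ 0 := norm_ne_zero_iff.2 hz
      have := (hf.pos₂ z⁻¹).ne'
      rw [norm_mul, norm_inv, Complex.norm_real, Real.norm_of_nonneg (hf.pos₁ z).le, hf.compat z hz,
        h.dbar_compat hz]
      simp only [norm_mul, norm_neg, norm_div, Complex.norm_I, norm_inv, norm_pow, RCLike.norm_conj]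
      field_simp
  refine ⟨max C1 C2, lt_max_of_lt_left h1, fun z => ⟨?_, ?_⟩⟩
  · exact (h1' z).trans (mul_le_mul_of_nonneg_right (le_max_left _ _) (decay_pos z).le)
  · have h3 := (h2' z).trans (mul_le_mul_of_nonneg_right (le_max_right C1 C2) (decay_pos z).le)
    rwa [norm_mul, norm_inv, Complex.norm_real, Real.norm_of_nonneg (hf.pos₁ z).le] at h3

theorem norm_dbar_cutoff_mul_le {η : ℂ → ℂ} (hη : ContDiff ℝ ∞ η) (ha : ContDiff ℝ ∞ a) {z : ℂ}
    {C K : ℝ} (h1 : ‖η z‖ ≤ 1) (h2 : ‖dbar η z‖ ≤ K * decay z) (h3 : ‖a z‖ ≤ C * decay z) :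
    ‖dbar (fun p => η p * a p) z‖ ≤ K * C * decay z ^ 2 + ‖dbar a z‖ := by
  rw [dbar_mul (hη.differentiable (by simp)).differentiableAt
    (ha.differentiable (by simp)).differentiableAt]
  refine (norm_add_le _ _).trans ?_
  rw [norm_mul, norm_mul]
  have h4 : ‖dbar η z‖ * ‖a z‖ ≤ (K * decay z) * (C * decay z) :=
    mul_le_mul h2 h3 (norm_nonneg _) ((norm_nonneg _).trans h2)
  have h5 : ‖η z‖ * ‖dbar a z‖ ≤ ‖dbar a z‖ := mul_le_of_le_one_left (norm_nonneg _) h1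
  linarith

theorem dbar_cutoff_mul_eq {η : ℂ → ℂ} (hη : ContDiff ℝ ∞ η) (ha : ContDiff ℝ ∞ a) {z : ℂ}
    (h1 : η z = 1) (h2 : dbar η z = 0) : dbar (fun p => η p * a p) z = dbar a z := by
  rw [dbar_mul (hη.differentiable (by simp)).differentiableAt
    (ha.differentiable (by simp)).differentiableAt, h1, h2]
  simp

/-- The energy identity for an eigen-half-spinor of the sphere. -/
theorem SphereSection.energy_eq (h : SphereSection a b) (hf : SphereMetric f₁ f₂) {μ : ℝ}
    (he : ChartEigen f₁ a μ) :
    ∫ z, (f₁ z)⁻¹ * ‖dbar a z‖ ^ 2 = μ * ∫ z, f₁ z * ‖a z‖ ^ 2 := by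
  obtain ⟨C, hC, hCa⟩ := h.exists_decay hf
  obtain ⟨η, K, hK, hη, hηc, hη1, hηd, hηe⟩ := exists_plane_cutoff
  have hωc := (contDiff_inv_ofReal hf.smooth₁ hf.pos₁).mul (contDiff_dbar h.smooth₁)
  have hfc : Continuous fun z => (f₁ z : ℂ) := Complex.continuous_ofReal.comp hf.smooth₁.continuous
  have hηa (n) : ContDiff ℝ ∞ fun z => η n z * a z := (hη n).mul h.smooth₁
  have ibp (n : ℕ) : ∫ z, ((f₁ z : ℂ)⁻¹ * dbar a z) * (starRingEnd ℂ) (dbar (fun p => η n p * a p) z) =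
      μ * ∫ z, (f₁ z * a z) * (starRingEnd ℂ) (η n z * a z) := by
    have hα : ContDiff ℝ ∞ fun z => (starRingEnd ℂ) (η n z * a z) :=
      Complex.conjCLE.contDiff.comp (hηa n)
    have hc : HasCompactSupport fun z => (starRingEnd ℂ) (η n z * a z) :=
      ((hηc n).mul_right (f' := a)).comp_left (g := starRingEnd ℂ) (map_zero _)
    have h1 := (integral_mul_dbar hωc hα hc).2
    simp only [del_conj] at h1
    rw [h1, ← integral_const_mul, ← integral_neg]
    congr 1 with z
    rw [he z]
    ring
  have lim1 : Tendsto (fun n => ∫ z, ((f₁ z : ℂ)⁻¹ * dbar a z) *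
      (starRingEnd ℂ) (dbar (fun p => η n p * a p) z)) atTop
      (𝓝 (∫ z, (((f₁ z)⁻¹ * ‖dbar a z‖ ^ 2 : ℝ) : ℂ))) := by
    -- The cutoff derivative is paired with f⁻¹ ∂̄a and with a, so the error is of order |z|⁻³.
    -- Being linear in the derivative of the cutoff, it is dominated without enlarging the conformal
    -- factor.
    refine tendsto_integral_of_dominated_convergence
      (fun z => C * (K * C) * decay z ^ 3 + (f₁ z)⁻¹ * ‖dbar a z‖ ^ 2) (fun n => ?_)
      ((integrable_decay_cube.const_mul _).add (h.energyDensity_norm hf).integrable)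
      (fun n => Eventually.of_forall fun z => ?_) (Eventually.of_forall fun z => ?_)
    · exact (hωc.continuous.mul (Complex.continuous_conj.comp
        (contDiff_dbar (hηa n)).continuous)).aestronglyMeasurable
    · rw [norm_mul, norm_mul, norm_inv, Complex.norm_real, Real.norm_of_nonneg (hf.pos₁ z).le,
        RCLike.norm_conj]
      have h1 := norm_dbar_cutoff_mul_le (hη n) h.smooth₁ (hη1 n z) (hηd n z) (hCa z).1
      have hfi : 0 ≤ (f₁ z)⁻¹ * ‖dbar a z‖ :=
        mul_nonneg (inv_nonneg.2 (hf.pos₁ z).le) (norm_nonneg _)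
      have hd := decay_pos z
      calc _ ≤ (f₁ z)⁻¹ * ‖dbar a z‖ * (K * C * decay z ^ 2 + ‖dbar a z‖) :=
            mul_le_mul_of_nonneg_left h1 hfi
        _ = (f₁ z)⁻¹ * ‖dbar a z‖ * (K * C * decay z ^ 2) + (f₁ z)⁻¹ * ‖dbar a z‖ ^ 2 := by ring
        _ ≤ (C * decay z) * (K * C * decay z ^ 2) + (f₁ z)⁻¹ * ‖dbar a z‖ ^ 2 := by
            have := mul_le_mul_of_nonneg_right (hCa z).2
              (by positivity : 0 ≤ K * C * decay z ^ 2)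
            linarith
        _ = _ := by ring
    · refine tendsto_const_nhds.congr' ?_
      filter_upwards [hηe z] with n hn
      rw [dbar_cutoff_mul_eq (hη n) h.smooth₁ hn.1 hn.2, mul_assoc, Complex.mul_conj']
      push_cast
      ring
  have lim2 : Tendsto (fun n => ∫ z, (f₁ z * a z) * (starRingEnd ℂ) (η n z * a z)) atTop
      (𝓝 (∫ z, ((f₁ z * ‖a z‖ ^ 2 : ℝ) : ℂ))) := by
    refine tendsto_integral_of_dominated_convergence (fun z => f₁ z * ‖a z‖ ^ 2) (fun n => ?_)
      (h.massDensity_norm hf).integrable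
      (fun n => Eventually.of_forall fun z => ?_) (Eventually.of_forall fun z => ?_)
    · exact ((hfc.mul h.smooth₁.continuous).mul (Complex.continuous_conj.comp
        (hηa n).continuous)).aestronglyMeasurable
    · rw [norm_mul, norm_mul, Complex.norm_real, Real.norm_of_nonneg (hf.pos₁ z).le,
        RCLike.norm_conj, norm_mul]
      have h1 : ‖η n z‖ * ‖a z‖ ≤ ‖a z‖ := mul_le_of_le_one_left (norm_nonneg _) (hη1 n z)
      have := (hf.pos₁ z).le
      calc _ ≤ f₁ z * ‖a z‖ * ‖a z‖ := mul_le_mul_of_nonneg_left h1 (by positivity)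
        _ = _ := by ring
    · refine tendsto_const_nhds.congr' ?_
      filter_upwards [hηe z] with n hn
      rw [hn.1, one_mul, mul_assoc, Complex.mul_conj']
      push_cast
      ring
  have h3 := tendsto_nhds_unique lim1 ((lim2.const_mul (μ : ℂ)).congr fun n => (ibp n).symm)
  rw [integral_complex_ofReal, integral_complex_ofReal] at h3
  exact_mod_cast h3

/-- The inequality for compactly supported functions is applied to η_n a with the factor f₁ + ε
`slowFactor`, first letting n → ∞ and then ε → 0. With f₁ alone the cutoff error is only dominated
by a function of order |z|⁻², which is not integrable. -/
theorem lamMin_sq_mul_le_of_sphereSection {x y : ℝ} (hy : 0 < y) (h : SphereSection a b)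
    (hf : SphereMetric f₁ f₂) :
    (nontrivialSpinTorus x y).lamMin ^ 2 * ∫ z, f₁ z * ‖a z‖ ^ 2 ≤
      (∫ z, f₁ z ^ 2) * ∫ z, (f₁ z)⁻¹ * ‖dbar a z‖ ^ 2 := by
  obtain ⟨C, hC, hCa⟩ := h.exists_decay hf
  obtain ⟨η, K, hK, hη, hηc, hη1, hηd, hηe⟩ := exists_plane_cutoff
  have hηa (n) : ContDiff ℝ ∞ fun z => η n z * a z := (hη n).mul h.smooth₁
  have hfc := hf.smooth₁.continuous
  have hE := (h.energyDensity_norm hf).integrable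
  have hM := (h.massDensity_norm hf).integrable
  set l := (nontrivialSpinTorus x y).lamMin
  have hprod : Integrable fun z => f₁ z * slowFactor z := by
    refine (hf.areaDensity.integrable.add integrable_slowFactor_sq).mono'
      (hfc.mul contDiff_slowFactor.continuous).aestronglyMeasurable
      (Eventually.of_forall fun z => ?_)
    rw [Real.norm_of_nonneg (mul_pos (hf.pos₁ z) (slowFactor_pos z)).le, Pi.add_apply]
    nlinarith [sq_nonneg (f₁ z - slowFactor z), sq_nonneg (f₁ z), sq_nonneg (slowFactor z)]
  have harea (ε : ℝ) : Integrable (fun z => (f₁ z + ε * slowFactor z) ^ 2) ∧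
      ∫ z, (f₁ z + ε * slowFactor z) ^ 2 = (∫ z, f₁ z ^ 2) + 2 * ε * (∫ z, f₁ z * slowFactor z) +
        ε ^ 2 * ∫ z, slowFactor z ^ 2 := by
    have i1 := hf.areaDensity.integrable
    have i2 := hprod.const_mul (2 * ε)
    have i3 := integrable_slowFactor_sq.const_mul (ε ^ 2)
    have i12 : Integrable fun z => f₁ z ^ 2 + 2 * ε * (f₁ z * slowFactor z) := i1.add i2
    have i123 : Integrable fun z => f₁ z ^ 2 + 2 * ε * (f₁ z * slowFactor z) +
      ε ^ 2 * slowFactor z ^ 2 := i12.add i3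
    have e : (fun z => (f₁ z + ε * slowFactor z) ^ 2) = fun z =>
        f₁ z ^ 2 + 2 * ε * (f₁ z * slowFactor z) + ε ^ 2 * slowFactor z ^ 2 := by
      ext z; ring
    rw [e]
    refine ⟨i123, ?_⟩
    rw [integral_add i12 i3, integral_add i1 i2, integral_const_mul, integral_const_mul]
  have key (ε : ℝ) (hε : 0 < ε) : l ^ 2 * ∫ z, f₁ z * ‖a z‖ ^ 2 ≤
      (∫ z, (f₁ z + ε * slowFactor z) ^ 2) * ∫ z, (f₁ z)⁻¹ * ‖dbar a z‖ ^ 2 := by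
    have hpos (z) : 0 < f₁ z + ε * slowFactor z :=
      add_pos (hf.pos₁ z) (mul_pos hε (slowFactor_pos z))
    have hh : ContDiff ℝ ∞ fun z => f₁ z + ε * slowFactor z :=
      hf.smooth₁.add (contDiff_const.mul contDiff_slowFactor)
    have hinv (z) : (f₁ z + ε * slowFactor z)⁻¹ ≤ (f₁ z)⁻¹ :=
      inv_anti₀ (hf.pos₁ z) (le_add_of_nonneg_right (mul_pos hε (slowFactor_pos z)).le)
    have hinv' (z) : (f₁ z + ε * slowFactor z)⁻¹ ≤ ε⁻¹ * (slowFactor z)⁻¹ := by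
      rw [← mul_inv]
      exact inv_anti₀ (mul_pos hε (slowFactor_pos z)) (le_add_of_nonneg_left (hf.pos₁ z).le)
    have step (n : ℕ) : l ^ 2 * ∫ z, f₁ z * ‖η n z * a z‖ ^ 2 ≤
        (∫ z, (f₁ z + ε * slowFactor z) ^ 2) *
          ∫ z, (f₁ z + ε * slowFactor z)⁻¹ * ‖dbar (fun p => η n p * a p) z‖ ^ 2 := by
      have hc : HasCompactSupport fun z => η n z * a z := (hηc n).mul_right
      have hint {g : ℂ → ℝ} (hg : Continuous g) :
          Integrable fun z => g z * ‖η n z * a z‖ ^ 2 := by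
        refine (hg.mul ((hηa n).continuous.norm.pow 2)).integrable_of_hasCompactSupport
          (hc.mono fun z hz h0 => hz ?_)
        have h0 : η n z * a z = 0 := h0
        change g z * ‖η n z * a z‖ ^ 2 = 0
        rw [h0]
        simp
      refine le_trans ?_ (lamMin_sq_mul_le_of_hasCompactSupport (x := x) hy hh hpos (harea ε).1 (hηa n) hc)
      refine mul_le_mul_of_nonneg_left (integral_mono ?_ ?_ fun z => ?_) (sq_nonneg _)
      · exact hint hfc
      · exact hint hh.continuous
      · exact mul_le_mul_of_nonneg_right
          (le_add_of_nonneg_right (mul_pos hε (slowFactor_pos z)).le) (sq_nonneg _)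
    have lim1 : Tendsto (fun n => ∫ z, f₁ z * ‖η n z * a z‖ ^ 2) atTop
        (𝓝 (∫ z, f₁ z * ‖a z‖ ^ 2)) := by
      refine tendsto_integral_of_dominated_convergence (fun z => f₁ z * ‖a z‖ ^ 2) (fun n => ?_)
        hM (fun n => Eventually.of_forall fun z => ?_) (Eventually.of_forall fun z => ?_)
      · exact (hfc.mul ((hηa n).continuous.norm.pow 2)).aestronglyMeasurable
      · have := (hf.pos₁ z).le
        rw [Real.norm_of_nonneg (by positivity), norm_mul]
        gcongr
        exact mul_le_of_le_one_left (norm_nonneg _) (hη1 n z)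
      · refine tendsto_const_nhds.congr' ?_
        filter_upwards [hηe z] with n hn
        rw [hn.1, one_mul]
    have lim2 : Tendsto (fun n => ∫ z, (f₁ z + ε * slowFactor z)⁻¹ *
        ‖dbar (fun p => η n p * a p) z‖ ^ 2) atTop
        (𝓝 (∫ z, (f₁ z + ε * slowFactor z)⁻¹ * ‖dbar a z‖ ^ 2)) := by
      -- The inverse of the enlarged factor is bounded in two ways: by ε⁻¹ `slowFactor`⁻¹ on the
      -- cutoff error and by f₁⁻¹ on the original energy.
      refine tendsto_integral_of_dominated_convergence (fun z =>
          2 * (K * C) ^ 2 * ε⁻¹ * ((slowFactor z)⁻¹ * decay z ^ 4) +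
          2 * ((f₁ z)⁻¹ * ‖dbar a z‖ ^ 2)) (fun n => ?_)
        ((integrable_slowFactor_inv_mul.const_mul _).add (hE.const_mul 2))
        (fun n => Eventually.of_forall fun z => ?_) (Eventually.of_forall fun z => ?_)
      · exact ((hh.continuous.inv₀ fun z => (hpos z).ne').mul
          ((contDiff_dbar (hηa n)).continuous.norm.pow 2)).aestronglyMeasurable
      · have hi : 0 ≤ (f₁ z + ε * slowFactor z)⁻¹ := inv_nonneg.2 (hpos z).le
        rw [Real.norm_of_nonneg (by positivity)]
        have h1 := norm_dbar_cutoff_mul_le (hη n) h.smooth₁ (hη1 n z) (hηd n z) (hCa z).1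
        have h2 : ‖dbar (fun p => η n p * a p) z‖ ^ 2 ≤
            2 * (K * C * decay z ^ 2) ^ 2 + 2 * ‖dbar a z‖ ^ 2 :=
          (pow_le_pow_left₀ (norm_nonneg _) h1 2).trans (by
            nlinarith [sq_nonneg (K * C * decay z ^ 2 - ‖dbar a z‖)])
        calc _ ≤ (f₁ z + ε * slowFactor z)⁻¹ *
              (2 * (K * C * decay z ^ 2) ^ 2 + 2 * ‖dbar a z‖ ^ 2) :=
              mul_le_mul_of_nonneg_left h2 hi
          _ = (f₁ z + ε * slowFactor z)⁻¹ * (2 * (K * C * decay z ^ 2) ^ 2) +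
              (f₁ z + ε * slowFactor z)⁻¹ * (2 * ‖dbar a z‖ ^ 2) := by ring
          _ ≤ (ε⁻¹ * (slowFactor z)⁻¹) * (2 * (K * C * decay z ^ 2) ^ 2) +
              (f₁ z)⁻¹ * (2 * ‖dbar a z‖ ^ 2) :=
              add_le_add (mul_le_mul_of_nonneg_right (hinv' z) (by positivity))
                (mul_le_mul_of_nonneg_right (hinv z) (by positivity))
          _ = _ := by ring
      · refine tendsto_const_nhds.congr' ?_
        filter_upwards [hηe z] with n hn
        rw [dbar_cutoff_mul_eq (hη n) h.smooth₁ hn.1 hn.2]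
    refine (le_of_tendsto_of_tendsto' (lim1.const_mul _) (lim2.const_mul _) step).trans ?_
    refine mul_le_mul_of_nonneg_left ?_ (integral_nonneg fun z => sq_nonneg _)
    exact integral_mono_of_nonneg (Eventually.of_forall fun z =>
      mul_nonneg (inv_nonneg.2 (hpos z).le) (sq_nonneg _)) hE
      (Eventually.of_forall fun z => mul_le_mul_of_nonneg_right (hinv z) (sq_nonneg _))
  have lim : Tendsto (fun ε : ℝ => (∫ z, (f₁ z + ε * slowFactor z) ^ 2) *
      ∫ z, (f₁ z)⁻¹ * ‖dbar a z‖ ^ 2) (𝓝[>] 0)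
      (𝓝 ((∫ z, f₁ z ^ 2) * ∫ z, (f₁ z)⁻¹ * ‖dbar a z‖ ^ 2)) := by
    simp only [fun ε => (harea ε).2]
    have hc : Continuous fun ε : ℝ => ((∫ z, f₁ z ^ 2) + 2 * ε * (∫ z, f₁ z * slowFactor z) +
        ε ^ 2 * ∫ z, slowFactor z ^ 2) * ∫ z, (f₁ z)⁻¹ * ‖dbar a z‖ ^ 2 := by fun_prop
    have h0 := (hc.tendsto 0).mono_left (nhdsWithin_le_nhds (s := Ioi 0))
    simpa using h0
  exact ge_of_tendsto lim (eventually_nhdsWithin_of_forall fun ε hε => key ε hε)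

theorem lamMin_sq_le_mul_area {x y : ℝ} (hy : 0 < y) (h : SphereSection a b)
    (hf : SphereMetric f₁ f₂) {μ : ℝ} (he : ChartEigen f₁ a μ) (ha : a ≠ 0) :
    (nontrivialSpinTorus x y).lamMin ^ 2 ≤ μ * ∫ z, f₁ z ^ 2 := by
  have h1 := lamMin_sq_mul_le_of_sphereSection (x := x) hy h hf
  rw [h.energy_eq hf he] at h1
  have hM := h.massDensity_norm hf
  have hpos : 0 < ∫ z, f₁ z * ‖a z‖ ^ 2 := by
    obtain ⟨z, hz⟩ := Function.ne_iff.1 ha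
    refine integral_pos_of_integrable_nonneg_nonzero (x := z) hM.cont₁ hM.integrable
      (fun w => mul_nonneg (hf.pos₁ w).le (sq_nonneg _)) ?_
    exact mul_ne_zero (hf.pos₁ z).ne' (pow_ne_zero _ (norm_ne_zero_iff.2 hz))
  refine le_of_mul_le_mul_right ?_ hpos
  linarith

end Transplant

end

/-! ### Comparison of the torus with the sphere -/

theorem proposition3p1 :
    ContinuousOn (fun p : ℝ × ℝ => (nontrivialSpinTorus p.1 p.2).lamMin) moduliDomain ∧
      ∀ p ∈ moduliDomain,
        (nontrivialSpinTorus p.1 p.2).lamMin ∈ Set.Ioc 0 sphere.lamMin := by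
  refine ⟨fun p hp => (continuousAt_lamMin hp.2.2).continuousWithinAt, fun p hp => ?_⟩
  have hpos := torus_lamMin_pos (x := p.1) hp.2.2
  refine ⟨hpos, ?_⟩
  obtain ⟨f₀, hf₀⟩ := sphere_exists_isMetric
  -- It suffices to compare with each metric on the sphere separately; the round metric shows that
  -- the infimum is not taken over the empty set.
  refine le_csInf ⟨_, f₀, hf₀, rfl⟩ ?_
  rintro _ ⟨f, hf, rfl⟩
  obtain ⟨μ₀, hμ₀⟩ := sphere_exists_eigenvalue hf
  have hS := sphereMetric_of_isMetric hf
  have hA : 0 < sphere.area f := by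
    rw [sphere_area]
    exact integral_pos_of_integrable_nonneg_nonzero (x := 0) hS.areaDensity.cont₁
      hS.areaDensity.integrable (fun z => sq_nonneg _) (pow_ne_zero _ (hS.pos₁ 0).ne')
  have h1 : (nontrivialSpinTorus p.1 p.2).lamMin ^ 2 / sphere.area f ≤ sphere.firstEigenvalue f := by
    -- The estimate holds for every eigenvalue of the sphere, so a smallest eigenspinor need not be
    -- selected.
    refine le_csInf ⟨μ₀, hμ₀⟩ fun μ hμ => ?_
    obtain ⟨a, b, hs, ha, he⟩ := exists_section_of_eigenvalue hf hμ
    rw [div_le_iff₀ hA, sphere_area]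
    exact lamMin_sq_le_mul_area hp.2.2 hs hS he ha
  rw [div_le_iff₀ hA] at h1
  rw [← Real.sqrt_mul' _ hA.le]
  exact Real.le_sqrt_of_sq_le h1
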